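/- Let $d,m$ be natural numbers and write $\mathcal J_1^s$ for the real Banach space of self-adjoint trace class operators on $L^2(\mathbb R^d)$ with norm $\|A\|_1=\operatorname{tr}|A|$. Let $\mu\in\mathbb R$, $\alpha_j,\beta_j\in\mathbb C^d$, $\gamma_j\in\mathbb C$ ($1\le j\le m$), and put $$H=-\tfrac12\Delta+\tfrac12|x|^2-i\mu\,(x\cdot\nabla+\nabla\cdot x),\qquad L_j=\alpha_j\cdot x+\beta_j\cdot\nabla+\gamma_j,\qquad L_j^*=\bar\alpha_j\cdot x-\bar\beta_j\cdot\nabla+\bar\gamma_j,$$ $$Y=-iH-\tfrac12\sum_{j=1}^m L_j^*L_j,\qquad Z(\rho)=Y\rho+\rho Y^*,\qquad \mathcal L(\rho)=-i[H,\rho]+\sum_{j=1}^m\Big(L_j\rho L_j^*-\tfrac12\big(L_j^*L_j\rho+\rho L_j^*L_j\big)\Big).$$ For $\rho\in\mathcal J_1^s$ the expressions $Z(\rho)$ and $\mathcal L(\rho)$ are understood as operators $C_0^\infty(\mathbb R^d)\to\mathcal D'(\mathbb R^d)$, and "$\mathcal L(\rho)\in\mathcal J_1^s$" means that this operator is the restriction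 of an element of $\mathcal J_1^s$ (likewise for $Z$). Put $$\mathcal D(Z)=\{\rho\in\mathcal J_1^s: Z(\rho)\in\mathcal J_1^s\},\qquad \mathcal D(\mathcal L)=\{\rho\in\mathcal J_1^s:\mathcal L(\rho)\in\mathcal J_1^s\}.$$ Let $\varphi\in C_0^\infty(\mathbb R^d)$ be real with $\varphi\ge0$, $\varphi(-x)=\varphi(x)$, $\int\varphi=1$, $\operatorname{supp}\varphi\subset\{|x|<1\}$, and let $\chi:[0,\infty)\to[0,1]$ be such that $x\mapsto\chi(|x|)$ is smooth on $\mathbb R^d$, $\operatorname{supp}\chi\subset[0,1]$ and $\chi=1$ on $[0,\frac12]$. For $n\ge1$ put $\varphi_n(x)=n^d\varphi(nx)$ and $\chi_n(x)=\chi(|x|/n)$. For $g\in C_0^\infty(\mathbb R^d)$ let $M(g)f=gf$ and $C(g)f=g*f$ on $L^2(\mathbb R^d)$. Let $$\mathcal D_n=\{\sigma\in\mathcal J_1^s:\ \sigma=M(\chi_n)C(\varphi_n)\,\rho\,C(\varphi_n)M(\chi_n)\text{ for some }\rho\in\mathcal J_1^s\},\qquad \mathcal D_\infty=\bigcup_{n\ge1}\mathcal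 D_n .$$ Then: (a) $\mathcal D_\infty$ is dense in $\mathcal J_1^s$. (b) $\mathcal D_\infty\subset\mathcal D(Z)\subset\mathcal D(\mathcal L)$. (c) The closure of $\mathcal L|_{\mathcal D_\infty}$ is the maximal operator $\mathcal L$ on $\mathcal D(\mathcal L)$: operators $\rho,T$ satisfy $\rho\in\mathcal D(\mathcal L)$ and $\mathcal L(\rho)=T$ if and only if there is a sequence $(\sigma_n)\subset\mathcal D_\infty$ with $\|\rho-\sigma_n\|_1+\|T-\mathcal L(\sigma_n)\|_1\to0$. In particular, for every $\rho\in\mathcal J_1^s$ with $\mathcal L(\rho)\in\mathcal J_1^s$ there is a sequence $(\sigma_n)\subset\mathcal D_\infty$ with $\|\rho-\sigma_n\|_1+\|\mathcal L(\rho)-\mathcal L(\sigma_n)\|_1\to0$. (d) If the infinitesimal generator $G$ of a strongly continuous contraction semigroup on $\mathcal J_1^s$ is a realization of $\mathcal L$ (that is, $G\rho=\mathcal L(\rho)$ for every $\rho$ in the domain of $G$), then $G$ is the maximal operator, i.e. its domain is exactly $\mathcal D(\mathcal L)$. Thus (b) and (c) hold equally when $\mathcal D(\mathcal L)$ is read as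 the domain of such a generator. -/

import Mathlib

open MeasureTheory Filter Topology
open scoped ENNReal ContDiff InnerProductSpace Distributions Convolution

noncomputable section

namespace QuantumLindblad

/-! ### Trace class operators on a complex Hilbert space -/

section TraceClass

variable {H : Type*} [NormedAddCommGroup H] [InnerProductSpace ℂ H] [CompleteSpace H]

/-- The trace of a positive operator `T`, with values in `[0, ∞]`: the supremum of
`∑ ⟨v, T v⟩` over all finite orthonormal systems. It is the sum over any orthonormal basis, see
`posTrace_eq_tsum`. -/
def posTrace (T : H →L[ℂ] H) : ℝ≥0∞ :=
  ⨆ (s : Finset H) (_ : Orthonormal ℂ (fun v : s => (v : H))),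
    ∑ v ∈ s, ENNReal.ofReal (Complex.re ⟪v, T v⟫_ℂ)

/-- For a positive operator, `posTrace` is the usual trace, computed in any orthonormal basis. -/
theorem posTrace_eq_tsum {ι : Type*} (b : HilbertBasis ι ℂ H) {T : H →L[ℂ] H} (hT : 0 ≤ T) :
    posTrace T = ∑' i, ENNReal.ofReal (Complex.re ⟪b i, T (b i)⟫_ℂ) := by
  classical
  have hS : IsSelfAdjoint (CFC.sqrt T) := (CFC.sqrt_nonneg T).isSelfAdjoint
  have hadj : ∀ u v : H, ⟪CFC.sqrt T u, v⟫_ℂ = ⟪u, CFC.sqrt T v⟫_ℂ := fun u v => by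
    rw [← ContinuousLinearMap.adjoint_inner_right, ← ContinuousLinearMap.star_eq_adjoint,
      hS.star_eq]
  have hq : ∀ v : H, Complex.re ⟪v, T v⟫_ℂ = ‖CFC.sqrt T v‖ ^ 2 := fun v => by
    have h : T v = CFC.sqrt T (CFC.sqrt T v) := by
      rw [← mul_apply_eq_comp, CFC.sqrt_mul_sqrt_self T hT]
    rw [h, ← hadj]
    exact inner_self_eq_norm_sq (𝕜 := ℂ) _
  have hpar : ∀ v : H, ENNReal.ofReal (‖CFC.sqrt T v‖ ^ 2)
      = ∑' i, ENNReal.ofReal (‖⟪v, CFC.sqrt T (b i)⟫_ℂ‖ ^ 2) := fun v => by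
    have h := b.hasSum_inner_mul_inner (CFC.sqrt T v) (CFC.sqrt T v)
    have h' : HasSum (fun i => ‖⟪v, CFC.sqrt T (b i)⟫_ℂ‖ ^ 2) (‖CFC.sqrt T v‖ ^ 2) := by
      rw [← inner_self_eq_norm_sq (𝕜 := ℂ)]
      have hre := Complex.hasSum_re h
      have he : ∀ i, (⟪CFC.sqrt T v, b i⟫_ℂ * ⟪b i, CFC.sqrt T v⟫_ℂ).re
          = ‖⟪v, CFC.sqrt T (b i)⟫_ℂ‖ ^ 2 := fun i => by
        rw [← inner_conj_symm (CFC.sqrt T v) (b i), ← Complex.normSq_eq_conj_mul_self,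
          Complex.ofReal_re, Complex.normSq_eq_norm_sq, ← hadj, norm_inner_symm]
      simp only [he] at hre
      exact hre
    rw [← h'.tsum_eq, ENNReal.ofReal_tsum_of_nonneg (fun _ => by positivity) h'.summable]
  simp only [posTrace, hq]
  refine le_antisymm (iSup₂_le fun s hs => ?_) ?_
  · rw [Finset.sum_congr rfl fun v _ => hpar v,
      ← (Summable.tsum_finsetSum fun _ _ => ENNReal.summable)]
    refine ENNReal.tsum_le_tsum fun i => ?_
    rw [← ENNReal.ofReal_sum_of_nonneg fun _ _ => by positivity]
    refine ENNReal.ofReal_le_ofReal ?_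
    have := hs.sum_inner_products_le (CFC.sqrt T (b i)) (s := Finset.univ)
    rw [← Finset.sum_coe_sort s]
    exact this
  · rw [ENNReal.tsum_eq_iSup_sum]
    refine iSup_le fun t => ?_
    have hinj : Function.Injective b := b.orthonormal.linearIndependent.injective
    have ho : Orthonormal ℂ (fun v : (t.image b : Finset H) => (v : H)) := by
      have hb := b.orthonormal.toSubtypeRange
      exact hb.comp (fun v : (t.image b : Finset H) => ⟨v.1, by
        obtain ⟨i, _, hi⟩ := Finset.mem_image.1 v.2
        exact ⟨i, hi⟩⟩) fun v w h => by
        have h' := congrArg (fun z : Set.range b => (z : H)) h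
        exact Subtype.ext h'
    refine le_trans (le_of_eq ?_) (le_iSup₂ (t.image b) ho)
    rw [Finset.sum_image hinj.injOn]

/-- The trace norm `tr |A|`, with `|A| = (A* A)^{1/2}`; it is `∞` if `A` is not trace class. -/
def traceNorm (A : H →L[ℂ] H) : ℝ≥0∞ := posTrace (CFC.abs A)

variable (H) in
/-- The space of self-adjoint trace class operators. -/
def selfAdjointTraceClass : Set (H →L[ℂ] H) :=
  {A | IsSelfAdjoint A ∧ traceNorm A ≠ ⊤}

end TraceClass

/-! ### The Hilbert space `L²(ℝᵈ)` and test functions -/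

/-- Euclidean space `ℝᵈ`. -/
abbrev Space (d : ℕ) : Type := EuclideanSpace ℝ (Fin d)

/-- The complex Hilbert space `L²(ℝᵈ)`. -/
abbrev L2 (d : ℕ) : Type := Lp ℂ 2 (volume : Measure (Space d))

/-- Bounded operators on `L²(ℝᵈ)`. -/
abbrev BoundedOp (d : ℕ) : Type := L2 d →L[ℂ] L2 d

/-- Smooth, compactly supported, complex-valued functions on `ℝᵈ`. -/
abbrev Test (d : ℕ) : Type := 𝓓((⊤ : TopologicalSpace.Opens (Space d)), ℂ)

variable {d m : ℕ}

theorem Test.smooth (f : Test d) : ContDiff ℝ ∞ f :=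
  TestFunctionClass.map_contDiff f

theorem Test.compactSupport (f : Test d) : HasCompactSupport f :=
  TestFunctionClass.map_hasCompactSupport f

theorem Test.cont (f : Test d) : Continuous f := f.smooth.continuous

theorem Test.memLp (f : Test d) (p : ℝ≥0∞) : MemLp f p (volume : Measure (Space d)) :=
  f.cont.memLp_of_hasCompactSupport f.compactSupport

/-- A test function as an element of `L²(ℝᵈ)`. -/
def Test.toL2 (f : Test d) : L2 d := (f.memLp 2).toLp f

/-! ### Multiplication and convolution operators -/

theorem memLp_mul (g : Test d) (f : L2 d) :
    MemLp (fun x => g x * f x) 2 (volume : Measure (Space d)) :=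
  (Lp.memLp f).mul (g.memLp ⊤)

theorem exists_bound (g : Test d) : ∃ c : ℝ, ∀ x, ‖g x‖ ≤ c :=
  g.compactSupport.exists_bound_of_continuous g.cont

/-- The multiplication operator `M(g)`, `(M(g) f)(x) = g(x) f(x)`. -/
def mulOp (g : Test d) : BoundedOp d :=
  LinearMap.mkContinuousOfExistsBound
    { toFun := fun f => (memLp_mul g f).toLp _
      map_add' := by
        intro f₁ f₂
        rw [← MemLp.toLp_add]
        refine MemLp.toLp_congr _ _ ?_
        filter_upwards [Lp.coeFn_add f₁ f₂] with x hx
        simp only [Pi.add_apply, hx, mul_add]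
      map_smul' := by
        intro c f
        rw [RingHom.id_apply, ← MemLp.toLp_const_smul]
        refine MemLp.toLp_congr _ _ ?_
        filter_upwards [Lp.coeFn_smul c f] with x hx
        simp only [Pi.smul_apply, hx, smul_eq_mul, mul_left_comm] }
    (by
      obtain ⟨c, hc⟩ := exists_bound g
      refine ⟨c, fun f => ?_⟩
      refine Lp.norm_le_mul_norm_of_ae_le_mul ?_
      filter_upwards [(memLp_mul g f).coeFn_toLp] with x hx
      have : ‖g x * f x‖ ≤ c * ‖f x‖ := by
        rw [norm_mul]
        exact mul_le_mul_of_nonneg_right (hc x) (norm_nonneg _)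
      simpa [hx] using this)

/-- The convolution `g ∗ f` of a test function and a function. -/
def convolve (g : Test d) (f : Space d → ℂ) : Space d → ℂ :=
  g ⋆[ContinuousLinearMap.mul ℂ ℂ, volume] f

theorem locInt (f : L2 d) : LocallyIntegrable f (volume : Measure (Space d)) :=
  (Lp.memLp f).locallyIntegrable (by norm_num)

theorem conv_exists (g : Test d) (f : L2 d) :
    ConvolutionExists g f (ContinuousLinearMap.mul ℂ ℂ) (volume : Measure (Space d)) :=
  g.compactSupport.convolutionExists_left _ g.cont (locInt f)

theorem conv_continuous (g : Test d) (f : L2 d) : Continuous (convolve g f) :=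
  g.compactSupport.continuous_convolution_left _ g.cont (locInt f)

/-- Pointwise Cauchy--Schwarz bound behind Young's inequality `‖g ∗ f‖₂ ≤ ‖g‖₁ ‖f‖₂`. -/
theorem enorm_conv_sq_le (g : Test d) (f : L2 d) (x : Space d) :
    ‖convolve g f x‖ₑ ^ 2 ≤ (∫⁻ t, ‖g t‖ₑ) * ∫⁻ t, ‖g t‖ₑ * ‖f (x - t)‖ₑ ^ 2 := by
  have hf : AEStronglyMeasurable f (volume : Measure (Space d)) := (Lp.memLp f).1
  have hf' : AEMeasurable (fun t => ‖f (x - t)‖ₑ) (volume : Measure (Space d)) :=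
    (hf.comp_quasiMeasurePreserving
      (quasiMeasurePreserving_sub_left (volume : Measure (Space d)) x)).enorm
  have hg : Measurable (fun t => ‖g t‖ₑ) := g.cont.measurable.enorm
  have h1 : ‖convolve g f x‖ₑ ≤ ∫⁻ t, ‖g t‖ₑ * ‖f (x - t)‖ₑ := by
    refine (enorm_integral_le_lintegral_enorm _).trans (le_of_eq ?_)
    simp [enorm_mul]
  have hs : ∀ a : ℝ≥0∞, (a ^ (1 / 2 : ℝ)) ^ (2 : ℝ) = a := fun a => by
    rw [← ENNReal.rpow_mul]; norm_num
  have hm : ∀ a : ℝ≥0∞, a ^ (1 / 2 : ℝ) * a ^ (1 / 2 : ℝ) = a := fun a => by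
    rw [← ENNReal.rpow_add_of_nonneg _ _ (by norm_num) (by norm_num)]; norm_num
  have h2 := ENNReal.lintegral_mul_le_Lp_mul_Lq (volume : Measure (Space d))
    Real.HolderConjugate.two_two
    (f := fun t => ‖g t‖ₑ ^ (1 / 2 : ℝ)) (g := fun t => ‖g t‖ₑ ^ (1 / 2 : ℝ) * ‖f (x - t)‖ₑ)
    (hg.pow_const _).aemeasurable ((hg.pow_const _).aemeasurable.mul hf')
  simp only [Pi.mul_apply, ← mul_assoc, hm, hs, ENNReal.mul_rpow_of_nonneg _ _ zero_le_two] at h2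
  have h3 := ENNReal.rpow_le_rpow (h1.trans h2) zero_le_two
  rw [ENNReal.mul_rpow_of_nonneg _ _ zero_le_two, hs, hs] at h3
  simpa only [ENNReal.rpow_two] using h3

theorem lintegral_conv_sq_le (g : Test d) (f : L2 d) :
    ∫⁻ x, ‖convolve g f x‖ₑ ^ 2 ≤ (∫⁻ t, ‖g t‖ₑ) ^ 2 * ∫⁻ x, ‖f x‖ₑ ^ 2 := by
  have hf : AEStronglyMeasurable f (volume : Measure (Space d)) := (Lp.memLp f).1
  have hg : Measurable (fun t => ‖g t‖ₑ) := g.cont.measurable.enorm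
  have hgf : (∫⁻ t, ‖g t‖ₑ) ≠ ⊤ :=
    (g.cont.integrable_of_hasCompactSupport g.compactSupport).2.ne
  have hq : AEMeasurable (fun p : Space d × Space d => ‖g p.2‖ₑ * ‖f (p.1 - p.2)‖ₑ ^ 2)
      (volume.prod volume) := by
    refine (hg.comp measurable_snd).aemeasurable.mul (AEMeasurable.pow_const ?_ 2)
    exact (hf.comp_quasiMeasurePreserving
      (quasiMeasurePreserving_sub (volume : Measure (Space d)) volume)).enorm
  calc ∫⁻ x, ‖convolve g f x‖ₑ ^ 2
      ≤ ∫⁻ x, (∫⁻ t, ‖g t‖ₑ) * ∫⁻ t, ‖g t‖ₑ * ‖f (x - t)‖ₑ ^ 2 :=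
        lintegral_mono fun x => enorm_conv_sq_le g f x
    _ = (∫⁻ t, ‖g t‖ₑ) * ∫⁻ x, ∫⁻ t, ‖g t‖ₑ * ‖f (x - t)‖ₑ ^ 2 :=
        lintegral_const_mul' _ _ hgf
    _ = (∫⁻ t, ‖g t‖ₑ) * ∫⁻ t, ∫⁻ x, ‖g t‖ₑ * ‖f (x - t)‖ₑ ^ 2 := by
        rw [lintegral_lintegral_swap hq]
    _ = (∫⁻ t, ‖g t‖ₑ) * ∫⁻ t, ‖g t‖ₑ * ∫⁻ x, ‖f x‖ₑ ^ 2 := by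
        congr 1
        refine lintegral_congr fun t => ?_
        rw [lintegral_const_mul' _ _ enorm_ne_top,
          lintegral_sub_right_eq_self (fun x => ‖f x‖ₑ ^ 2) t]
    _ = (∫⁻ t, ‖g t‖ₑ) ^ 2 * ∫⁻ x, ‖f x‖ₑ ^ 2 := by
        rw [lintegral_mul_const _ hg, ← mul_assoc, sq]

theorem eLpNorm_two_sq (u : Space d → ℂ) :
    eLpNorm u 2 volume ^ 2 = ∫⁻ x, ‖u x‖ₑ ^ 2 := by
  rw [eLpNorm_eq_lintegral_rpow_enorm_toReal (by norm_num) (by norm_num)]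
  simp only [ENNReal.toReal_ofNat, ENNReal.rpow_two]
  rw [← ENNReal.rpow_two, ← ENNReal.rpow_mul]
  norm_num

theorem eLpNorm_conv_le (g : Test d) (f : L2 d) :
    eLpNorm (convolve g f) 2 volume ≤ (∫⁻ t, ‖g t‖ₑ) * eLpNorm f 2 volume := by
  rw [← ENNReal.pow_le_pow_left_iff two_ne_zero, mul_pow, eLpNorm_two_sq, eLpNorm_two_sq]
  exact lintegral_conv_sq_le g f

theorem lintegral_enorm_ne_top (g : Test d) : (∫⁻ t, ‖g t‖ₑ) ≠ ⊤ :=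
  (g.cont.integrable_of_hasCompactSupport g.compactSupport).2.ne

theorem memLp_conv (g : Test d) (f : L2 d) :
    MemLp (convolve g f) 2 (volume : Measure (Space d)) :=
  ⟨(conv_continuous g f).aestronglyMeasurable,
    (eLpNorm_conv_le g f).trans_lt
      (ENNReal.mul_lt_top (lintegral_enorm_ne_top g).lt_top (Lp.memLp f).2)⟩

theorem conv_congr (g : Test d) {f₁ f₂ : Space d → ℂ} (h : f₁ =ᵐ[volume] f₂) :
    convolve g f₁ = convolve g f₂ :=
  convolution_congr _ Filter.EventuallyEq.rfl h

/-- The convolution operator `C(g)`, `C(g) f = g ∗ f`. -/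
def convOp (g : Test d) : BoundedOp d :=
  LinearMap.mkContinuousOfExistsBound
    { toFun := fun f => (memLp_conv g f).toLp _
      map_add' := by
        intro f₁ f₂
        rw [← MemLp.toLp_add]
        refine MemLp.toLp_congr _ _ (Filter.Eventually.of_forall fun x => ?_)
        rw [conv_congr g (Lp.coeFn_add f₁ f₂)]
        exact congrFun ((conv_exists g f₁).distrib_add (conv_exists g f₂)) x
      map_smul' := by
        intro c f
        rw [RingHom.id_apply, ← MemLp.toLp_const_smul]
        refine MemLp.toLp_congr _ _ (Filter.Eventually.of_forall fun x => ?_)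
        rw [conv_congr g (Lp.coeFn_smul c f)]
        exact congrFun convolution_smul x }
    (by
      refine ⟨(∫⁻ t, ‖g t‖ₑ).toReal, fun f => ?_⟩
      have h := ENNReal.toReal_mono
        (ENNReal.mul_ne_top (lintegral_enorm_ne_top g) (Lp.memLp f).2.ne) (eLpNorm_conv_le g f)
      rw [ENNReal.toReal_mul] at h
      rw [LinearMap.coe_mk, AddHom.coe_mk, Lp.norm_toLp, Lp.norm_def]
      exact h)

/-! ### Mollifiers, cut-offs, and the set `𝒟_∞` -/

/-- A mollifier profile: `φ ∈ C₀^∞(ℝᵈ)`, `φ ≥ 0`, `φ(-x) = φ(x)`, `∫ φ = 1`,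
`supp φ ⊂ {|x| < 1}`. -/
structure Mollifier (d : ℕ) where
  toFun : Space d → ℝ
  smooth : ContDiff ℝ ∞ toFun
  nonneg : ∀ x, 0 ≤ toFun x
  even : ∀ x, toFun (-x) = toFun x
  integral_eq_one : ∫ x, toFun x = 1
  tsupport_subset : tsupport toFun ⊆ Metric.ball 0 1

/-- A radial cut-off profile `χ : [0, ∞) → [0, 1]`: `x ↦ χ(|x|)` is smooth on `ℝᵈ`,
`supp χ ⊂ [0, 1]`, and `χ = 1` on `[0, 1/2]`. Values of `toFun` on negative numbers play no
role. -/
structure Cutoff (d : ℕ) where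
  toFun : ℝ → ℝ
  smooth : ContDiff ℝ ∞ (fun x : Space d => toFun ‖x‖)
  nonneg : ∀ r, 0 ≤ r → 0 ≤ toFun r
  le_one : ∀ r, 0 ≤ r → toFun r ≤ 1
  eq_zero : ∀ r, 1 < r → toFun r = 0
  eq_one : ∀ r, 0 ≤ r → r ≤ 1 / 2 → toFun r = 1

/-- `φ_n(x) = n^d φ(n x)`. -/
def Mollifier.scaled (φ : Mollifier d) (n : ℕ+) : Test d where
  toFun x := (((n : ℝ) ^ d * φ.toFun ((n : ℝ) • x) : ℝ) : ℂ)
  contDiff' := Complex.ofRealCLM.contDiff.comp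
    (contDiff_const.mul (φ.smooth.comp (contDiff_const_smul _)))
  hasCompactSupport' := by
    refine HasCompactSupport.intro (isCompact_closedBall (0 : Space d) 1) fun x hx => ?_
    have hn : (1 : ℝ) ≤ n := by exact_mod_cast n.pos
    have : φ.toFun ((n : ℝ) • x) = 0 := by
      by_contra h
      have h' := φ.tsupport_subset (subset_tsupport _ (Function.mem_support.2 h))
      simp only [Metric.mem_closedBall, dist_zero_right, Metric.mem_ball, norm_smul,
        Real.norm_natCast, not_le] at hx h'
      nlinarith
    simp [this]
  tsupport_subset' := fun _ _ => trivial

/-- `χ_n(x) = χ(|x| / n)`. -/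
def Cutoff.scaled (χ : Cutoff d) (n : ℕ+) : Test d where
  toFun x := ((χ.toFun (‖x‖ / n) : ℝ) : ℂ)
  contDiff' := by
    have h := Complex.ofRealCLM.contDiff.comp
      (χ.smooth.comp (contDiff_const_smul ((n : ℝ)⁻¹)))
    have he : (fun x : Space d => ((χ.toFun (‖x‖ / n) : ℝ) : ℂ)) =
        Complex.ofRealCLM ∘ (fun x : Space d => χ.toFun ‖x‖) ∘ fun x => ((n : ℝ)⁻¹) • x := by
      ext x
      simp [norm_smul, div_eq_inv_mul]
    rw [he]
    exact h
  hasCompactSupport' := by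
    refine HasCompactSupport.intro (isCompact_closedBall (0 : Space d) n) fun x hx => ?_
    have hn : (0 : ℝ) < n := by exact_mod_cast n.pos
    simp only [Metric.mem_closedBall, dist_zero_right, not_le] at hx
    rw [χ.eq_zero _ ((one_lt_div hn).2 hx), Complex.ofReal_zero]
  tsupport_subset' := fun _ _ => trivial

/-- `𝒟_n`: the self-adjoint trace class operators of the form
`M(χ_n) C(φ_n) ρ C(φ_n) M(χ_n)` with `ρ` self-adjoint and trace class. -/
def mollifiedOps (φ : Mollifier d) (χ : Cutoff d) (n : ℕ+) : Set (BoundedOp d) :=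
  {σ | σ ∈ selfAdjointTraceClass (L2 d) ∧ ∃ ρ ∈ selfAdjointTraceClass (L2 d),
    σ = mulOp (χ.scaled n) ∘L convOp (φ.scaled n) ∘L ρ ∘L
      convOp (φ.scaled n) ∘L mulOp (χ.scaled n)}

/-- `𝒟_∞ = ⋃_n 𝒟_n`. -/
def allMollifiedOps (φ : Mollifier d) (χ : Cutoff d) : Set (BoundedOp d) :=
  ⋃ n : ℕ+, mollifiedOps φ χ n

/-! ### Differential operators on test functions -/

/-- Multiplication by the coordinate `x_k`. -/
def pos (k : Fin d) (f : Test d) : Test d where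
  toFun x := ((x k : ℝ) : ℂ) * f x
  contDiff' := by
    have h : ContDiff ℝ ∞ (fun x : Space d => x k) :=
      (EuclideanSpace.proj (𝕜 := ℝ) k).contDiff
    exact (Complex.ofRealCLM.contDiff.comp h).mul f.smooth
  hasCompactSupport' := f.compactSupport.mul_left
  tsupport_subset' := fun _ _ => trivial

/-- The partial derivative `∂_k`. -/
def der (k : Fin d) (f : Test d) : Test d :=
  LineDeriv.lineDerivOp (EuclideanSpace.single k (1 : ℝ)) f

/-- The coefficients of the model: the real number `μ` in the Hamiltonian and the coefficients of
the `m` Lindblad operators `L_j = α_j · x + β_j · ∇ + γ_j`. -/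
structure Coefficients (d m : ℕ) where
  μ : ℝ
  α : Fin m → Fin d → ℂ
  β : Fin m → Fin d → ℂ
  γ : Fin m → ℂ

namespace Coefficients

variable (Q : Coefficients d m)

/-- `H = -Δ/2 + |x|²/2 - i μ [x, ∇]₊`, with `[x, ∇]₊ = x · ∇ + ∇ · x`. -/
def hamiltonian (f : Test d) : Test d :=
  -((1 / 2 : ℂ) • ∑ k, der k (der k f)) + (1 / 2 : ℂ) • ∑ k, pos k (pos k f)
    - (Complex.I * Q.μ) • ∑ k, (pos k (der k f) + der k (pos k f))

/-- `L_j = α_j · x + β_j · ∇ + γ_j`. -/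
def lindblad (j : Fin m) (f : Test d) : Test d :=
  ∑ k, (Q.α j k • pos k f + Q.β j k • der k f) + Q.γ j • f

/-- `L_j^* = ᾱ_j · x - β̄_j · ∇ + γ̄_j`. -/
def lindbladAdj (j : Fin m) (f : Test d) : Test d :=
  ∑ k, (star (Q.α j k) • pos k f - star (Q.β j k) • der k f) + star (Q.γ j) • f

/-- `L_j^* L_j`. -/
def lindbladSq (j : Fin m) (f : Test d) : Test d := Q.lindbladAdj j (Q.lindblad j f)

/-- `Y^* = iH - L/2`, the formal adjoint of `Y = -iH - L/2`, where `L = ∑ L_j^* L_j`. -/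
def yAdj (f : Test d) : Test d :=
  Complex.I • Q.hamiltonian f - (1 / 2 : ℂ) • ∑ j, Q.lindbladSq j f

/-- `Z(ρ) = T`, where `Z(ρ) = Yρ + ρY^*` is understood as an operator from test functions to
distributions: `⟨f, Z(ρ) g⟩ = ⟨Y^* f, ρ g⟩ + ⟨f, ρ Y^* g⟩`. -/
def ZEq (ρ T : BoundedOp d) : Prop :=
  ∀ f g : Test d, ⟪f.toL2, T g.toL2⟫_ℂ =
    ⟪(Q.yAdj f).toL2, ρ g.toL2⟫_ℂ + ⟪f.toL2, ρ (Q.yAdj g).toL2⟫_ℂ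

/-- `𝓛(ρ) = T`, where
`𝓛(ρ) = -i[H, ρ] + ∑ (L_j ρ L_j^* - (L_j^* L_j ρ + ρ L_j^* L_j) / 2)` is understood as an operator
from test functions to distributions; operators acting from the left on `ρ` are moved onto the
test function `f` as their formal adjoints. -/
def LEq (ρ T : BoundedOp d) : Prop :=
  ∀ f g : Test d, ⟪f.toL2, T g.toL2⟫_ℂ =
    -Complex.I * (⟪(Q.hamiltonian f).toL2, ρ g.toL2⟫_ℂ - ⟪f.toL2, ρ (Q.hamiltonian g).toL2⟫_ℂ)
    + ∑ j, (⟪(Q.lindbladAdj j f).toL2, ρ (Q.lindbladAdj j g).toL2⟫_ℂ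
      - (1 / 2 : ℂ) * (⟪(Q.lindbladSq j f).toL2, ρ g.toL2⟫_ℂ
        + ⟪f.toL2, ρ (Q.lindbladSq j g).toL2⟫_ℂ))

/-- `𝒟(Z)`: all `ρ ∈ 𝒥₁ˢ` with `Z(ρ) ∈ 𝒥₁ˢ`. -/
def domZ : Set (BoundedOp d) :=
  {ρ | ρ ∈ selfAdjointTraceClass (L2 d) ∧ ∃ T ∈ selfAdjointTraceClass (L2 d), Q.ZEq ρ T}

/-- The graph of the maximal operator `𝓛` in `𝒥₁ˢ`: all `(ρ, T)` with `ρ, T ∈ 𝒥₁ˢ` and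
`𝓛(ρ) = T`. -/
def maxGraph : Set (BoundedOp d × BoundedOp d) :=
  {p | p.1 ∈ selfAdjointTraceClass (L2 d) ∧ p.2 ∈ selfAdjointTraceClass (L2 d) ∧
    Q.LEq p.1 p.2}

/-- `𝒟(𝓛)`: all `ρ ∈ 𝒥₁ˢ` with `𝓛(ρ) ∈ 𝒥₁ˢ`. -/
def domL : Set (BoundedOp d) := {ρ | ∃ T, (ρ, T) ∈ Q.maxGraph}

end Coefficients

/-! ### Contraction semigroups on `𝒥₁ˢ` -/

/-- `Φ_t`, `t ≥ 0`, is a strongly continuous semigroup of linear contractions on the real Banach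
space `𝒥₁ˢ` with the trace norm. -/
structure IsContractionSemigroup (Φ : ℝ → BoundedOp d → BoundedOp d) : Prop where
  mem : ∀ t, 0 ≤ t → ∀ ρ ∈ selfAdjointTraceClass (L2 d), Φ t ρ ∈ selfAdjointTraceClass (L2 d)
  map_add : ∀ t, 0 ≤ t → ∀ ρ ∈ selfAdjointTraceClass (L2 d),
    ∀ σ ∈ selfAdjointTraceClass (L2 d), Φ t (ρ + σ) = Φ t ρ + Φ t σ
  map_smul : ∀ t, 0 ≤ t → ∀ c : ℝ, ∀ ρ ∈ selfAdjointTraceClass (L2 d), Φ t (c • ρ) = c • Φ t ρ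
  zero : ∀ ρ ∈ selfAdjointTraceClass (L2 d), Φ 0 ρ = ρ
  add : ∀ s t, 0 ≤ s → 0 ≤ t → ∀ ρ ∈ selfAdjointTraceClass (L2 d), Φ (s + t) ρ = Φ s (Φ t ρ)
  contraction : ∀ t, 0 ≤ t → ∀ ρ ∈ selfAdjointTraceClass (L2 d),
    traceNorm (Φ t ρ) ≤ traceNorm ρ
  continuous : ∀ ρ ∈ selfAdjointTraceClass (L2 d),
    Tendsto (fun t => traceNorm (Φ t ρ - ρ)) (𝓝[>] 0) (𝓝 0)

/-- The graph of the infinitesimal generator of `Φ`: all `(ρ, T)` in `𝒥₁ˢ × 𝒥₁ˢ` with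
`(Φ_t ρ - ρ) / t → T` in trace norm as `t ↓ 0`. -/
def generatorGraph (Φ : ℝ → BoundedOp d → BoundedOp d) : Set (BoundedOp d × BoundedOp d) :=
  {p | p.1 ∈ selfAdjointTraceClass (L2 d) ∧ p.2 ∈ selfAdjointTraceClass (L2 d) ∧
    Tendsto (fun t : ℝ => traceNorm (t⁻¹ • (Φ t p.1 - p.1) - p.2)) (𝓝[>] 0) (𝓝 0)}

end QuantumLindblad

end

open QuantumLindblad

/-!
The maximal operator `𝓛` turns out to be the closure of its restriction to smoothed operators, and
it is dissipative enough for `1 - 𝓛` to be injective. Both facts rest on the dual description of the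
trace norm on self-adjoint operators as the supremum `nuc` of `|∑ ⟨u i, A (v i)⟩|` over finite
Bessel families (`traceNorm_eq_nuc`). It is manifestly subadditive and lower semicontinuous, and it
is the quantity in which all estimates are carried out.

*Smoothing.* With `b_n = C(φ_n) M(χ_n)` the elements of `𝒟_n` are the operators `b_n* ρ b_n`. Since
`b_n* → 1` strongly, these converge to `ρ` in trace norm, which gives density. The products of `b_n`
with polynomials in `x_k` and `∂_k` from the right are bounded, so `𝓛` and `Z` are defined on `𝒟_n`.
The core statement is a Friedrichs lemma (`tendsto_nuc_sub_formOp`): if `𝓛(ρ) = T`, then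
`𝓛(b_n* ρ b_n) → T`. The operators `b_n` belong to the family `W_n(g, h) f = g_n ∗ (h_n f)`, and the
scales are matched: commutators with first order operators are `O(1 / n)`, while first order
operators times `W_n` are `o(n)`. Hence the adjoints of the commutators with second order operators
tend to `0` strongly (`commutator_mem_smallFamilies`), and the mixed terms that come from
`L_j ρ L_j*` tend to `0` in trace norm.

*The jump part.* Inside `b_n* ρ b_n` one may replace `ρ` by a finite-rank operator, which shows that
finite-rank operators `σ` built from test functions form a core for `Z` and for `𝓛`. Such a `σ`
can be diagonalized with eigenfunctions that are test functions again. Pairing `Z(σ)` with the signs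
of the eigenvalues and using `2 Re ⟨Y* f, f⟩ = - ∑ ‖L_j f‖²` yields
`‖∑ L_j σ L_j*‖₁ ≤ ‖Z(σ)‖₁` and `‖σ‖₁ ≤ ‖σ - 𝓛(σ)‖₁` (`Coefficients.exists_jumpPart`). The first
inequality extends to limits and gives `𝒟(Z) ⊆ 𝒟(𝓛)`; the second one, extended to the maximal
operator by means of the core, shows that `1 - 𝓛` is injective.

*Generators.* For a generator `G` of a contraction semigroup the Laplace transform solves
`x - G x = y` (`exists_generator_resolvent`), where the completeness of the self-adjoint trace class
operators is used. If `G ⊆ 𝓛`, then `1 - 𝓛` is an injective extension of the surjective operator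
`1 - G`, hence `G = 𝓛`.
-/

noncomputable section

namespace QuantumLindblad

/-! ### Bessel families and the nuclear norm -/

section Nuclear

universe u
variable {H : Type u} [NormedAddCommGroup H] [InnerProductSpace ℂ H]

/-- A finite family `u` is Bessel with constant `a` if `∑ |⟨u i, x⟩|² ≤ a² ‖x‖²` for all `x`. -/
def IsBessel {ι : Type*} [Fintype ι] (a : ℝ) (u : ι → H) : Prop :=
  ∀ x, ∑ i, ‖⟪u i, x⟫_ℂ‖ ^ 2 ≤ a ^ 2 * ‖x‖ ^ 2

theorem Orthonormal.isBessel {ι : Type*} [Fintype ι] {u : ι → H} (hu : Orthonormal ℂ u) :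
    IsBessel 1 u := fun x => by
  rw [one_pow, one_mul]
  exact hu.sum_inner_products_le x

theorem IsBessel.comp_equiv {ι κ : Type*} [Fintype ι] [Fintype κ] {a : ℝ} {u : ι → H}
    (hu : IsBessel a u) (e : κ ≃ ι) : IsBessel a (u ∘ e) := fun x => by
  refine le_trans (le_of_eq ?_) (hu x)
  exact e.sum_comp fun i => ‖⟪u i, x⟫_ℂ‖ ^ 2

theorem IsBessel.smul {ι : Type*} [Fintype ι] {a : ℝ} {u : ι → H} (hu : IsBessel a u) (c : ℝ) :
    IsBessel (c * a) fun i => (c : ℂ) • u i := fun x => by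
  simp only [inner_smul_left, norm_mul, mul_pow, ← Finset.mul_sum]
  have := mul_le_mul_of_nonneg_left (hu x) (sq_nonneg c)
  simpa [mul_assoc] using this

/-- The nuclear norm of `A`: the supremum of `|∑ ⟨u i, A (v i)⟩|` over all pairs of finite Bessel
families with constant `1`. As a supremum of functionals which are continuous in the operator
norm it is subadditive and lower semicontinuous, and on self-adjoint operators it is the trace
norm, see `traceNorm_eq_nuc`. -/
def nuc (A : H →L[ℂ] H) : ℝ≥0∞ :=
  ⨆ (n : ℕ) (u : Fin n → H) (v : Fin n → H) (_ : IsBessel 1 u) (_ : IsBessel 1 v),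
    ‖∑ i, ⟪u i, A (v i)⟫_ℂ‖ₑ

theorem nuc_le_iff {A : H →L[ℂ] H} {c : ℝ≥0∞} : nuc A ≤ c ↔
    ∀ (n : ℕ) (u v : Fin n → H), IsBessel 1 u → IsBessel 1 v → ‖∑ i, ⟪u i, A (v i)⟫_ℂ‖ₑ ≤ c := by
  simp only [nuc, iSup_le_iff]

theorem enorm_sum_le_nuc_one {ι : Type*} [Fintype ι] (A : H →L[ℂ] H) {u v : ι → H}
    (hu : IsBessel 1 u) (hv : IsBessel 1 v) : ‖∑ i, ⟪u i, A (v i)⟫_ℂ‖ₑ ≤ nuc A := by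
  have e := (Fintype.equivFin ι).symm
  have := nuc_le_iff.1 (le_refl (nuc A)) _ _ _ (hu.comp_equiv e) (hv.comp_equiv e)
  refine le_trans (le_of_eq ?_) this
  congr 1
  exact (e.sum_comp fun i => ⟪u i, A (v i)⟫_ℂ).symm

theorem enorm_sum_le_nuc {ι : Type*} [Fintype ι] (A : H →L[ℂ] H) {a b : ℝ} (ha : 0 ≤ a)
    (hb : 0 ≤ b) {u v : ι → H} (hu : IsBessel a u) (hv : IsBessel b v) :
    ‖∑ i, ⟪u i, A (v i)⟫_ℂ‖ₑ ≤ ENNReal.ofReal a * ENNReal.ofReal b * nuc A := by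
  -- a family with Bessel constant `0` vanishes
  have key : ∀ {w : ι → H}, IsBessel 0 w → ∀ i, w i = 0 := by
    intro w hw i
    have h := hw (w i)
    have h1 := Finset.single_le_sum (f := fun j => ‖⟪w j, w i⟫_ℂ‖ ^ 2)
      (fun _ _ => sq_nonneg _) (Finset.mem_univ i)
    have h2 : ‖⟪w i, w i⟫_ℂ‖ ^ 2 ≤ 0 := by
      refine h1.trans (h.trans ?_)
      simp
    have h3 : ⟪w i, w i⟫_ℂ = 0 := by
      rw [← norm_eq_zero]
      exact pow_eq_zero_iff two_ne_zero |>.1 (le_antisymm h2 (sq_nonneg _))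
    exact inner_self_eq_zero.1 h3
  rcases ha.eq_or_lt with ha0 | ha0
  · subst ha0
    simp [key hu]
  rcases hb.eq_or_lt with hb0 | hb0
  · subst hb0
    simp [key hv]
  have hu' := hu.smul a⁻¹
  have hv' := hv.smul b⁻¹
  rw [inv_mul_cancel₀ ha0.ne'] at hu'
  rw [inv_mul_cancel₀ hb0.ne'] at hv'
  have h := enorm_sum_le_nuc_one A hu' hv'
  have he : ∑ i, ⟪u i, A (v i)⟫_ℂ
      = ((a : ℂ) * b) * ∑ i, ⟪((a⁻¹ : ℝ) : ℂ) • u i, A (((b⁻¹ : ℝ) : ℂ) • v i)⟫_ℂ := by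
    rw [Finset.mul_sum]
    refine Finset.sum_congr rfl fun i _ => ?_
    have ha1 : (a : ℂ) ≠ 0 := by exact_mod_cast ha0.ne'
    have hb1 : (b : ℂ) ≠ 0 := by exact_mod_cast hb0.ne'
    rw [map_smul, inner_smul_left, inner_smul_right, Complex.conj_ofReal]
    push_cast
    field_simp
  rw [he, enorm_mul, enorm_mul]
  have hr : ∀ {c : ℝ}, 0 ≤ c → ‖(c : ℂ)‖ₑ = ENNReal.ofReal c := fun hc => by
    rw [← ofReal_norm, Complex.norm_real, Real.norm_of_nonneg hc]
  rw [hr ha, hr hb]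
  gcongr

theorem nuc_add_le (A B : H →L[ℂ] H) : nuc (A + B) ≤ nuc A + nuc B := by
  refine nuc_le_iff.2 fun n u v hu hv => ?_
  simp only [add_apply, inner_add_right, Finset.sum_add_distrib]
  exact (enorm_add_le _ _).trans
    (add_le_add (enorm_sum_le_nuc_one A hu hv) (enorm_sum_le_nuc_one B hu hv))

theorem nuc_smul_le (c : ℂ) (A : H →L[ℂ] H) : nuc (c • A) ≤ ‖c‖ₑ * nuc A := by
  refine nuc_le_iff.2 fun n u v hu hv => ?_
  simp only [smul_apply, inner_smul_right, ← Finset.mul_sum, enorm_mul]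
  gcongr
  exact enorm_sum_le_nuc_one A hu hv

@[simp] theorem nuc_zero : nuc (0 : H →L[ℂ] H) = 0 :=
  le_antisymm (nuc_le_iff.2 fun n u v _ _ => by simp) zero_le

theorem nuc_neg (A : H →L[ℂ] H) : nuc (-A) = nuc A := by
  have h : ∀ B : H →L[ℂ] H, nuc (-B) ≤ nuc B := fun B => by
    simpa using nuc_smul_le (-1) B
  exact le_antisymm (h A) (by simpa using h (-A))

theorem nuc_sub_le (A B : H →L[ℂ] H) : nuc (A - B) ≤ nuc A + nuc B := by
  rw [sub_eq_add_neg, ← nuc_neg B]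
  exact nuc_add_le A (-B)

theorem nuc_sub_comm (A B : H →L[ℂ] H) : nuc (A - B) = nuc (B - A) := by
  rw [← nuc_neg, neg_sub]

theorem nuc_sum_le {ι : Type*} (s : Finset ι) (A : ι → H →L[ℂ] H) :
    nuc (∑ i ∈ s, A i) ≤ ∑ i ∈ s, nuc (A i) := by
  classical
  induction s using Finset.induction_on with
  | empty => simp
  | insert a s ha ih =>
    rw [Finset.sum_insert ha, Finset.sum_insert ha]
    exact (nuc_add_le _ _).trans (by gcongr)

theorem enorm_inner_le_nuc (A : H →L[ℂ] H) (x y : H) : ‖⟪x, A y⟫_ℂ‖ₑ ≤ ‖x‖ₑ * ‖y‖ₑ * nuc A := by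
  have hs : ∀ z : H, IsBessel ‖z‖ fun _ : Fin 1 => z := fun z w => by
    simp only [Finset.univ_unique, Finset.sum_const, Finset.card_singleton, one_smul, ← mul_pow]
    gcongr
    exact norm_inner_le_norm _ _
  have h := enorm_sum_le_nuc A (norm_nonneg x) (norm_nonneg y) (hs x) (hs y)
  simpa using h

/-- The nuclear norm dominates the operator norm. -/
theorem enorm_le_nuc (A : H →L[ℂ] H) : ‖A‖ₑ ≤ nuc A := by
  by_cases hA : nuc A = ⊤
  · simp [hA]
  rw [← ENNReal.ofReal_toReal hA, ← ofReal_norm]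
  refine ENNReal.ofReal_le_ofReal ?_
  refine A.opNorm_le_of_re_inner_le ENNReal.toReal_nonneg fun x y hx hy => ?_
  have h := enorm_inner_le_nuc A y x
  rw [← ofReal_norm y, ← ofReal_norm x, hx, hy, ENNReal.ofReal_one, one_mul, one_mul,
    ← ofReal_norm] at h
  have h' := ENNReal.toReal_mono hA h
  rw [ENNReal.toReal_ofReal (norm_nonneg _)] at h'
  refine le_trans ?_ h'
  rw [norm_inner_symm]
  exact RCLike.re_le_norm _

/-- Cauchy--Schwarz for finite sums of products. -/
theorem norm_sum_mul_le {ι : Type*} (s : Finset ι) (a b : ι → ℂ) :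
    ‖∑ i ∈ s, a i * b i‖ ≤ √(∑ i ∈ s, ‖a i‖ ^ 2) * √(∑ i ∈ s, ‖b i‖ ^ 2) := by
  refine (norm_sum_le _ _).trans ?_
  simp only [norm_mul]
  exact Real.sum_mul_le_sqrt_mul_sqrt s _ _

theorem nuc_rankOne_le (x y : H) : nuc (InnerProductSpace.rankOne ℂ x y) ≤ ‖x‖ₑ * ‖y‖ₑ := by
  refine nuc_le_iff.2 fun n u v hu hv => ?_
  simp only [InnerProductSpace.inner_right_rankOne_apply]
  rw [← ofReal_norm, ← ofReal_norm, ← ofReal_norm, ← ENNReal.ofReal_mul (norm_nonneg _)]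
  refine ENNReal.ofReal_le_ofReal ((norm_sum_mul_le _ _ _).trans ?_)
  have h1 := hu x
  have h2 := hv y
  rw [one_pow, one_mul] at h1 h2
  have h2' : ∑ i, ‖⟪y, v i⟫_ℂ‖ ^ 2 ≤ ‖y‖ ^ 2 := by simpa only [norm_inner_symm y] using h2
  exact mul_le_mul (Real.sqrt_le_iff.2 ⟨norm_nonneg _, h1⟩)
    (Real.sqrt_le_iff.2 ⟨norm_nonneg _, h2'⟩) (Real.sqrt_nonneg _) (norm_nonneg _)

theorem hasSum_norm_inner_sq {ι : Type*} (b : HilbertBasis ι ℂ H) (x : H) :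
    HasSum (fun i => ‖⟪b i, x⟫_ℂ‖ ^ 2) (‖x‖ ^ 2) := by
  have h := Complex.hasSum_re (b.hasSum_inner_mul_inner x x)
  have he : ∀ i, (⟪x, b i⟫_ℂ * ⟪b i, x⟫_ℂ).re = ‖⟪b i, x⟫_ℂ‖ ^ 2 := fun i => by
    rw [← inner_conj_symm x (b i), ← Complex.normSq_eq_conj_mul_self,
      Complex.ofReal_re, Complex.normSq_eq_norm_sq]
  simp only [he] at h
  rwa [show (⟪x, x⟫_ℂ).re = ‖x‖ ^ 2 from inner_self_eq_norm_sq (𝕜 := ℂ) x] at h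

theorem enorm_sq_eq_tsum {ι : Type*} (b : HilbertBasis ι ℂ H) (x : H) :
    ‖x‖ₑ ^ 2 = ∑' i, ‖⟪b i, x⟫_ℂ‖ₑ ^ 2 := by
  have h := hasSum_norm_inner_sq b x
  simp only [← ofReal_norm, ← ENNReal.ofReal_pow (norm_nonneg _)]
  rw [← h.tsum_eq, ENNReal.ofReal_tsum_of_nonneg (fun _ => by positivity) h.summable]

/-! ### Hilbert--Schmidt norms and the trace norm -/

/-- The square of the Hilbert--Schmidt norm, computed in the Hilbert basis `b`. -/
def hsSq {ι : Type*} (b : HilbertBasis ι ℂ H) (S : H →L[ℂ] H) : ℝ≥0∞ := ∑' i, ‖S (b i)‖ₑ ^ 2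

theorem hsSq_comp_le {ι : Type*} (b : HilbertBasis ι ℂ H) (P S : H →L[ℂ] H) :
    hsSq b (P ∘L S) ≤ ‖P‖ₑ ^ 2 * hsSq b S := by
  rw [hsSq, hsSq, ← ENNReal.tsum_mul_left]
  refine ENNReal.tsum_le_tsum fun i => ?_
  rw [← mul_pow]
  gcongr
  exact P.le_opENorm _

/-- If `P n → 0` strongly and boundedly, then `P n S → 0` in the Hilbert--Schmidt norm, by
dominated convergence for the sum over the basis. -/
theorem tendsto_hsSq_comp {α ι : Type*} {l : Filter α} (b : HilbertBasis ι ℂ H)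
    {S : H →L[ℂ] H} (hS : hsSq b S ≠ ⊤) {P : α → H →L[ℂ] H} {C : ℝ} (hC : ∀ n, ‖P n‖ ≤ C)
    (hP : ∀ x, Tendsto (fun n => P n x) l (𝓝 0)) :
    Tendsto (fun n => hsSq b (P n ∘L S)) l (𝓝 0) := by
  have hterm : ∀ T : H →L[ℂ] H, ∀ i, ‖T (b i)‖ₑ ^ 2 = ENNReal.ofReal (‖T (b i)‖ ^ 2) :=
    fun T i => by rw [← ofReal_norm, ENNReal.ofReal_pow (norm_nonneg _)]
  have hsum : Summable fun i => ‖S (b i)‖ ^ 2 := by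
    have h := hS
    simp only [hsSq, hterm] at h
    have h' := ENNReal.summable_toReal h
    simpa [ENNReal.toReal_ofReal, sq_nonneg] using h'
  have hle : ∀ n i, ‖(P n ∘L S) (b i)‖ ^ 2 ≤ C ^ 2 * ‖S (b i)‖ ^ 2 := fun n i => by
    rw [← mul_pow]
    gcongr
    exact (P n).le_of_opNorm_le (hC n) _
  have h := tendsto_tsum_of_dominated_convergence (𝓕 := l)
    (f := fun n i => ‖(P n ∘L S) (b i)‖ ^ 2) (g := fun _ => 0) (hsum.mul_left (C ^ 2))
    (fun i => by
      have := ((hP (S (b i))).norm).pow 2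
      simpa using this)
    (Eventually.of_forall fun n i => by
      rw [Real.norm_of_nonneg (sq_nonneg _)]
      exact hle n i)
  rw [tsum_zero] at h
  have h' := ENNReal.tendsto_ofReal h
  rw [ENNReal.ofReal_zero] at h'
  refine h'.congr fun n => ?_
  rw [ENNReal.ofReal_tsum_of_nonneg (fun _ => sq_nonneg _)
    (Summable.of_nonneg_of_le (fun _ => sq_nonneg _) (hle n) (hsum.mul_left _))]
  exact tsum_congr fun i => (hterm _ i).symm

theorem tendsto_nuc_of_sq_le {α : Type*} {l : Filter α} {A : α → H →L[ℂ] H} {f : α → ℝ≥0∞}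
    (hf : Tendsto f l (𝓝 0)) (h : ∀ n, nuc (A n) ^ 2 ≤ f n) :
    Tendsto (fun n => nuc (A n)) l (𝓝 0) := by
  have h2 : Tendsto (fun n => nuc (A n) ^ 2) l (𝓝 0) :=
    tendsto_of_tendsto_of_tendsto_of_le_of_le tendsto_const_nhds hf (fun _ => zero_le) h
  have h3 := (ENNReal.continuous_rpow_const (y := 1 / 2)).tendsto 0 |>.comp h2
  rw [ENNReal.zero_rpow_of_pos (by norm_num)] at h3
  refine h3.congr fun n => ?_
  rw [Function.comp_apply, ← ENNReal.rpow_two, ← ENNReal.rpow_mul]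
  norm_num

variable [CompleteSpace H]

theorem IsBessel.map {ι : Type*} [Fintype ι] {a : ℝ} {u : ι → H} (hu : IsBessel a u)
    (P : H →L[ℂ] H) : IsBessel (‖P‖ * a) fun i => P (u i) := fun x => by
  simp only [← ContinuousLinearMap.adjoint_inner_right]
  refine (hu _).trans ?_
  have h := P.adjoint.le_opNorm x
  rw [LinearIsometryEquiv.norm_map] at h
  calc a ^ 2 * ‖P.adjoint x‖ ^ 2 ≤ a ^ 2 * (‖P‖ * ‖x‖) ^ 2 := by gcongr
    _ = _ := by ring

theorem nuc_comp_le (P A R : H →L[ℂ] H) : nuc (P ∘L A ∘L R) ≤ ‖P‖ₑ * ‖R‖ₑ * nuc A := by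
  refine nuc_le_iff.2 fun n u v hu hv => ?_
  have h := enorm_sum_le_nuc A (by positivity) (by positivity) (hu.map P.adjoint) (hv.map R)
  simpa [ContinuousLinearMap.adjoint_inner_left] using h

theorem nuc_adjoint (A : H →L[ℂ] H) : nuc A.adjoint = nuc A := by
  have h : ∀ B : H →L[ℂ] H, nuc B.adjoint ≤ nuc B := fun B => by
    refine nuc_le_iff.2 fun n u v hu hv => ?_
    have := enorm_sum_le_nuc_one B hv hu
    refine le_trans (le_of_eq ?_) this
    rw [← RCLike.enorm_conj, map_sum]
    simp [ContinuousLinearMap.adjoint_inner_right]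
  exact le_antisymm (h A) (by simpa using h A.adjoint)

section HilbertSchmidt

variable {ι : Type*} (b : HilbertBasis ι ℂ H)

theorem sum_enorm_sq_le_hsSq {κ : Type*} [Fintype κ] (S : H →L[ℂ] H) {v : κ → H}
    (hv : IsBessel 1 v) : ∑ k, ‖S.adjoint (v k)‖ₑ ^ 2 ≤ hsSq b S := by
  simp only [enorm_sq_eq_tsum b (S.adjoint _)]
  rw [← Summable.tsum_finsetSum fun _ _ => ENNReal.summable]
  refine ENNReal.tsum_le_tsum fun i => ?_
  have h := hv (S (b i))
  rw [one_pow, one_mul] at h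
  simp only [ContinuousLinearMap.adjoint_inner_right, ← ofReal_norm,
    ← ENNReal.ofReal_pow (norm_nonneg _)]
  rw [← ENNReal.ofReal_sum_of_nonneg fun _ _ => by positivity]
  refine ENNReal.ofReal_le_ofReal (le_trans (le_of_eq ?_) h)
  exact Finset.sum_congr rfl fun k _ => by rw [norm_inner_symm]

/-- Cauchy--Schwarz for the nuclear norm of a product of two Hilbert--Schmidt operators. -/
theorem nuc_comp_adjoint_sq_le (P R : H →L[ℂ] H) :
    nuc (P ∘L R.adjoint) ^ 2 ≤ hsSq b P * hsSq b R := by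
  have hsq : ∀ x : ℝ≥0∞, (x ^ (1 / 2 : ℝ)) ^ 2 = x := fun x => by
    rw [← ENNReal.rpow_two, ← ENNReal.rpow_mul]; norm_num
  rw [← hsq (hsSq b P * hsSq b R)]
  gcongr
  refine nuc_le_iff.2 fun n u v hu hv => ?_
  rw [← ENNReal.pow_le_pow_left_iff two_ne_zero, hsq]
  refine le_trans ?_ (mul_le_mul' (sum_enorm_sq_le_hsSq b P hu) (sum_enorm_sq_le_hsSq b R hv))
  simp only [ContinuousLinearMap.comp_apply, ← ofReal_norm, ← ENNReal.ofReal_pow (norm_nonneg _)]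
  rw [← ENNReal.ofReal_sum_of_nonneg fun _ _ => by positivity,
    ← ENNReal.ofReal_sum_of_nonneg fun _ _ => by positivity,
    ← ENNReal.ofReal_mul (Finset.sum_nonneg fun _ _ => by positivity)]
  refine ENNReal.ofReal_le_ofReal ?_
  have h1 : ‖∑ i, ⟪u i, P (R.adjoint (v i))⟫_ℂ‖
      ≤ ∑ i, ‖P.adjoint (u i)‖ * ‖R.adjoint (v i)‖ := by
    refine (norm_sum_le _ _).trans (Finset.sum_le_sum fun i _ => ?_)
    rw [← ContinuousLinearMap.adjoint_inner_left]
    exact norm_inner_le_norm _ _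
  calc _ ≤ (∑ i, ‖P.adjoint (u i)‖ * ‖R.adjoint (v i)‖) ^ 2 := by gcongr
    _ ≤ _ := Finset.sum_mul_sq_le_sq_mul_sq _ _ _

theorem nuc_mul_self_le {S : H →L[ℂ] H} (hS : IsSelfAdjoint S) : nuc (S ∘L S) ≤ hsSq b S := by
  have h := nuc_comp_adjoint_sq_le b S S
  rw [hS.adjoint_eq, ← sq] at h
  exact (ENNReal.pow_le_pow_left_iff two_ne_zero).1 h

theorem sqrt_isSelfAdjoint (T : H →L[ℂ] H) : IsSelfAdjoint (CFC.sqrt T) :=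
  (CFC.sqrt_nonneg T).isSelfAdjoint

theorem sqrt_comp_sqrt {T : H →L[ℂ] H} (hT : 0 ≤ T) : CFC.sqrt T ∘L CFC.sqrt T = T :=
  CFC.sqrt_mul_sqrt_self T hT

theorem posTrace_eq_hsSq {T : H →L[ℂ] H} (hT : 0 ≤ T) : posTrace T = hsSq b (CFC.sqrt T) := by
  rw [posTrace_eq_tsum b hT, hsSq]
  refine tsum_congr fun i => ?_
  rw [← ofReal_norm, ← ENNReal.ofReal_pow (norm_nonneg _)]
  congr 1
  have h : T (b i) = CFC.sqrt T (CFC.sqrt T (b i)) := by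
    rw [← ContinuousLinearMap.comp_apply, sqrt_comp_sqrt hT]
  rw [h, ← ContinuousLinearMap.adjoint_inner_left, (sqrt_isSelfAdjoint T).adjoint_eq]
  exact inner_self_eq_norm_sq (𝕜 := ℂ) _

/-- The trace norm in terms of the Jordan decomposition, `‖A‖₁ = tr A⁺ + tr A⁻`. -/
theorem traceNorm_eq_add {A : H →L[ℂ] H} (hA : IsSelfAdjoint A) :
    traceNorm A = hsSq b (CFC.sqrt A⁺) + hsSq b (CFC.sqrt A⁻) := by
  have hp : 0 ≤ A⁺ := CFC.posPart_nonneg A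
  have hn : 0 ≤ A⁻ := CFC.negPart_nonneg A
  rw [traceNorm, ← CFC.posPart_add_negPart A hA, posTrace_eq_tsum b (add_nonneg hp hn),
    ← posTrace_eq_hsSq b hp, ← posTrace_eq_hsSq b hn, posTrace_eq_tsum b hp,
    posTrace_eq_tsum b hn, ← ENNReal.tsum_add]
  refine tsum_congr fun i => ?_
  have hre : ∀ {T : H →L[ℂ] H}, 0 ≤ T → 0 ≤ (⟪b i, T (b i)⟫_ℂ).re := fun hT =>
    ((ContinuousLinearMap.nonneg_iff_isPositive _).1 hT).re_inner_nonneg_right _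
  rw [← ENNReal.ofReal_add (hre hp) (hre hn), add_apply, inner_add_right, Complex.add_re]

end HilbertSchmidt

/-- The Jordan decomposition makes the absolute value of a self-adjoint operator `A` equal to
`R A` for a reflection `R`. -/
theorem exists_reflection_comp_eq_abs {A : H →L[ℂ] H} (hA : IsSelfAdjoint A) :
    ∃ R : H ≃ₗᵢ[ℂ] H, (∀ x y, ⟪R x, y⟫_ℂ = ⟪x, R y⟫_ℂ) ∧ ∀ x, CFC.abs A x = R (A x) := by
  have hp : IsSelfAdjoint A⁺ := (CFC.posPart_nonneg A).isSelfAdjoint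
  let K : Submodule ℂ H := (LinearMap.range (A⁺).toLinearMap).topologicalClosure
  have : CompleteSpace K := (Submodule.isClosed_topologicalClosure _).completeSpace_coe
  refine ⟨K.reflection, fun x y => ?_, fun x => ?_⟩
  · rw [← K.reflection.inner_map_map x, Submodule.reflection_reflection]
  have h1 : A⁺ x ∈ K := Submodule.le_topologicalClosure _ ⟨x, rfl⟩
  have h2 : A⁻ x ∈ Kᗮ := by
    rw [Submodule.orthogonal_closure, Submodule.mem_orthogonal]
    rintro _ ⟨y, rfl⟩
    have h0 : A⁺ (A⁻ x) = 0 := by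
      have := congrArg (fun T : H →L[ℂ] H => T x) (CFC.posPart_mul_negPart A)
      exact this
    show ⟪A⁺ y, A⁻ x⟫_ℂ = 0
    rw [← ContinuousLinearMap.adjoint_inner_right, hp.adjoint_eq, h0, inner_zero_right]
  have h3 : A x = A⁺ x - A⁻ x := by
    rw [← sub_apply, CFC.posPart_sub_negPart A hA]
  rw [h3, map_sub, Submodule.reflection_mem_subspace_eq_self h1,
    Submodule.reflection_mem_subspace_orthogonalComplement_eq_neg h2, sub_neg_eq_add,
    ← add_apply, CFC.posPart_add_negPart A hA]

/-- A self-adjoint trace class operator is a difference of squares of self-adjoint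
Hilbert--Schmidt operators, the square roots of its positive and negative parts. -/
theorem exists_hsSq_decomposition {ι : Type*} (b : HilbertBasis ι ℂ H) {A : H →L[ℂ] H}
    (hA : A ∈ selfAdjointTraceClass H) : ∃ S T : H →L[ℂ] H, IsSelfAdjoint S ∧ IsSelfAdjoint T ∧
      hsSq b S ≠ ⊤ ∧ hsSq b T ≠ ⊤ ∧ A = S ∘L S - T ∘L T := by
  have h := hA.2
  rw [traceNorm_eq_add b hA.1, ENNReal.add_ne_top] at h
  refine ⟨_, _, sqrt_isSelfAdjoint _, sqrt_isSelfAdjoint _, h.1, h.2, ?_⟩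
  rw [sqrt_comp_sqrt (CFC.posPart_nonneg A), sqrt_comp_sqrt (CFC.negPart_nonneg A),
    CFC.posPart_sub_negPart A hA.1]

/-- On self-adjoint operators the nuclear norm is the trace norm. Here `≤` holds because
`⟨v, |A| v⟩ = ⟨R v, A v⟩` for a reflection `R`, so that orthonormal systems give Bessel families,
and `≥` follows from `A = A⁺ - A⁻` and the bound `‖S²‖₁ ≤ ‖S‖²` in terms of Hilbert--Schmidt
norms. -/
theorem traceNorm_eq_nuc {A : H →L[ℂ] H} (hA : IsSelfAdjoint A) : traceNorm A = nuc A := by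
  refine le_antisymm ?_ ?_
  · obtain ⟨R, hR, hRA⟩ := exists_reflection_comp_eq_abs hA
    refine iSup₂_le fun s hs => ?_
    have hR' : Orthonormal ℂ fun v : s => R v := hs.comp_linearIsometryEquiv R
    have hre : ∀ v : H, ⟪v, CFC.abs A v⟫_ℂ = ⟪R v, A v⟫_ℂ := fun v => by rw [hRA, hR]
    have h0 : ∀ v : H, 0 ≤ (⟪R v, A v⟫_ℂ).re := fun v => by
      rw [← hre]
      exact ((ContinuousLinearMap.nonneg_iff_isPositive _).1
        (CFC.abs_nonneg A)).re_inner_nonneg_right v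
    simp only [hre]
    rw [← ENNReal.ofReal_sum_of_nonneg fun v _ => h0 v]
    refine le_trans ?_ (enorm_sum_le_nuc_one A (Orthonormal.isBessel hR')
      (Orthonormal.isBessel hs))
    rw [← ofReal_norm, ← Complex.re_sum, ← Finset.sum_coe_sort s]
    exact ENNReal.ofReal_le_ofReal (Complex.re_le_norm _)
  · obtain ⟨w, b, _⟩ := exists_hilbertBasis ℂ H
    rw [traceNorm_eq_add b hA]
    conv_lhs => rw [← CFC.posPart_sub_negPart A hA, ← sqrt_comp_sqrt (CFC.posPart_nonneg A),
      ← sqrt_comp_sqrt (CFC.negPart_nonneg A)]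
    exact (nuc_sub_le _ _).trans (add_le_add (nuc_mul_self_le b (sqrt_isSelfAdjoint _))
      (nuc_mul_self_le b (sqrt_isSelfAdjoint _)))

theorem mem_selfAdjointTraceClass_iff {A : H →L[ℂ] H} :
    A ∈ selfAdjointTraceClass H ↔ IsSelfAdjoint A ∧ nuc A ≠ ⊤ :=
  and_congr_right fun hA => by rw [traceNorm_eq_nuc hA]

/-- The trace norm dominates the operator norm; self-adjointness is not needed, since
`‖A‖ = ‖|A|‖`. -/
theorem enorm_le_traceNorm (A : H →L[ℂ] H) : ‖A‖ₑ ≤ traceNorm A := by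
  have h : traceNorm (CFC.abs A) = traceNorm A := by simp [traceNorm]
  rw [← h, traceNorm_eq_nuc (CFC.abs_nonneg A).isSelfAdjoint]
  refine le_trans (le_of_eq ?_) (enorm_le_nuc _)
  rw [← ofReal_norm, ← ofReal_norm, CFC.norm_abs]

/-! ### Convergence and finite rank approximation in the trace norm -/

/-- If `P n → 0` strongly, with `P n` and `R n` uniformly bounded, then `P n A (R n)* → 0` in the
trace norm for each trace class operator `A`. -/
theorem tendsto_nuc_comp_adjoint {α : Type*} {l : Filter α} {A : H →L[ℂ] H}
    (hA : A ∈ selfAdjointTraceClass H) {P R : α → H →L[ℂ] H} {C D : ℝ} (hC : ∀ n, ‖P n‖ ≤ C)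
    (hD : ∀ n, ‖R n‖ ≤ D) (hP : ∀ x, Tendsto (fun n => P n x) l (𝓝 0)) :
    Tendsto (fun n => nuc (P n ∘L A ∘L (R n).adjoint)) l (𝓝 0) := by
  obtain ⟨w, b, _⟩ := exists_hilbertBasis ℂ H
  obtain ⟨S, T, hS, hT, hS', hT', rfl⟩ := exists_hsSq_decomposition b hA
  have key : ∀ S : H →L[ℂ] H, IsSelfAdjoint S → hsSq b S ≠ ⊤ →
      Tendsto (fun n => nuc (P n ∘L (S ∘L S) ∘L (R n).adjoint)) l (𝓝 0) := by
    intro S hS hS'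
    have hlim : Tendsto (fun n => hsSq b (P n ∘L S) * (ENNReal.ofReal D ^ 2 * hsSq b S)) l
        (𝓝 0) := by
      have := ENNReal.Tendsto.mul_const (tendsto_hsSq_comp b hS' hC hP)
        (b := ENNReal.ofReal D ^ 2 * hsSq b S)
        (Or.inr (ENNReal.mul_ne_top (by simp) hS'))
      simpa using this
    refine tendsto_nuc_of_sq_le hlim fun n => ?_
    have he : P n ∘L (S ∘L S) ∘L (R n).adjoint = (P n ∘L S) ∘L (R n ∘L S).adjoint := by
      rw [ContinuousLinearMap.adjoint_comp, hS.adjoint_eq]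
      rfl
    rw [he]
    refine (nuc_comp_adjoint_sq_le b _ _).trans ?_
    gcongr
    refine (hsSq_comp_le b _ _).trans ?_
    gcongr
    rw [← ofReal_norm]
    exact ENNReal.ofReal_le_ofReal (hD n)
  have h := (key S hS hS').add (key T hT hT')
  rw [add_zero] at h
  refine tendsto_of_tendsto_of_tendsto_of_le_of_le tendsto_const_nhds h (fun _ => zero_le)
    fun n => ?_
  have he : P n ∘L (S ∘L S - T ∘L T) ∘L (R n).adjoint =
      P n ∘L (S ∘L S) ∘L (R n).adjoint - P n ∘L (T ∘L T) ∘L (R n).adjoint := by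
    rw [ContinuousLinearMap.sub_comp, ContinuousLinearMap.comp_sub]
  simp only [he]
  exact nuc_sub_le _ _

theorem tendsto_nuc_comp_adjoint_right {α : Type*} {l : Filter α} {A : H →L[ℂ] H}
    (hA : A ∈ selfAdjointTraceClass H) {P R : α → H →L[ℂ] H} {C D : ℝ} (hC : ∀ n, ‖P n‖ ≤ C)
    (hD : ∀ n, ‖R n‖ ≤ D) (hP : ∀ x, Tendsto (fun n => P n x) l (𝓝 0)) :
    Tendsto (fun n => nuc (R n ∘L A ∘L (P n).adjoint)) l (𝓝 0) := by
  refine (tendsto_nuc_comp_adjoint hA hC hD hP).congr fun n => ?_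
  rw [← nuc_adjoint, ContinuousLinearMap.adjoint_comp, ContinuousLinearMap.adjoint_comp,
    ContinuousLinearMap.adjoint_adjoint, hA.1.adjoint_eq]
  rfl

/-- Real linear combinations of rank one operators `|v⟩⟨v|` are dense: in `A = S² - T²` replace
`S²` by `S Q S` for the projection `Q` onto the span of finitely many basis vectors. -/
theorem exists_finiteRank_nuc_sub_lt {A : H →L[ℂ] H} (hA : A ∈ selfAdjointTraceClass H)
    {ε : ℝ≥0∞} (hε : 0 < ε) : ∃ (ι : Type u) (_ : Fintype ι) (c : ι → ℝ) (v : ι → H),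
      nuc (A - ∑ i, (c i : ℂ) • InnerProductSpace.rankOne ℂ (v i) (v i)) < ε := by
  classical
  obtain ⟨w, b, _⟩ := exists_hilbertBasis ℂ H
  obtain ⟨S, T, hS, hT, hS', hT', rfl⟩ := exists_hsSq_decomposition b hA
  let F : (H →L[ℂ] H) → Finset w → H →L[ℂ] H := fun S s =>
    ∑ i ∈ s, InnerProductSpace.rankOne ℂ (S (b i)) (S (b i))
  have key : ∀ S : H →L[ℂ] H, IsSelfAdjoint S → hsSq b S ≠ ⊤ →
      Tendsto (fun s : Finset w => nuc (S ∘L S - F S s)) atTop (𝓝 0) := by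
    intro S hS hS'
    let Q : Finset w → H →L[ℂ] H := fun s => ∑ i ∈ s, InnerProductSpace.rankOne ℂ (b i) (b i)
    have hQ : ∀ s i, (S - S ∘L Q s) (b i) = if i ∈ s then 0 else S (b i) := by
      intro s i
      have hQi : Q s (b i) = if i ∈ s then b i else 0 := by
        simp only [Q, sum_apply, InnerProductSpace.rankOne_apply,
          orthonormal_iff_ite.1 b.orthonormal, ite_smul, one_smul, zero_smul, Finset.sum_ite_eq']
      rw [sub_apply, ContinuousLinearMap.comp_apply, hQi]
      split_ifs <;> simp
    have hlim : Tendsto (fun s => hsSq b (S - S ∘L Q s)) atTop (𝓝 0) := by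
      refine (ENNReal.tendsto_tsum_compl_atTop_zero hS').congr fun s => ?_
      refine (tsum_subtype {i | i ∉ s} fun i => ‖S (b i)‖ₑ ^ 2).trans ?_
      refine tsum_congr fun i => ?_
      rw [hQ]
      by_cases h : i ∈ s <;> simp [h, Set.indicator]
    have hlim' := ENNReal.Tendsto.mul_const hlim (b := hsSq b S) (Or.inr hS')
    rw [zero_mul] at hlim'
    refine tendsto_nuc_of_sq_le hlim' fun s => ?_
    have he : S ∘L S - F S s = (S - S ∘L Q s) ∘L S.adjoint := by
      ext x
      simp only [F, Q, hS.adjoint_eq, sub_apply, ContinuousLinearMap.comp_apply,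
        sum_apply, InnerProductSpace.rankOne_apply, map_sum, map_smul]
      congr 1
      refine Finset.sum_congr rfl fun i _ => ?_
      rw [← ContinuousLinearMap.adjoint_inner_right, hS.adjoint_eq]
    rw [he]
    exact nuc_comp_adjoint_sq_le b _ _
  have h := (key S hS hS').add (key T hT hT')
  rw [add_zero] at h
  obtain ⟨s, hs⟩ := (h.eventually (gt_mem_nhds hε)).exists
  refine ⟨s ⊕ s, inferInstance, Sum.elim (fun _ => 1) fun _ => -1,
    Sum.elim (fun i => S (b i)) fun i => T (b i), lt_of_le_of_lt ?_ hs⟩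
  refine le_trans (le_of_eq ?_) (nuc_sub_le (S ∘L S - F S s) (T ∘L T - F T s))
  congr 1
  simp only [F, Fintype.sum_sum_type, Sum.elim_inl, Sum.elim_inr, Complex.ofReal_one, one_smul,
    Complex.ofReal_neg, neg_smul, Finset.sum_neg_distrib]
  rw [← Finset.sum_coe_sort s, ← Finset.sum_coe_sort s]
  abel

end Nuclear

/-! ### Products and convolutions of test functions -/

section TestAlgebra

variable {d : ℕ}

theorem Test.hasFDerivAt (f : Test d) (x : Space d) : HasFDerivAt f (fderiv ℝ f x) x :=
  (f.smooth.differentiable (by simp) x).hasFDerivAt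

theorem der_apply (k : Fin d) (f : Test d) (x : Space d) :
    der k f x = fderiv ℝ f x (EuclideanSpace.single k 1) := by
  rw [der, TestFunction.lineDerivOp_eq_lineDerivCLM ℂ,
    TestFunction.lineDerivCLM_apply_of_le (by simp),
    (f.smooth.differentiable (by simp) x).lineDeriv_eq_fderiv]

theorem pos_apply (k : Fin d) (f : Test d) (x : Space d) : pos k f x = (x k : ℂ) * f x := rfl

theorem Test.add_apply (f g : Test d) (x : Space d) : (f + g) x = f x + g x := rfl
theorem Test.smul_apply (c : ℂ) (f : Test d) (x : Space d) : (c • f) x = c * f x := rfl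

/-- Multiplication by the coordinate `x_k` as an endomorphism of the space of test functions. -/
def posEnd (k : Fin d) : Module.End ℂ (Test d) where
  toFun := pos k
  map_add' f g := by ext x; simp only [pos_apply, Test.add_apply, mul_add]
  map_smul' c f := by
    ext x; simp only [pos_apply, Test.smul_apply, RingHom.id_apply, mul_left_comm]

/-- The partial derivative `∂_k` as an endomorphism of the space of test functions. -/
def derEnd (k : Fin d) : Module.End ℂ (Test d) where
  toFun := der k
  map_add' _ _ := LineDeriv.lineDerivOp_add _ _ _
  map_smul' _ _ := LineDeriv.lineDerivOp_smul _ _ _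

@[simp] theorem posEnd_apply (k : Fin d) (f : Test d) : posEnd k f = pos k f := rfl
@[simp] theorem derEnd_apply (k : Fin d) (f : Test d) : derEnd k f = der k f := rfl

/-- The embedding of test functions into `L²(ℝᵈ)` as a linear map. -/
def toL2Lin : Test d →ₗ[ℂ] L2 d where
  toFun := Test.toL2
  map_add' f g := MemLp.toLp_add (f.memLp 2) (g.memLp 2)
  map_smul' c f := MemLp.toLp_const_smul c (f.memLp 2)

@[simp] theorem toL2Lin_apply (f : Test d) : toL2Lin f = f.toL2 := rfl

/-- The product of two test functions. -/
def mulTest (h f : Test d) : Test d where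
  toFun x := h x * f x
  contDiff' := h.smooth.mul f.smooth
  hasCompactSupport' := f.compactSupport.mul_left
  tsupport_subset' := fun _ _ => trivial

theorem mulTest_apply (h f : Test d) (x : Space d) : mulTest h f x = h x * f x := rfl

/-- The convolution `g ∗ f` of two test functions. -/
def convTest (g f : Test d) : Test d where
  toFun := convolve g f
  contDiff' := g.compactSupport.contDiff_convolution_left (n := ⊤)
    (ContinuousLinearMap.mul ℝ ℂ) g.smooth f.cont.locallyIntegrable
  hasCompactSupport' := g.compactSupport.convolution _ f.compactSupport
  tsupport_subset' := fun _ _ => trivial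

theorem convTest_apply (g f : Test d) (x : Space d) : convTest g f x = ∫ t, g t * f (x - t) := rfl

theorem integrable_conv (g f : Test d) (x : Space d) : Integrable fun t => g t * f (x - t) :=
  g.compactSupport.convolutionExists_left (ContinuousLinearMap.mul ℂ ℂ) g.cont
    f.cont.locallyIntegrable x

theorem pos_mulTest_left (k : Fin d) (h f : Test d) :
    mulTest (pos k h) f = pos k (mulTest h f) := by
  ext x; simp only [pos_apply, mulTest_apply]; ring

theorem pos_mulTest_right (k : Fin d) (h f : Test d) :
    mulTest h (pos k f) = pos k (mulTest h f) := by
  ext x; simp only [pos_apply, mulTest_apply]; ring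

theorem der_mulTest (k : Fin d) (h f : Test d) :
    der k (mulTest h f) = mulTest (der k h) f + mulTest h (der k f) := by
  ext x
  have := (h.hasFDerivAt x).mul (f.hasFDerivAt x)
  rw [der_apply, show fderiv ℝ (mulTest h f) x = _ from this.fderiv]
  rw [Test.add_apply]
  simp only [mulTest_apply, der_apply, _root_.add_apply, _root_.smul_apply, smul_eq_mul]
  ring

theorem pos_convTest (k : Fin d) (g f : Test d) :
    pos k (convTest g f) = convTest (pos k g) f + convTest g (pos k f) := by
  ext x
  rw [Test.add_apply, pos_apply, convTest_apply, convTest_apply, convTest_apply,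
    ← integral_add (integrable_conv (pos k g) f x) (integrable_conv g (pos k f) x),
    ← integral_const_mul]
  congr 1
  ext t
  simp only [pos_apply, PiLp.sub_apply]
  push_cast
  ring

theorem der_convTest_right (k : Fin d) (g f : Test d) :
    der k (convTest g f) = convTest g (der k f) := by
  ext x
  have h := f.compactSupport.hasFDerivAt_convolution_right (ContinuousLinearMap.mul ℝ ℂ)
    (g.cont.locallyIntegrable (μ := volume)) (f.smooth.of_le (by exact_mod_cast le_top)) x
  rw [der_apply, show fderiv ℝ (convTest g f) x = _ from h.fderiv]
  rw [convolution_precompR_apply]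
  · rw [convTest_apply]
    simp only [der_apply]
    rfl
  · exact g.cont.locallyIntegrable
  · exact f.compactSupport.fderiv ℝ
  · exact f.smooth.continuous_fderiv (by simp)

theorem convTest_comm (g f : Test d) : convTest g f = convTest f g := by
  ext x
  refine (convolution_mul_swap (𝕜 := ℂ) (μ := volume) (f := g) (g := f) (x := x)).trans ?_
  rw [convTest_apply]
  congr 1
  ext t
  rw [mul_comm]

theorem der_convTest_left (k : Fin d) (g f : Test d) :
    der k (convTest g f) = convTest (der k g) f := by
  rw [convTest_comm, der_convTest_right, convTest_comm]

/-- The endomorphism `f ↦ g ∗ (h f)` of the space of test functions. -/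
def convMul (g h : Test d) : Module.End ℂ (Test d) where
  toFun f := convTest g (mulTest h f)
  map_add' f₁ f₂ := by
    ext x
    simp only [convTest_apply, Test.add_apply]
    rw [← integral_add (integrable_conv _ _ x) (integrable_conv _ _ x)]
    congr 1
    ext t
    simp only [mulTest_apply, Test.add_apply, mul_add]
  map_smul' c f := by
    ext x
    simp only [convTest_apply, Test.smul_apply, RingHom.id_apply]
    rw [← integral_const_mul]
    congr 1
    ext t
    simp only [mulTest_apply, Test.smul_apply]
    ring

theorem convMul_apply (g h f : Test d) : convMul g h f = convTest g (mulTest h f) := rfl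

theorem convMul_smul_left (c : ℂ) (g h : Test d) : convMul (c • g) h = c • convMul g h := by
  ext f x
  show convTest (c • g) (mulTest h f) x = c * convTest g (mulTest h f) x
  simp only [convTest_apply, Test.smul_apply, mul_assoc, integral_const_mul]

theorem convMul_smul_right (c : ℂ) (g h : Test d) : convMul g (c • h) = c • convMul g h := by
  ext f x
  show convTest g (mulTest (c • h) f) x = c * convTest g (mulTest h f) x
  simp only [convTest_apply, mulTest_apply, Test.smul_apply]
  rw [← integral_const_mul]
  congr 1
  ext t
  ring

theorem posEnd_mul_convMul (k : Fin d) (g h : Test d) :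
    posEnd k * convMul g h = convMul (pos k g) h + convMul g (pos k h) := by
  refine LinearMap.ext fun f => ?_
  show pos k (convTest g (mulTest h f)) = convTest (pos k g) (mulTest h f) +
    convTest g (mulTest (pos k h) f)
  rw [pos_convTest, pos_mulTest_left]

theorem convMul_mul_posEnd (k : Fin d) (g h : Test d) :
    convMul g h * posEnd k = convMul g (pos k h) := by
  refine LinearMap.ext fun f => ?_
  show convTest g (mulTest h (pos k f)) = convTest g (mulTest (pos k h) f)
  rw [pos_mulTest_left, pos_mulTest_right]

theorem derEnd_mul_convMul (k : Fin d) (g h : Test d) :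
    derEnd k * convMul g h = convMul (der k g) h :=
  LinearMap.ext fun f => der_convTest_left k g (mulTest h f)

theorem convMul_mul_derEnd (k : Fin d) (g h : Test d) :
    convMul g h * derEnd k = convMul (der k g) h - convMul g (der k h) := by
  rw [eq_sub_iff_add_eq]
  refine LinearMap.ext fun f => ?_
  show convTest g (mulTest h (der k f)) + convMul g (der k h) f = convTest (der k g) (mulTest h f)
  rw [← der_convTest_left, der_convTest_right, der_mulTest]
  have : ∀ f₁ f₂ : Test d, convTest g (f₁ + f₂) = convTest g f₁ + convTest g f₂ := fun f₁ f₂ => by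
    ext x
    simp only [convTest_apply, Test.add_apply]
    rw [← integral_add (integrable_conv _ _ x) (integrable_conv _ _ x)]
    congr 1
    ext t
    rw [mul_add]
  rw [this, convMul_apply, add_comm]

/-! ### Scaling -/

/-- `g_n(x) = n^d g(n x)`. -/
def concentrate (n : ℕ+) (g : Test d) : Test d where
  toFun x := (n : ℂ) ^ d * g ((n : ℝ) • x)
  contDiff' := contDiff_const.mul (g.smooth.comp (contDiff_const_smul _))
  hasCompactSupport' := by
    refine HasCompactSupport.mul_left ?_
    exact g.compactSupport.comp_homeomorph
      (Homeomorph.smulOfNeZero (n : ℝ) (by exact_mod_cast n.ne_zero))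
  tsupport_subset' := fun _ _ => trivial

/-- `h_n(x) = h(x / n)`. -/
def spread (n : ℕ+) (h : Test d) : Test d where
  toFun x := h ((n : ℝ)⁻¹ • x)
  contDiff' := h.smooth.comp (contDiff_const_smul _)
  hasCompactSupport' := h.compactSupport.comp_homeomorph
      (Homeomorph.smulOfNeZero (n : ℝ)⁻¹ (by simp))
  tsupport_subset' := fun _ _ => trivial

theorem concentrate_apply (n : ℕ+) (g : Test d) (x : Space d) :
    concentrate n g x = (n : ℂ) ^ d * g ((n : ℝ) • x) := rfl

theorem spread_apply (n : ℕ+) (h : Test d) (x : Space d) :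
    spread n h x = h ((n : ℝ)⁻¹ • x) := rfl

theorem fderiv_comp_const_smul (f : Test d) (c : ℝ) (x v : Space d) :
    fderiv ℝ (fun x => f (c • x)) x v = c • fderiv ℝ f (c • x) v := by
  have := (f.hasFDerivAt (c • x)).comp x ((hasFDerivAt_id x).const_smul c)
  rw [show fderiv ℝ (fun x => f (c • x)) x = _ from this.fderiv]
  simp

theorem pnat_ne_zero (n : ℕ+) : (n : ℂ) ≠ 0 := by exact_mod_cast n.ne_zero

theorem pos_concentrate (k : Fin d) (n : ℕ+) (g : Test d) :
    pos k (concentrate n g) = (n : ℂ)⁻¹ • concentrate n (pos k g) := by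
  ext x
  have := pnat_ne_zero n
  simp only [pos_apply, concentrate_apply, Test.smul_apply, PiLp.smul_apply, smul_eq_mul]
  push_cast
  field_simp

theorem der_concentrate (k : Fin d) (n : ℕ+) (g : Test d) :
    der k (concentrate n g) = (n : ℂ) • concentrate n (der k g) := by
  ext x
  have h1 : DifferentiableAt ℝ (fun x => g ((n : ℝ) • x)) x :=
    ((g.hasFDerivAt _).comp x ((hasFDerivAt_id x).const_smul (n : ℝ))).differentiableAt
  rw [der_apply, show fderiv ℝ (concentrate n g) x = _ from fderiv_const_mul h1 ((n : ℂ) ^ d)]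
  rw [Test.smul_apply]
  simp only [_root_.smul_apply, fderiv_comp_const_smul, concentrate_apply,
    der_apply, smul_eq_mul, Complex.real_smul]
  push_cast
  ring

theorem pos_spread (k : Fin d) (n : ℕ+) (h : Test d) :
    pos k (spread n h) = (n : ℂ) • spread n (pos k h) := by
  ext x
  have := pnat_ne_zero n
  simp only [pos_apply, spread_apply, Test.smul_apply, PiLp.smul_apply, smul_eq_mul]
  push_cast
  field_simp

theorem der_spread (k : Fin d) (n : ℕ+) (h : Test d) :
    der k (spread n h) = (n : ℂ)⁻¹ • spread n (der k h) := by
  ext x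
  rw [der_apply, show fderiv ℝ (spread n h) x _ = _ from fderiv_comp_const_smul h _ x _]
  simp only [Test.smul_apply, spread_apply, der_apply, Complex.real_smul]
  push_cast
  ring

/-- The endomorphism `W_n(g, h) f = g_n ∗ (h_n f)`. Composing it with `x_k` or `∂_k` from either
side gives combinations of operators of the same kind, with coefficients `n` and `n⁻¹`; those with
coefficient `n` are the same on both sides. -/
def scaledConvMul (n : ℕ+) (g h : Test d) : Module.End ℂ (Test d) :=
  convMul (concentrate n g) (spread n h)

theorem posEnd_mul_scaledConvMul (k : Fin d) (n : ℕ+) (g h : Test d) :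
    posEnd k * scaledConvMul n g h =
      (n : ℂ)⁻¹ • scaledConvMul n (pos k g) h + (n : ℂ) • scaledConvMul n g (pos k h) := by
  simp only [scaledConvMul, posEnd_mul_convMul, pos_concentrate, pos_spread, convMul_smul_left,
    convMul_smul_right]

theorem scaledConvMul_mul_posEnd (k : Fin d) (n : ℕ+) (g h : Test d) :
    scaledConvMul n g h * posEnd k = (n : ℂ) • scaledConvMul n g (pos k h) := by
  simp only [scaledConvMul, convMul_mul_posEnd, pos_spread, convMul_smul_right]

theorem derEnd_mul_scaledConvMul (k : Fin d) (n : ℕ+) (g h : Test d) :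
    derEnd k * scaledConvMul n g h = (n : ℂ) • scaledConvMul n (der k g) h := by
  simp only [scaledConvMul, derEnd_mul_convMul, der_concentrate, convMul_smul_left]

theorem scaledConvMul_mul_derEnd (k : Fin d) (n : ℕ+) (g h : Test d) :
    scaledConvMul n g h * derEnd k =
      (n : ℂ) • scaledConvMul n (der k g) h - (n : ℂ)⁻¹ • scaledConvMul n g (der k h) := by
  simp only [scaledConvMul, convMul_mul_derEnd, der_concentrate, der_spread, convMul_smul_left,
    convMul_smul_right]

end TestAlgebra

/-! ### Multiplication and convolution as bounded operators -/

section BoundedRealizations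

variable {d : ℕ}

theorem Test.coeFn_toL2 (f : Test d) : f.toL2 =ᵐ[volume] f := (f.memLp 2).coeFn_toLp

theorem denseRange_toL2 : DenseRange (Test.toL2 : Test d → L2 d) := by
  refine (Lp.dense_hasCompactSupport_contDiff (F := ℂ) (μ := (volume : Measure (Space d)))
    (p := 2) (by norm_num)).mono ?_
  rintro f ⟨g, hfg, hg, hg'⟩
  refine ⟨⟨g, hg', hg, fun _ _ => trivial⟩, ?_⟩
  refine Lp.ext ?_
  exact (Test.coeFn_toL2 _).trans hfg.symm

theorem inner_toL2 (f g : Test d) : ⟪f.toL2, g.toL2⟫_ℂ = ∫ x, star (f x) * g x := by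
  rw [L2.inner_def]
  refine integral_congr_ae ?_
  filter_upwards [f.coeFn_toL2, g.coeFn_toL2] with x hf hg
  rw [hf, hg, RCLike.inner_apply, mul_comm]
  rfl

theorem mulOp_coeFn (h : Test d) (f : L2 d) : mulOp h f =ᵐ[volume] fun x => h x * f x :=
  (memLp_mul h f).coeFn_toLp

theorem convOp_coeFn (g : Test d) (f : L2 d) : convOp g f =ᵐ[volume] convolve g f :=
  (memLp_conv g f).coeFn_toLp

theorem mulOp_toL2 (h f : Test d) : mulOp h f.toL2 = (mulTest h f).toL2 := by
  refine Lp.ext ?_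
  filter_upwards [mulOp_coeFn h f.toL2, (mulTest h f).coeFn_toL2, f.coeFn_toL2] with x h1 h2 h3
  rw [h1, h2, h3, mulTest_apply]

theorem convOp_toL2 (g f : Test d) : convOp g f.toL2 = (convTest g f).toL2 := by
  refine Lp.ext ?_
  filter_upwards [convOp_coeFn g f.toL2, (convTest g f).coeFn_toL2] with x h1 h2
  rw [h1, h2, conv_congr g f.coeFn_toL2]
  rfl

/-- The complex conjugate of a test function. -/
def conjTest (h : Test d) : Test d where
  toFun x := star (h x)
  contDiff' := Complex.conjCLE.contDiff.comp h.smooth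
  hasCompactSupport' := h.compactSupport.comp_left (g := star) (star_zero ℂ)
  tsupport_subset' := fun _ _ => trivial

/-- The test function `x ↦ conj (g (-x))`; convolution by it is the adjoint of convolution
by `g`. -/
def conjReflTest (g : Test d) : Test d where
  toFun x := star (g (-x))
  contDiff' := Complex.conjCLE.contDiff.comp (g.smooth.comp contDiff_neg)
  hasCompactSupport' :=
    (g.compactSupport.comp_homeomorph (Homeomorph.neg _)).comp_left (g := star) (star_zero ℂ)
  tsupport_subset' := fun _ _ => trivial

theorem conjTest_apply (h : Test d) (x : Space d) : conjTest h x = star (h x) := rfl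
theorem conjReflTest_apply (g : Test d) (x : Space d) : conjReflTest g x = star (g (-x)) := rfl

theorem adjoint_mulOp (h : Test d) : (mulOp h).adjoint = mulOp (conjTest h) := by
  symm
  rw [ContinuousLinearMap.eq_adjoint_iff]
  intro u v
  rw [L2.inner_def, L2.inner_def]
  refine integral_congr_ae ?_
  filter_upwards [mulOp_coeFn (conjTest h) u, mulOp_coeFn h v] with x h1 h2
  rw [h1, h2]
  simp only [RCLike.inner_apply, conjTest_apply, map_mul, Complex.star_def,
    RingHomCompTriple.comp_apply, RingHom.id_apply]
  ring_nf

theorem inner_convTest (g u v : Test d) :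
    ⟪(convTest (conjReflTest g) u).toL2, v.toL2⟫_ℂ = ⟪u.toL2, (convTest g v).toL2⟫_ℂ := by
  have hcs : ∀ F : Space d × Space d → ℂ, Continuous F → (∀ p, p.2 ∉ tsupport g → F p = 0) →
      (∀ w : Test d, (∀ p, p.1 ∉ tsupport w → F p = 0) → Integrable F (volume.prod volume)) := by
    intro F hF h1 w h2
    refine hF.integrable_of_hasCompactSupport (HasCompactSupport.intro
      (w.compactSupport.isCompact.prod g.compactSupport.isCompact) fun p hp => ?_)
    rw [Set.mem_prod, not_and_or] at hp
    exact hp.elim (h2 p) (h1 p)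
  have hgz : ∀ t, t ∉ tsupport g → g t = 0 := fun t => image_eq_zero_of_notMem_tsupport
  have hint1 : Integrable (Function.uncurry fun x t => star (u x) * (g t * v (x - t)))
      ((volume : Measure (Space d)).prod volume) := by
    refine hcs _ ?_ (fun p hp => ?_) u fun p hp => ?_
    · have := g.cont; have := u.cont; have := v.cont
      fun_prop
    · simp [Function.uncurry, hgz _ hp]
    · simp [Function.uncurry, image_eq_zero_of_notMem_tsupport hp]
  have hint2 : Integrable (Function.uncurry fun x t => star (u (x + t)) * (g t * v x))
      ((volume : Measure (Space d)).prod volume) := by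
    refine hcs _ ?_ (fun p hp => ?_) v fun p hp => ?_
    · have := g.cont; have := u.cont; have := v.cont
      fun_prop
    · simp [Function.uncurry, hgz _ hp]
    · simp [Function.uncurry, image_eq_zero_of_notMem_tsupport hp]
  rw [inner_toL2, inner_toL2]
  calc ∫ x, star (convTest (conjReflTest g) u x) * v x
      = ∫ x, ∫ t, star (u (x + t)) * (g t * v x) := by
        congr 1
        ext x
        rw [convTest_apply, ← integral_neg_eq_self, Complex.star_def, ← integral_conj,
          ← integral_mul_const]
        congr 1
        ext t
        simp only [conjReflTest_apply, map_mul, Complex.star_def, neg_neg, Complex.conj_conj,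
          sub_neg_eq_add]
        ring
    _ = ∫ t, ∫ x, star (u (x + t)) * (g t * v x) := integral_integral_swap hint2
    _ = ∫ t, ∫ x, star (u x) * (g t * v (x - t)) := by
        congr 1
        ext t
        rw [← integral_add_right_eq_self (fun x => star (u x) * (g t * v (x - t))) t]
        simp only [add_sub_cancel_right]
    _ = ∫ x, ∫ t, star (u x) * (g t * v (x - t)) := (integral_integral_swap hint1).symm
    _ = ∫ x, star (u x) * convTest g v x := by
        simp only [convTest_apply, integral_const_mul]

theorem adjoint_convOp (g : Test d) : (convOp g).adjoint = convOp (conjReflTest g) := by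
  symm
  rw [ContinuousLinearMap.eq_adjoint_iff]
  intro u v
  refine denseRange_toL2.induction_on₂ (p := fun u v : L2 d =>
    ⟪convOp (conjReflTest g) u, v⟫_ℂ = ⟪u, convOp g v⟫_ℂ) ?_ ?_ u v
  · exact isClosed_eq (by fun_prop) (by fun_prop)
  · intro u v
    rw [convOp_toL2, convOp_toL2, inner_convTest]

/-! ### Norm bounds and strong limits of the scaled operators -/

theorem norm_mulOp_le {h : Test d} {C : ℝ} (hC0 : 0 ≤ C) (hC : ∀ x, ‖h x‖ ≤ C) :
    ‖mulOp h‖ ≤ C := by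
  refine ContinuousLinearMap.opNorm_le_bound _ hC0 fun f => ?_
  refine Lp.norm_le_mul_norm_of_ae_le_mul ?_
  filter_upwards [mulOp_coeFn h f] with x hx
  rw [hx, norm_mul]
  exact mul_le_mul_of_nonneg_right (hC x) (norm_nonneg _)

theorem norm_convOp_le (g : Test d) : ‖convOp g‖ ≤ ∫ x, ‖g x‖ := by
  refine ContinuousLinearMap.opNorm_le_bound _ (integral_nonneg fun _ => norm_nonneg _)
    fun f => ?_
  have h := ENNReal.toReal_mono
    (ENNReal.mul_ne_top (lintegral_enorm_ne_top g) (Lp.memLp f).2.ne) (eLpNorm_conv_le g f)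
  rw [ENNReal.toReal_mul, ← ofReal_integral_norm_eq_lintegral_enorm
    (g.cont.integrable_of_hasCompactSupport g.compactSupport),
    ENNReal.toReal_ofReal (integral_nonneg fun _ => norm_nonneg _)] at h
  rw [Lp.norm_def f]
  refine le_trans (le_of_eq ?_) h
  exact Lp.norm_toLp _ (memLp_conv g f)

theorem norm_mulOp_spread_le (h : Test d) : ∃ C, ∀ n, ‖mulOp (spread n h)‖ ≤ C := by
  obtain ⟨c, hc⟩ := exists_bound h
  exact ⟨c, fun n => norm_mulOp_le ((norm_nonneg _).trans (hc 0)) fun x => hc _⟩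

theorem integral_concentrate {E : Type*} [NormedAddCommGroup E] [NormedSpace ℝ E] (n : ℕ+)
    (F : Space d → E) : ∫ t, ((n : ℝ) ^ d) • F ((n : ℝ) • t) = ∫ t, F t := by
  have hn : (0 : ℝ) < (n : ℝ) ^ d := pow_pos (by exact_mod_cast n.pos) d
  rw [integral_smul, Measure.integral_comp_smul, finrank_euclideanSpace_fin,
    abs_of_pos (inv_pos.2 hn), smul_smul, mul_inv_cancel₀ hn.ne', one_smul]

theorem norm_convOp_concentrate_le (n : ℕ+) (g : Test d) :
    ‖convOp (concentrate n g)‖ ≤ ∫ x, ‖g x‖ := by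
  refine (norm_convOp_le _).trans (le_of_eq ?_)
  rw [← integral_concentrate n fun x => ‖g x‖]
  simp [concentrate_apply]

theorem convTest_concentrate_apply (n : ℕ+) (g f : Test d) (x : Space d) :
    convTest (concentrate n g) f x = ∫ t, g t * f (x - (n : ℝ)⁻¹ • t) := by
  rw [convTest_apply, ← integral_concentrate n fun t => g t * f (x - (n : ℝ)⁻¹ • t)]
  congr 1
  ext t
  have hn : (n : ℝ) ≠ 0 := by exact_mod_cast n.ne_zero
  rw [smul_smul, inv_mul_cancel₀ hn, one_smul, concentrate_apply, Complex.real_smul]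
  push_cast
  ring

/-- A uniform bound on test functions supported in a fixed ball controls their `L²` norms. -/
theorem exists_norm_toL2_le (r : ℝ) : ∃ K : ℝ, ∀ (f : Test d) (ε : ℝ), 0 ≤ ε →
    (∀ x, ‖f x‖ ≤ ε) → (∀ x, r < ‖x‖ → f x = 0) → ‖f.toL2‖ ≤ ε * K := by
  let K : ℝ≥0∞ := volume (Metric.closedBall (0 : Space d) r) ^ (1 / 2 : ℝ)
  have hK : K ≠ ⊤ := ENNReal.rpow_ne_top_of_nonneg (by norm_num) measure_closedBall_lt_top.ne
  refine ⟨K.toReal, fun f ε hε hf hr => ?_⟩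
  have h1 : eLpNorm f 2 volume ≤
      eLpNorm ((Metric.closedBall (0 : Space d) r).indicator fun _ => ε) 2 volume := by
    refine eLpNorm_mono_real fun x => ?_
    by_cases hx : x ∈ Metric.closedBall (0 : Space d) r
    · rw [Set.indicator_of_mem hx]; exact hf x
    · rw [Set.indicator_of_notMem hx, hr x (by simpa using hx), norm_zero]
  have h2 := h1.trans (eLpNorm_indicator_const_le ε 2)
  have h3 := ENNReal.toReal_mono (by
    exact ENNReal.mul_ne_top enorm_ne_top (by simpa [K] using hK)) h2
  rw [ENNReal.toReal_mul, toReal_enorm, Real.norm_of_nonneg hε] at h3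
  refine le_trans (le_of_eq ?_) (h3.trans (le_of_eq ?_))
  · exact Lp.norm_toLp _ (f.memLp 2)
  · simp [K]

theorem tendsto_inv_pnat : Tendsto (fun n : ℕ+ => ((n : ℝ))⁻¹) atTop (𝓝 0) :=
  (PNat.tendsto_comp_val_iff (f := fun n : ℕ => ((n : ℝ))⁻¹)).2 tendsto_inv_atTop_nhds_zero_nat

theorem Test.exists_lipschitz (f : Test d) : ∃ L : ℝ, 0 ≤ L ∧ ∀ x y, ‖f x - f y‖ ≤ L * ‖x - y‖ := by
  obtain ⟨L, hL⟩ := ContDiff.lipschitzWith_of_hasCompactSupport (𝕂 := ℝ) f.compactSupport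
    f.smooth (by simp)
  exact ⟨L, L.coe_nonneg, fun x y => hL.norm_sub_le x y⟩

theorem Test.exists_radius (f : Test d) : ∃ r : ℝ, 0 ≤ r ∧ ∀ x, r < ‖x‖ → f x = 0 := by
  obtain ⟨r, hr⟩ := f.compactSupport.isCompact.isBounded.exists_norm_le
  refine ⟨max r 0, le_max_right _ _, fun x hx => ?_⟩
  by_contra h
  exact absurd (hr x (subset_tsupport _ h)) (not_le.2 ((le_max_left _ _).trans_lt hx))

/-- Strong convergence of a bounded family of operators may be checked on a dense set. -/
theorem tendsto_of_dense {α E : Type*} [NormedAddCommGroup E] [NormedSpace ℂ E] {l : Filter α}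
    {T : α → E →L[ℂ] E} {T₀ : E →L[ℂ] E} {C : ℝ} (hC : ∀ n, ‖T n‖ ≤ C) {β : Type*} {e : β → E}
    (he : DenseRange e) (h : ∀ b, Tendsto (fun n => T n (e b)) l (𝓝 (T₀ (e b)))) (x : E) :
    Tendsto (fun n => T n x) l (𝓝 (T₀ x)) := by
  rcases isEmpty_or_nonempty α with hα | ⟨⟨n₀⟩⟩
  · rw [filter_eq_bot_of_isEmpty l]; exact tendsto_bot
  have hC0 : 0 ≤ C := (norm_nonneg _).trans (hC n₀)
  rw [Metric.tendsto_nhds]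
  intro ε hε
  have hpos : 0 < C + ‖T₀‖ + 1 := by positivity
  obtain ⟨b, hb⟩ := he.exists_dist_lt x (ε := ε / 2 / (C + ‖T₀‖ + 1)) (by positivity)
  filter_upwards [(Metric.tendsto_nhds.1 (h b)) (ε / 2) (by positivity)] with n hn
  rw [dist_eq_norm] at hb hn ⊢
  have h1 : T n x - T₀ x = T n (x - e b) + (T n (e b) - T₀ (e b)) - T₀ (x - e b) := by
    simp only [map_sub]; abel
  have h2 := (T n).le_of_opNorm_le (hC n) (x - e b)
  have h3 := T₀.le_opNorm (x - e b)
  have h4 : (C + ‖T₀‖) * ‖x - e b‖ ≤ ε / 2 := by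
    rw [lt_div_iff₀ hpos] at hb
    nlinarith [norm_nonneg (x - e b)]
  rw [h1]
  calc _ ≤ ‖T n (x - e b)‖ + ‖T n (e b) - T₀ (e b)‖ + ‖T₀ (x - e b)‖ :=
        (norm_sub_le _ _).trans (by gcongr; exact norm_add_le _ _)
    _ < ε := by nlinarith

/-- Uniform convergence at the rate `1 / n` with supports in a fixed ball gives convergence
in `L²`. -/
theorem tendsto_toL2_of_le {u : ℕ+ → Test d} {v : Test d} {r c : ℝ} (hc : 0 ≤ c)
    (h : ∀ n x, ‖u n x - v x‖ ≤ c * (n : ℝ)⁻¹) (hr : ∀ n x, r < ‖x‖ → u n x - v x = 0) :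
    Tendsto (fun n => (u n).toL2) atTop (𝓝 v.toL2) := by
  obtain ⟨K, hK⟩ := exists_norm_toL2_le (d := d) r
  rw [tendsto_iff_norm_sub_tendsto_zero]
  have hlim : Tendsto (fun n : ℕ+ => c * (n : ℝ)⁻¹ * K) atTop (𝓝 0) := by
    simpa using (tendsto_inv_pnat.const_mul c).mul_const K
  refine squeeze_zero (fun _ => norm_nonneg _) (fun n => ?_) hlim
  have := hK (u n - v) (c * (n : ℝ)⁻¹) (by positivity) (h n) (hr n)
  rwa [← toL2Lin_apply, map_sub] at this

theorem tendsto_mulOp_spread (h : Test d) (v : L2 d) :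
    Tendsto (fun n => mulOp (spread n h) v) atTop (𝓝 (h 0 • v)) := by
  obtain ⟨C, hC⟩ := norm_mulOp_spread_le h
  refine tendsto_of_dense (T₀ := h 0 • ContinuousLinearMap.id ℂ (L2 d)) hC denseRange_toL2
    (fun f => ?_) v
  show Tendsto _ _ (𝓝 (h 0 • toL2Lin f))
  rw [← map_smul]
  simp only [mulOp_toL2, toL2Lin_apply]
  obtain ⟨L, hL0, hL⟩ := h.exists_lipschitz
  obtain ⟨r, hr0, hr⟩ := f.exists_radius
  obtain ⟨c, hc⟩ := exists_bound f
  have hc0 : 0 ≤ c := (norm_nonneg _).trans (hc 0)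
  have he : ∀ (n : ℕ+) x, mulTest (spread n h) f x - (h 0 • f) x
      = (h ((n : ℝ)⁻¹ • x) - h 0) * f x := fun n x => by
    rw [mulTest_apply, spread_apply, Test.smul_apply, sub_mul]
  refine tendsto_toL2_of_le (r := r) (c := L * r * c) (by positivity) (fun n x => ?_)
    fun n x hx => by rw [he, hr x hx, mul_zero]
  rw [he]
  rcases le_or_gt ‖x‖ r with hx | hx
  · rw [norm_mul]
    have h1 := hL ((n : ℝ)⁻¹ • x) 0
    rw [sub_zero, norm_smul, norm_inv, Real.norm_natCast] at h1
    calc _ ≤ (L * ((n : ℝ)⁻¹ * r)) * c := by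
          gcongr
          · exact h1.trans (by gcongr)
          · exact hc x
      _ = _ := by ring
  · rw [hr x hx, mul_zero, norm_zero]
    positivity

theorem tendsto_convOp_concentrate (g : Test d) (v : L2 d) :
    Tendsto (fun n => convOp (concentrate n g) v) atTop (𝓝 ((∫ t, g t) • v)) := by
  refine tendsto_of_dense (T₀ := (∫ t, g t) • ContinuousLinearMap.id ℂ (L2 d))
    (norm_convOp_concentrate_le · g) denseRange_toL2 (fun f => ?_) v
  show Tendsto _ _ (𝓝 ((∫ t, g t) • toL2Lin f))
  rw [← map_smul]
  simp only [convOp_toL2, toL2Lin_apply]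
  obtain ⟨L, hL0, hL⟩ := f.exists_lipschitz
  obtain ⟨r, hr0, hr⟩ := f.exists_radius
  obtain ⟨s, hs0, hs⟩ := g.exists_radius
  have hgi : Integrable (g : Space d → ℂ) :=
    g.cont.integrable_of_hasCompactSupport g.compactSupport
  have hi : ∀ (n : ℕ+) x, Integrable fun t => g t * f (x - (n : ℝ)⁻¹ • t) := fun n x => by
    refine Continuous.integrable_of_hasCompactSupport ?_ g.compactSupport.mul_right
    have := g.cont; have := f.cont
    fun_prop
  have he : ∀ (n : ℕ+) x, convTest (concentrate n g) f x - ((∫ t, g t) • f) x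
      = ∫ t, g t * (f (x - (n : ℝ)⁻¹ • t) - f x) := fun n x => by
    rw [convTest_concentrate_apply, Test.smul_apply, ← integral_mul_const,
      ← integral_sub (hi n x) (hgi.mul_const _)]
    simp only [mul_sub]
  refine tendsto_toL2_of_le (r := r + s) (c := (∫ t, ‖g t‖) * (L * s))
    (mul_nonneg (integral_nonneg fun _ => norm_nonneg _) (by positivity)) (fun n x => ?_)
    fun n x hx => ?_
  · rw [he, mul_assoc, ← integral_mul_const]
    refine norm_integral_le_of_norm_le (hgi.norm.mul_const _) (Eventually.of_forall fun t => ?_)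
    rcases le_or_gt ‖t‖ s with ht | ht
    · rw [norm_mul]
      gcongr
      have h1 := hL (x - (n : ℝ)⁻¹ • t) x
      rw [sub_sub_cancel_left, norm_neg, norm_smul, norm_inv, Real.norm_natCast] at h1
      calc _ ≤ L * ((n : ℝ)⁻¹ * s) := h1.trans (by gcongr)
        _ = _ := by ring
    · rw [hs t ht, zero_mul, norm_zero, zero_mul]
  · rw [he]
    refine integral_eq_zero_of_ae (Eventually.of_forall fun t => ?_)
    rcases le_or_gt ‖t‖ s with ht | ht
    · have hn : (n : ℝ)⁻¹ ≤ 1 := inv_le_one_of_one_le₀ (by exact_mod_cast n.pos)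
      have h1 : ‖(n : ℝ)⁻¹ • t‖ ≤ s := by
        rw [norm_smul, norm_inv, Real.norm_natCast]
        nlinarith [norm_nonneg t]
      have h2 := norm_sub_norm_le x ((n : ℝ)⁻¹ • t)
      show g t * (f (x - (n : ℝ)⁻¹ • t) - f x) = 0
      rw [hr _ (by linarith), hr x (by linarith), sub_zero, mul_zero]
    · show g t * (f (x - (n : ℝ)⁻¹ • t) - f x) = 0
      rw [hs t ht, zero_mul]

/-- The bounded operator `C(g_n) M(h_n)` extending `scaledConvMul n g h`. -/
def scaledOp (n : ℕ+) (g h : Test d) : BoundedOp d :=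
  convOp (concentrate n g) ∘L mulOp (spread n h)

theorem scaledOp_toL2 (n : ℕ+) (g h f : Test d) :
    scaledOp n g h f.toL2 = (scaledConvMul n g h f).toL2 := by
  rw [scaledOp, ContinuousLinearMap.comp_apply, mulOp_toL2, convOp_toL2]
  rfl

theorem conjReflTest_concentrate (n : ℕ+) (g : Test d) :
    conjReflTest (concentrate n g) = concentrate n (conjReflTest g) := by
  ext x
  simp [conjReflTest_apply, concentrate_apply]

theorem conjTest_spread (n : ℕ+) (h : Test d) :
    conjTest (spread n h) = spread n (conjTest h) := rfl

theorem adjoint_scaledOp (n : ℕ+) (g h : Test d) : (scaledOp n g h).adjoint =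
    mulOp (spread n (conjTest h)) ∘L convOp (concentrate n (conjReflTest g)) := by
  rw [scaledOp, ContinuousLinearMap.adjoint_comp, adjoint_mulOp, adjoint_convOp,
    conjReflTest_concentrate, conjTest_spread]

theorem exists_norm_scaledOp_le (g h : Test d) : ∃ C, ∀ n, ‖scaledOp n g h‖ ≤ C := by
  obtain ⟨C, hC⟩ := norm_mulOp_spread_le h
  refine ⟨(∫ x, ‖g x‖) * C, fun n => (ContinuousLinearMap.opNorm_comp_le _ _).trans ?_⟩
  exact mul_le_mul (norm_convOp_concentrate_le n g) (hC n) (norm_nonneg _)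
    (integral_nonneg fun _ => norm_nonneg _)

/-- The adjoints of `C(g_n) M(h_n)` converge strongly to the multiple of the identity by the
conjugate of `(∫ g) h(0)`. -/
theorem tendsto_adjoint_scaledOp (g h : Test d) (v : L2 d) :
    Tendsto (fun n => (scaledOp n g h).adjoint v) atTop
      (𝓝 (star ((∫ t, g t) * h 0) • v)) := by
  obtain ⟨C, hC⟩ := norm_mulOp_spread_le (conjTest h)
  have hint : ∫ t, conjReflTest g t = star (∫ t, g t) := by
    simp only [conjReflTest_apply, Complex.star_def]
    rw [integral_conj, integral_neg_eq_self]
  have h1 := tendsto_convOp_concentrate (conjReflTest g) v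
  have h2 := tendsto_mulOp_spread (conjTest h) ((∫ t, conjReflTest g t) • v)
  rw [conjTest_apply, smul_smul, hint, mul_comm, ← star_mul'] at h2
  rw [hint] at h1
  have h3 : Tendsto (fun n => mulOp (spread n (conjTest h))
      (convOp (concentrate n (conjReflTest g)) v - star (∫ t, g t) • v)) atTop (𝓝 0) := by
    rw [tendsto_zero_iff_norm_tendsto_zero]
    have h4 := ((tendsto_iff_norm_sub_tendsto_zero.1 h1).const_mul C)
    rw [mul_zero] at h4
    exact squeeze_zero (fun _ => norm_nonneg _)
      (fun n => ContinuousLinearMap.le_of_opNorm_le _ (hC n) _) h4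
  have h5 := h3.add h2
  rw [zero_add] at h5
  refine h5.congr fun n => ?_
  rw [adjoint_scaledOp, ContinuousLinearMap.comp_apply, ← map_add, sub_add_cancel]

end BoundedRealizations

/-! ### Commutators of differential operators with the smoothing operators -/

section Commutators

variable {d : ℕ}

/-- Families of endomorphisms of the space of test functions which extend to a uniformly bounded
family of operators on `L²(ℝᵈ)`. -/
def boundedFamilies (d : ℕ) : Submodule ℂ (ℕ+ → Module.End ℂ (Test d)) where
  carrier := {D | ∃ (E : ℕ+ → BoundedOp d) (C : ℝ), (∀ n f, E n f.toL2 = (D n f).toL2) ∧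
    ∀ n, ‖E n‖ ≤ C}
  zero_mem' := ⟨0, 0, fun n f => by simpa using (map_zero toL2Lin).symm, fun n => by simp⟩
  add_mem' := by
    rintro D₁ D₂ ⟨E₁, C₁, h₁, hC₁⟩ ⟨E₂, C₂, h₂, hC₂⟩
    refine ⟨E₁ + E₂, C₁ + C₂, fun n f => ?_, fun n =>
      (norm_add_le _ _).trans (add_le_add (hC₁ n) (hC₂ n))⟩
    exact (congrArg₂ (· + ·) (h₁ n f) (h₂ n f)).trans (map_add toL2Lin _ _).symm
  smul_mem' := by
    rintro c D ⟨E, C, h, hC⟩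
    refine ⟨c • E, ‖c‖ * C, fun n f => ?_, fun n => ?_⟩
    · exact (congrArg (c • ·) (h n f)).trans (map_smul toL2Lin _ _).symm
    · rw [Pi.smul_apply, norm_smul]
      gcongr
      exact hC n

/-- Families of endomorphisms of the space of test functions which extend to a uniformly bounded
family of operators on `L²(ℝᵈ)` whose adjoints converge strongly to `0`. -/
def smallFamilies (d : ℕ) : Submodule ℂ (ℕ+ → Module.End ℂ (Test d)) where
  carrier := {D | ∃ (E : ℕ+ → BoundedOp d) (C : ℝ), (∀ n f, E n f.toL2 = (D n f).toL2) ∧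
    (∀ n, ‖E n‖ ≤ C) ∧ ∀ v, Tendsto (fun n => (E n).adjoint v) atTop (𝓝 0)}
  zero_mem' := ⟨0, 0, fun n f => by simpa using (map_zero toL2Lin).symm, fun n => by simp,
    fun v => by simp⟩
  add_mem' := by
    rintro D₁ D₂ ⟨E₁, C₁, h₁, hC₁, hE₁⟩ ⟨E₂, C₂, h₂, hC₂, hE₂⟩
    refine ⟨E₁ + E₂, C₁ + C₂, fun n f => ?_, fun n =>
      (norm_add_le _ _).trans (add_le_add (hC₁ n) (hC₂ n)), fun v => ?_⟩
    · exact (congrArg₂ (· + ·) (h₁ n f) (h₂ n f)).trans (map_add toL2Lin _ _).symm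
    · simpa using (hE₁ v).add (hE₂ v)
  smul_mem' := by
    rintro c D ⟨E, C, h, hC, hE⟩
    refine ⟨c • E, ‖c‖ * C, fun n f => ?_, fun n => ?_, fun v => ?_⟩
    · exact (congrArg (c • ·) (h n f)).trans (map_smul toL2Lin _ _).symm
    · rw [Pi.smul_apply, norm_smul]
      gcongr
      exact hC n
    · have := (hE v).const_smul (star c)
      simp only [smul_zero] at this
      refine this.congr fun n => ?_
      rw [Pi.smul_apply, map_smulₛₗ]
      rfl

theorem scaledConvMul_mem_boundedFamilies (g h : Test d) :
    (fun n => scaledConvMul n g h) ∈ boundedFamilies d := by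
  obtain ⟨C, hC⟩ := exists_norm_scaledOp_le g h
  exact ⟨fun n => scaledOp n g h, C, fun n f => scaledOp_toL2 n g h f, hC⟩

theorem scaledConvMul_mem_smallFamilies {g h : Test d} (h0 : (∫ t, g t) * h 0 = 0) :
    (fun n => scaledConvMul n g h) ∈ smallFamilies d := by
  obtain ⟨C, hC⟩ := exists_norm_scaledOp_le g h
  refine ⟨fun n => scaledOp n g h, C, fun n f => scaledOp_toL2 n g h f, hC, fun v => ?_⟩
  simpa [h0] using tendsto_adjoint_scaledOp g h v

theorem smul_mem_smallFamilies {D : ℕ+ → Module.End ℂ (Test d)} (hD : D ∈ boundedFamilies d)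
    {a : ℕ+ → ℂ} (ha : Tendsto a atTop (𝓝 0)) {c : ℝ} (hc : ∀ n, ‖a n‖ ≤ c) :
    (fun n => a n • D n) ∈ smallFamilies d := by
  obtain ⟨E, C, h, hC⟩ := hD
  refine ⟨fun n => a n • E n, c * C, fun n f => ?_, fun n => ?_, fun v => ?_⟩
  · exact (congrArg (a n • ·) (h n f)).trans (map_smul toL2Lin _ _).symm
  · rw [norm_smul]
    exact mul_le_mul (hc n) (hC n) (norm_nonneg _) ((norm_nonneg _).trans (hc n))
  · rw [tendsto_zero_iff_norm_tendsto_zero]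
    have h1 : Tendsto (fun n => ‖a n‖ * (C * ‖v‖)) atTop (𝓝 0) := by
      simpa using ha.norm.mul_const (C * ‖v‖)
    refine squeeze_zero (fun _ => norm_nonneg _) (fun n => ?_) h1
    refine (ContinuousLinearMap.le_opNorm _ _).trans ?_
    rw [LinearIsometryEquiv.norm_map, norm_smul, mul_assoc]
    gcongr
    exact hC n

theorem tendsto_inv_pnat_complex : Tendsto (fun n : ℕ+ => ((n : ℂ))⁻¹) atTop (𝓝 0) := by
  rw [tendsto_zero_iff_norm_tendsto_zero]
  simpa using tendsto_inv_pnat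

theorem norm_inv_pnat_le (n : ℕ+) : ‖(n : ℂ)⁻¹‖ ≤ 1 := by
  rw [norm_inv, Complex.norm_natCast]
  exact inv_le_one_of_one_le₀ (by exact_mod_cast n.pos)

theorem integral_der (k : Fin d) (g : Test d) : ∫ t, der k g t = 0 := by
  have hi : ∀ f : Test d, Integrable (f : Space d → ℂ) := fun f =>
    f.cont.integrable_of_hasCompactSupport f.compactSupport
  have he : ∀ x, der k g x = fderiv ℝ g x (EuclideanSpace.single k 1) := der_apply k g
  simp only [he]
  have h := integral_mul_fderiv_eq_neg_fderiv_mul_of_integrable (μ := volume)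
    (f := fun _ : Space d => (1 : ℂ)) (g := g) (v := EuclideanSpace.single k 1)
    (by simp)
    (by simpa only [one_mul, he] using (hi (der k g)).congr (Eventually.of_forall he))
    (by simpa using hi g)
    (fun x _ => differentiableAt_const _) fun x _ => (g.hasFDerivAt x).differentiableAt
  simpa using h

/-- The generators `1`, `x_k` and `∂_k` of the space of first order operators. -/
inductive IsGenerator : Module.End ℂ (Test d) → Prop
  | one : IsGenerator 1
  | coordinate (k : Fin d) : IsGenerator (posEnd k)
  | partialDerivative (k : Fin d) : IsGenerator (derEnd k)

variable (d) in
/-- The operators `α · x + β · ∇ + γ` with `α, β ∈ ℂᵈ` and `γ ∈ ℂ`. -/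
def firstOrder : Submodule ℂ (Module.End ℂ (Test d)) := Submodule.span ℂ {D | IsGenerator D}

/-- The commutator of a generator with `W_n(g, h)` is `1 / n` times an operator of the same
form. -/
theorem IsGenerator.exists_commutator {D : Module.End ℂ (Test d)} (hD : IsGenerator D)
    (g h : Test d) : ∃ (c : ℂ) (g₁ h₁ : Test d), ∀ n : ℕ+,
      scaledConvMul n g h * D - D * scaledConvMul n g h =
        (n : ℂ)⁻¹ • c • scaledConvMul n g₁ h₁ := by
  rcases hD with _ | k | k
  · exact ⟨0, g, h, fun n => by simp⟩
  · refine ⟨-1, pos k g, h, fun n => ?_⟩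
    rw [scaledConvMul_mul_posEnd, posEnd_mul_scaledConvMul]
    module
  · refine ⟨-1, g, der k h, fun n => ?_⟩
    rw [scaledConvMul_mul_derEnd, derEnd_mul_scaledConvMul]
    module

/-- A first order operator composed with `W_n(g, h)` has size `o(n)`: the part of size `n` is
`W_n(g, x_k h)` or `W_n(∂_k g, h)`, and these tend to `0` strongly because `x_k h` vanishes at `0`
and `∂_k g` has integral `0`. -/
theorem IsGenerator.inv_smul_mem {D : Module.End ℂ (Test d)} (hD : IsGenerator D)
    (g h : Test d) : (fun n : ℕ+ => (n : ℂ)⁻¹ • (scaledConvMul n g h * D)) ∈ smallFamilies d := by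
  rcases hD with _ | k | k
  · simp only [mul_one]
    exact smul_mem_smallFamilies (scaledConvMul_mem_boundedFamilies g h)
      tendsto_inv_pnat_complex norm_inv_pnat_le
  · simp only [scaledConvMul_mul_posEnd]
    have : (pos k h) 0 = 0 := by simp [pos_apply]
    refine (congrArg (· ∈ smallFamilies d) (funext fun n : ℕ+ => ?_)).mp
      (scaledConvMul_mem_smallFamilies (g := g) (h := pos k h) (by rw [this, mul_zero]))
    rw [smul_smul, inv_mul_cancel₀ (pnat_ne_zero n), one_smul]
  · simp only [scaledConvMul_mul_derEnd]
    have h1 := scaledConvMul_mem_smallFamilies (g := der k g) (h := h)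
      (by rw [integral_der, zero_mul])
    have h2 := smul_mem_smallFamilies (scaledConvMul_mem_boundedFamilies g (der k h))
      (a := fun n => (n : ℂ)⁻¹ * (n : ℂ)⁻¹) (c := 1)
      (by simpa using tendsto_inv_pnat_complex.mul tendsto_inv_pnat_complex)
      (fun n => by
        rw [norm_mul]
        exact mul_le_one₀ (norm_inv_pnat_le n) (norm_nonneg _) (norm_inv_pnat_le n))
    refine (congrArg (· ∈ smallFamilies d) (funext fun n : ℕ+ => ?_)).mp (Submodule.sub_mem _ h1 h2)
    rw [Pi.sub_apply]
    rw [smul_sub, smul_smul, smul_smul, inv_mul_cancel₀ (pnat_ne_zero n), one_smul]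

theorem IsGenerator.inv_smul_mem_left {D : Module.End ℂ (Test d)} (hD : IsGenerator D)
    (g h : Test d) : (fun n : ℕ+ => (n : ℂ)⁻¹ • (D * scaledConvMul n g h)) ∈ smallFamilies d := by
  obtain ⟨c, g₁, h₁, he⟩ := hD.exists_commutator g h
  have h2 := smul_mem_smallFamilies
    (Submodule.smul_mem _ c (scaledConvMul_mem_boundedFamilies g₁ h₁))
    (a := fun n => (n : ℂ)⁻¹ * (n : ℂ)⁻¹) (c := 1)
    (by simpa using tendsto_inv_pnat_complex.mul tendsto_inv_pnat_complex)
    (fun n => by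
      rw [norm_mul]
      exact mul_le_one₀ (norm_inv_pnat_le n) (norm_nonneg _) (norm_inv_pnat_le n))
  refine (congrArg (· ∈ smallFamilies d) (funext fun n : ℕ+ => ?_)).mp
    (Submodule.sub_mem _ (hD.inv_smul_mem g h) h2)
  show (n : ℂ)⁻¹ • (scaledConvMul n g h * D) -
    ((n : ℂ)⁻¹ * (n : ℂ)⁻¹) • c • scaledConvMul n g₁ h₁ = _
  rw [mul_smul, ← he n, ← smul_sub, sub_sub_cancel]

/-- The commutator of a first order operator with `W_n(g, h)` has size `O(1 / n)`. -/
theorem smul_commutator_mem_boundedFamilies {D : Module.End ℂ (Test d)} (hD : D ∈ firstOrder d)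
    (g h : Test d) : (fun n : ℕ+ => (n : ℂ) • (scaledConvMul n g h * D - D * scaledConvMul n g h)) ∈
      boundedFamilies d := by
  induction hD using Submodule.span_induction with
  | mem D hD =>
    obtain ⟨c, g₁, h₁, he⟩ := IsGenerator.exists_commutator hD g h
    refine (congrArg (· ∈ boundedFamilies d) (funext fun n : ℕ+ => ?_)).mp
      (Submodule.smul_mem _ c (scaledConvMul_mem_boundedFamilies g₁ h₁))
    rw [he n, smul_smul, mul_inv_cancel₀ (pnat_ne_zero n), one_smul]
    rfl
  | zero =>
    simp only [mul_zero, zero_mul, sub_self, smul_zero]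
    exact Submodule.zero_mem (boundedFamilies d)
  | add D₁ D₂ _ _ h₁ h₂ =>
    refine (congrArg (· ∈ boundedFamilies d) (funext fun n : ℕ+ => ?_)).mp
      (Submodule.add_mem _ h₁ h₂)
    rw [Pi.add_apply]
    rw [mul_add, add_mul, ← smul_add]
    congr 1
    abel
  | smul c D _ h₁ =>
    refine (congrArg (· ∈ boundedFamilies d) (funext fun n : ℕ+ => ?_)).mp
      (Submodule.smul_mem _ c h₁)
    rw [Pi.smul_apply]
    rw [mul_smul_comm, smul_mul_assoc, ← smul_sub, smul_comm]

theorem inv_smul_mem_smallFamilies {D : Module.End ℂ (Test d)} (hD : D ∈ firstOrder d)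
    (g h : Test d) : (fun n : ℕ+ => (n : ℂ)⁻¹ • (scaledConvMul n g h * D)) ∈ smallFamilies d := by
  induction hD using Submodule.span_induction with
  | mem D hD => exact IsGenerator.inv_smul_mem hD g h
  | zero =>
    simp only [mul_zero, smul_zero]
    exact Submodule.zero_mem (smallFamilies d)
  | add D₁ D₂ _ _ h₁ h₂ =>
    refine (congrArg (· ∈ smallFamilies d) (funext fun n : ℕ+ => ?_)).mp
      (Submodule.add_mem _ h₁ h₂)
    rw [Pi.add_apply]
    rw [mul_add, ← smul_add]
  | smul c D _ h₁ =>
    refine (congrArg (· ∈ smallFamilies d) (funext fun n : ℕ+ => ?_)).mp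
      (Submodule.smul_mem _ c h₁)
    rw [Pi.smul_apply]
    rw [mul_smul_comm, smul_comm]

/-- The commutator of a second order operator with `W_n(g, h)` is bounded uniformly in `n`, and
its adjoint tends to `0` strongly: in `[W, D₁ D₂] = [W, D₁] D₂ + D₁ [W, D₂]` the commutators gain a
factor `1 / n`, while the remaining first order operators cost only `o(n)`. -/
theorem commutator_mem_smallFamilies {D : Module.End ℂ (Test d)}
    (hD : D ∈ firstOrder d * firstOrder d) (g h : Test d) :
    (fun n : ℕ+ => scaledConvMul n g h * D - D * scaledConvMul n g h) ∈ smallFamilies d := by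
  rw [firstOrder, Submodule.span_mul_span] at hD
  induction hD using Submodule.span_induction with
  | mem D hD =>
    obtain ⟨D₁, hD₁, D₂, hD₂, rfl⟩ := Set.mem_mul.1 hD
    obtain ⟨c₁, g₁, h₁, he₁⟩ := IsGenerator.exists_commutator hD₁ g h
    obtain ⟨c₂, g₂, h₂, he₂⟩ := IsGenerator.exists_commutator hD₂ g h
    refine (congrArg (· ∈ smallFamilies d) (funext fun n : ℕ+ => ?_)).mp
      (Submodule.add_mem _
        (Submodule.smul_mem _ c₁ (IsGenerator.inv_smul_mem hD₂ g₁ h₁))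
        (Submodule.smul_mem _ c₂ (IsGenerator.inv_smul_mem_left hD₁ g₂ h₂)))
    have e : scaledConvMul n g h * (D₁ * D₂) - D₁ * D₂ * scaledConvMul n g h =
        (scaledConvMul n g h * D₁ - D₁ * scaledConvMul n g h) * D₂ +
          D₁ * (scaledConvMul n g h * D₂ - D₂ * scaledConvMul n g h) := by noncomm_ring
    rw [e, he₁ n, he₂ n]
    simp only [Pi.add_apply, Pi.smul_apply, smul_mul_assoc, mul_smul_comm]
    rw [smul_comm c₁, smul_comm c₂]
  | zero =>
    simp only [mul_zero, zero_mul, sub_self]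
    exact Submodule.zero_mem (smallFamilies d)
  | add D₁ D₂ _ _ h₁ h₂ =>
    refine (congrArg (· ∈ smallFamilies d) (funext fun n : ℕ+ => ?_)).mp
      (Submodule.add_mem _ h₁ h₂)
    rw [Pi.add_apply]
    rw [mul_add, add_mul]
    abel
  | smul c D _ h₁ =>
    refine (congrArg (· ∈ smallFamilies d) (funext fun n : ℕ+ => ?_)).mp
      (Submodule.smul_mem _ c h₁)
    rw [Pi.smul_apply]
    rw [mul_smul_comm, smul_mul_assoc, ← smul_sub]

variable (d) in
/-- The span of the endomorphisms `f ↦ g ∗ (h f)`. It is stable under composition from the right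
with first order operators. -/
def convMulSpan : Submodule ℂ (Module.End ℂ (Test d)) :=
  Submodule.span ℂ {D | ∃ g h, D = convMul g h}

theorem convMul_mem_convMulSpan (g h : Test d) : convMul g h ∈ convMulSpan d :=
  Submodule.subset_span ⟨g, h, rfl⟩

theorem exists_realization {D : Module.End ℂ (Test d)} (hD : D ∈ convMulSpan d) :
    ∃ E : BoundedOp d, ∀ f : Test d, E f.toL2 = (D f).toL2 := by
  induction hD using Submodule.span_induction with
  | mem D hD =>
    obtain ⟨g, h, rfl⟩ := hD
    exact ⟨convOp g ∘L mulOp h, fun f => by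
      rw [ContinuousLinearMap.comp_apply, mulOp_toL2, convOp_toL2]; rfl⟩
  | zero => exact ⟨0, fun f => by simpa using (map_zero toL2Lin).symm⟩
  | add D₁ D₂ _ _ h₁ h₂ =>
    obtain ⟨E₁, h₁⟩ := h₁
    obtain ⟨E₂, h₂⟩ := h₂
    exact ⟨E₁ + E₂, fun f =>
      (congrArg₂ (· + ·) (h₁ f) (h₂ f)).trans (map_add toL2Lin _ _).symm⟩
  | smul c D _ h =>
    obtain ⟨E, h⟩ := h
    exact ⟨c • E, fun f => (congrArg (c • ·) (h f)).trans (map_smul toL2Lin _ _).symm⟩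

theorem mul_mem_convMulSpan {w D : Module.End ℂ (Test d)} (hw : w ∈ convMulSpan d)
    (hD : D ∈ firstOrder d) : w * D ∈ convMulSpan d := by
  have key : convMulSpan d * firstOrder d ≤ convMulSpan d := by
    rw [convMulSpan, firstOrder, Submodule.span_mul_span, Submodule.span_le]
    rintro _ ⟨_, ⟨g, h, rfl⟩, D, hD, rfl⟩
    show convMul g h * D ∈ convMulSpan d
    rcases hD with _ | k | k
    · rw [mul_one]
      exact convMul_mem_convMulSpan g h
    · rw [convMul_mul_posEnd]
      exact convMul_mem_convMulSpan _ _
    · rw [convMul_mul_derEnd]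
      exact Submodule.sub_mem _ (convMul_mem_convMulSpan _ _) (convMul_mem_convMulSpan _ _)
  exact key (Submodule.mul_mem_mul hw hD)

theorem mul_mem_convMulSpan_of_secondOrder {w D : Module.End ℂ (Test d)} (hw : w ∈ convMulSpan d)
    (hD : D ∈ firstOrder d * firstOrder d) : w * D ∈ convMulSpan d := by
  induction hD using Submodule.mul_induction_on' with
  | mem_mul_mem D₁ h₁ D₂ h₂ =>
    rw [← mul_assoc]
    exact mul_mem_convMulSpan (mul_mem_convMulSpan hw h₁) h₂
  | add D₁ _ D₂ _ h₁ h₂ =>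
    rw [mul_add]
    exact Submodule.add_mem _ h₁ h₂

end Commutators

section Core

variable {d m : ℕ}

/-! ### The weak form of the generator -/

/-- The weak form of `T = Y ρ + ρ Y* + ∑ A_j ρ A_j*`, where `Y` and `A j` stand for the formal
adjoints acting on test functions. Both `ZEq` and `LEq` are instances. -/
def FormEq {κ : Type*} [Fintype κ] (Y : Module.End ℂ (Test d)) (A : κ → Module.End ℂ (Test d))
    (ρ T : BoundedOp d) : Prop :=
  ∀ f g : Test d, ⟪f.toL2, T g.toL2⟫_ℂ =
    ⟪(Y f).toL2, ρ g.toL2⟫_ℂ + ⟪f.toL2, ρ (Y g).toL2⟫_ℂ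
      + ∑ j, ⟪(A j f).toL2, ρ (A j g).toL2⟫_ℂ

/-- A bounded operator is determined by its matrix elements between test functions. -/
theorem ext_of_inner_toL2 {S T : BoundedOp d}
    (h : ∀ f g : Test d, ⟪f.toL2, S g.toL2⟫_ℂ = ⟪f.toL2, T g.toL2⟫_ℂ) : S = T := by
  refine ContinuousLinearMap.ext fun v => ext_inner_left ℂ fun u => ?_
  refine denseRange_toL2.induction_on₂ (p := fun u v : L2 d => ⟪u, S v⟫_ℂ = ⟪u, T v⟫_ℂ) ?_ h u v
  exact isClosed_eq (by fun_prop) (by fun_prop)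

/-! ### The smoothing operators -/

/-- The mollifier profile as a test function. -/
def Mollifier.toTest (φ : Mollifier d) : Test d where
  toFun x := (φ.toFun x : ℂ)
  contDiff' := Complex.ofRealCLM.contDiff.comp φ.smooth
  hasCompactSupport' := by
    refine HasCompactSupport.intro (isCompact_closedBall (0 : Space d) 1) fun x hx => ?_
    have : φ.toFun x = 0 := by
      by_contra h
      exact hx (Metric.ball_subset_closedBall
        (φ.tsupport_subset (subset_tsupport _ (Function.mem_support.2 h))))
    simp [this]
  tsupport_subset' := fun _ _ => trivial

/-- The cut-off profile as a test function. -/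
def Cutoff.toTest (χ : Cutoff d) : Test d where
  toFun x := (χ.toFun ‖x‖ : ℂ)
  contDiff' := Complex.ofRealCLM.contDiff.comp χ.smooth
  hasCompactSupport' := by
    refine HasCompactSupport.intro (isCompact_closedBall (0 : Space d) 1) fun x hx => ?_
    simp only [Metric.mem_closedBall, dist_zero_right, not_le] at hx
    rw [χ.eq_zero _ hx, Complex.ofReal_zero]
  tsupport_subset' := fun _ _ => trivial

theorem Mollifier.scaled_eq (φ : Mollifier d) (n : ℕ+) :
    φ.scaled n = concentrate n φ.toTest := by
  ext x
  show (((n : ℝ) ^ d * φ.toFun ((n : ℝ) • x) : ℝ) : ℂ) = (n : ℂ) ^ d * (φ.toFun ((n : ℝ) • x) : ℂ)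
  push_cast
  rfl

theorem Cutoff.scaled_eq (χ : Cutoff d) (n : ℕ+) : χ.scaled n = spread n χ.toTest := by
  ext x
  show ((χ.toFun (‖x‖ / n) : ℝ) : ℂ) = (χ.toFun ‖(n : ℝ)⁻¹ • x‖ : ℂ)
  rw [norm_smul, norm_inv, Real.norm_natCast, div_eq_inv_mul]

/-- The smoothing operator `b = C(φ_n) M(χ_n)`. Its adjoint is `M(χ_n) C(φ_n)`, so the elements of
`𝒟_n` are the operators `b* ρ b`. -/
def smoothing (φ : Mollifier d) (χ : Cutoff d) (n : ℕ+) : BoundedOp d :=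
  scaledOp n φ.toTest χ.toTest

theorem adjoint_smoothing (φ : Mollifier d) (χ : Cutoff d) (n : ℕ+) :
    (smoothing φ χ n).adjoint = mulOp (χ.scaled n) ∘L convOp (φ.scaled n) := by
  have h1 : conjTest χ.toTest = χ.toTest := by
    ext x
    exact Complex.conj_ofReal _
  have h2 : conjReflTest φ.toTest = φ.toTest := by
    ext x
    show star ((φ.toFun (-x) : ℝ) : ℂ) = _
    rw [φ.even, Complex.star_def, Complex.conj_ofReal]
    rfl
  rw [smoothing, adjoint_scaledOp, h1, h2, φ.scaled_eq, χ.scaled_eq]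

theorem mem_mollifiedOps_iff {φ : Mollifier d} {χ : Cutoff d} {n : ℕ+} {σ : BoundedOp d} :
    σ ∈ mollifiedOps φ χ n ↔ σ ∈ selfAdjointTraceClass (L2 d) ∧
      ∃ ρ ∈ selfAdjointTraceClass (L2 d),
        σ = (smoothing φ χ n).adjoint ∘L ρ ∘L smoothing φ χ n := by
  rw [adjoint_smoothing, smoothing, scaledOp, ← φ.scaled_eq, ← χ.scaled_eq]
  rfl

theorem tendsto_adjoint_smoothing (φ : Mollifier d) (χ : Cutoff d) (v : L2 d) :
    Tendsto (fun n => (smoothing φ χ n).adjoint v) atTop (𝓝 v) := by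
  have h := tendsto_adjoint_scaledOp φ.toTest χ.toTest v
  have h1 : ∫ t, φ.toTest t = 1 := by
    have : ∫ t, φ.toTest t = ((∫ t, φ.toFun t : ℝ) : ℂ) := integral_ofReal
    rw [this, φ.integral_eq_one, Complex.ofReal_one]
  have h2 : χ.toTest 0 = 1 := by
    show ((χ.toFun ‖(0 : Space d)‖ : ℝ) : ℂ) = 1
    rw [χ.eq_one _ (norm_nonneg _) (by simp), Complex.ofReal_one]
  rw [h1, h2, one_mul, star_one, one_smul] at h
  exact h

theorem exists_norm_smoothing_le (φ : Mollifier d) (χ : Cutoff d) :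
    ∃ C, ∀ n, ‖smoothing φ χ n‖ ≤ C := exists_norm_scaledOp_le _ _

/-- The range of `b*` consists of test functions. -/
theorem exists_toL2_eq_adjoint_smoothing (φ : Mollifier d) (χ : Cutoff d) (n : ℕ+) (v : L2 d) :
    ∃ f : Test d, f.toL2 = (smoothing φ χ n).adjoint v := by
  refine ⟨⟨fun x => χ.scaled n x * convolve (φ.scaled n) v x, ?_, ?_, fun _ _ => trivial⟩, ?_⟩
  · exact (χ.scaled n).smooth.mul ((φ.scaled n).compactSupport.contDiff_convolution_left (n := ⊤)
      (ContinuousLinearMap.mul ℝ ℂ) (φ.scaled n).smooth (locInt v))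
  · exact (χ.scaled n).compactSupport.mul_right
  · rw [adjoint_smoothing]
    refine Lp.ext ?_
    rw [ContinuousLinearMap.comp_apply]
    filter_upwards [Test.coeFn_toL2 _, mulOp_coeFn (χ.scaled n) (convOp (φ.scaled n) v),
      convOp_coeFn (φ.scaled n) v] with x h1 h2 h3
    rw [h1, h2, h3]
    rfl

/-! ### Ideal properties of the self-adjoint trace class operators -/

section Ideal

universe u
variable {H : Type u} [NormedAddCommGroup H] [InnerProductSpace ℂ H] [CompleteSpace H]

theorem add_mem_saTraceClass {A B : H →L[ℂ] H} (hA : A ∈ selfAdjointTraceClass H)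
    (hB : B ∈ selfAdjointTraceClass H) : A + B ∈ selfAdjointTraceClass H := by
  rw [mem_selfAdjointTraceClass_iff] at *
  exact ⟨hA.1.add hB.1, ne_top_of_le_ne_top (ENNReal.add_ne_top.2 ⟨hA.2, hB.2⟩) (nuc_add_le A B)⟩

theorem real_smul_mem_saTraceClass (c : ℝ) {A : H →L[ℂ] H} (hA : A ∈ selfAdjointTraceClass H) :
    c • A ∈ selfAdjointTraceClass H := by
  rw [mem_selfAdjointTraceClass_iff] at *
  rw [show c • A = (c : ℂ) • A from (Complex.coe_smul c A).symm]
  refine ⟨IsSelfAdjoint.smul (show IsSelfAdjoint (c : ℂ) from Complex.conj_ofReal c) hA.1, ?_⟩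
  exact ne_top_of_le_ne_top (ENNReal.mul_ne_top enorm_ne_top hA.2) (nuc_smul_le _ A)

theorem zero_mem_saTraceClass : (0 : H →L[ℂ] H) ∈ selfAdjointTraceClass H :=
  mem_selfAdjointTraceClass_iff.2 ⟨IsSelfAdjoint.zero _, by simp⟩

theorem sub_mem_saTraceClass {A B : H →L[ℂ] H} (hA : A ∈ selfAdjointTraceClass H)
    (hB : B ∈ selfAdjointTraceClass H) : A - B ∈ selfAdjointTraceClass H := by
  rw [mem_selfAdjointTraceClass_iff] at *
  exact ⟨hA.1.sub hB.1, ne_top_of_le_ne_top (ENNReal.add_ne_top.2 ⟨hA.2, hB.2⟩) (nuc_sub_le A B)⟩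

theorem sum_mem_saTraceClass {κ : Type*} (s : Finset κ) {A : κ → H →L[ℂ] H}
    (h : ∀ j ∈ s, A j ∈ selfAdjointTraceClass H) : ∑ j ∈ s, A j ∈ selfAdjointTraceClass H :=
  Finset.sum_induction A _ (fun _ _ => add_mem_saTraceClass) zero_mem_saTraceClass h

theorem conj_mem_saTraceClass {A : H →L[ℂ] H} (hA : A ∈ selfAdjointTraceClass H)
    (P : H →L[ℂ] H) : P.adjoint ∘L A ∘L P ∈ selfAdjointTraceClass H := by
  rw [mem_selfAdjointTraceClass_iff] at *
  refine ⟨?_, ne_top_of_le_ne_top (ENNReal.mul_ne_top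
    (ENNReal.mul_ne_top enorm_ne_top enorm_ne_top) hA.2) (nuc_comp_le _ _ _)⟩
  rw [ContinuousLinearMap.isSelfAdjoint_iff', ContinuousLinearMap.adjoint_comp,
    ContinuousLinearMap.adjoint_comp, ContinuousLinearMap.adjoint_adjoint, hA.1.adjoint_eq]
  rfl

theorem cross_mem_saTraceClass {A : H →L[ℂ] H} (hA : A ∈ selfAdjointTraceClass H)
    (P R : H →L[ℂ] H) : P.adjoint ∘L A ∘L R + R.adjoint ∘L A ∘L P ∈ selfAdjointTraceClass H := by
  rw [mem_selfAdjointTraceClass_iff] at *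
  refine ⟨?_, ne_top_of_le_ne_top (ENNReal.add_ne_top.2
    ⟨ENNReal.mul_ne_top
    (ENNReal.mul_ne_top enorm_ne_top enorm_ne_top) hA.2, ENNReal.mul_ne_top
    (ENNReal.mul_ne_top enorm_ne_top enorm_ne_top) hA.2⟩)
    ((nuc_add_le _ _).trans (add_le_add (nuc_comp_le _ _ _) (nuc_comp_le _ _ _)))⟩
  rw [ContinuousLinearMap.isSelfAdjoint_iff', map_add, ContinuousLinearMap.adjoint_comp,
    ContinuousLinearMap.adjoint_comp, ContinuousLinearMap.adjoint_comp,
    ContinuousLinearMap.adjoint_comp, ContinuousLinearMap.adjoint_adjoint,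
    ContinuousLinearMap.adjoint_adjoint, hA.1.adjoint_eq, add_comm]
  rfl

end Ideal

/-! ### Approximation of the maximal operator from smooth operators -/

section Approximation

/-- The operators `b Y` and `b A_j` on test functions extend to bounded operators, as derivatives
and coordinates are absorbed by the convolution and the cut-off in `b`. -/
theorem exists_realizations {κ : Type*} (φ : Mollifier d) (χ : Cutoff d) {Y : Module.End ℂ (Test d)}
    (hY : Y ∈ firstOrder d * firstOrder d) {A : κ → Module.End ℂ (Test d)}
    (hA : ∀ j, A j ∈ firstOrder d) (n : ℕ+) : ∃ (E₀ : BoundedOp d) (G : κ → BoundedOp d),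
      (∀ f : Test d, E₀ f.toL2 = (scaledConvMul n φ.toTest χ.toTest (Y f)).toL2) ∧
      ∀ j, ∀ f : Test d, G j f.toL2 = (scaledConvMul n φ.toTest χ.toTest (A j f)).toL2 := by
  have hB := convMul_mem_convMulSpan (concentrate n φ.toTest) (spread n χ.toTest)
  obtain ⟨E₀, hE₀⟩ := exists_realization (mul_mem_convMulSpan_of_secondOrder hB hY)
  choose G hG using fun j => exists_realization (mul_mem_convMulSpan hB (hA j))
  exact ⟨E₀, G, hE₀, hG⟩

variable {κ : Type*} [Fintype κ]

/-- The operator `E₀* ρ b + b* ρ E₀ + ∑ G_j* ρ G_j`. -/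
def formOp (b E₀ : BoundedOp d) (G : κ → BoundedOp d) (ρ : BoundedOp d) : BoundedOp d :=
  (E₀.adjoint ∘L ρ ∘L b + b.adjoint ∘L ρ ∘L E₀) + ∑ j, (G j).adjoint ∘L ρ ∘L G j

theorem formOp_mem (b E₀ : BoundedOp d) (G : κ → BoundedOp d) {ρ : BoundedOp d}
    (hρ : ρ ∈ selfAdjointTraceClass (L2 d)) : formOp b E₀ G ρ ∈ selfAdjointTraceClass (L2 d) :=
  add_mem_saTraceClass (cross_mem_saTraceClass hρ _ _)
    (sum_mem_saTraceClass _ fun _ _ => conj_mem_saTraceClass hρ _)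

theorem formOp_sub (b E₀ : BoundedOp d) (G : κ → BoundedOp d) (ρ σ : BoundedOp d) :
    formOp b E₀ G (ρ - σ) = formOp b E₀ G ρ - formOp b E₀ G σ := by
  simp only [formOp, ContinuousLinearMap.sub_comp, ContinuousLinearMap.comp_sub,
    Finset.sum_sub_distrib]
  abel

theorem exists_nuc_formOp_le (b E₀ : BoundedOp d) (G : κ → BoundedOp d) :
    ∃ K : ℝ≥0∞, K ≠ ⊤ ∧ ∀ ρ, nuc (formOp b E₀ G ρ) ≤ K * nuc ρ := by
  refine ⟨(‖E₀.adjoint‖ₑ * ‖b‖ₑ + ‖b.adjoint‖ₑ * ‖E₀‖ₑ) + ∑ j, ‖(G j).adjoint‖ₑ * ‖G j‖ₑ, ?_,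
    fun ρ => ?_⟩
  · refine ENNReal.add_ne_top.2 ⟨ENNReal.add_ne_top.2 ⟨?_, ?_⟩, ?_⟩
    · exact ENNReal.mul_ne_top (by simp) (by simp)
    · exact ENNReal.mul_ne_top (by simp) (by simp)
    · exact ENNReal.sum_ne_top.2 fun j _ => ENNReal.mul_ne_top (by simp) (by simp)
  · rw [add_mul, add_mul, Finset.sum_mul]
    refine (nuc_add_le _ _).trans (add_le_add ((nuc_add_le _ _).trans (add_le_add ?_ ?_)) ?_)
    · exact nuc_comp_le _ _ _
    · exact nuc_comp_le _ _ _
    · exact (nuc_sum_le _ _).trans (Finset.sum_le_sum fun j _ => nuc_comp_le _ _ _)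

/-- On the smoothed operators `b* ρ b` the form is given by a bounded operator. -/
theorem formEq_formOp {Y : Module.End ℂ (Test d)} {A : κ → Module.End ℂ (Test d)}
    {B : Module.End ℂ (Test d)} {b E₀ : BoundedOp d} {G : κ → BoundedOp d}
    (hb : ∀ f : Test d, b f.toL2 = (B f).toL2) (hE₀ : ∀ f : Test d, E₀ f.toL2 = (B (Y f)).toL2)
    (hG : ∀ j, ∀ f : Test d, G j f.toL2 = (B (A j f)).toL2) (ρ : BoundedOp d) :
    FormEq Y A (b.adjoint ∘L ρ ∘L b) (formOp b E₀ G ρ) := fun f g => by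
  simp only [formOp, add_apply, sum_apply, ContinuousLinearMap.comp_apply,
    inner_add_right, inner_sum, ContinuousLinearMap.adjoint_inner_right, hb, hE₀, hG]

theorem smoothing_toL2 (φ : Mollifier d) (χ : Cutoff d) (n : ℕ+) (f : Test d) :
    smoothing φ χ n f.toL2 = (scaledConvMul n φ.toTest χ.toTest f).toL2 := scaledOp_toL2 _ _ _ _

/-- If `b* → 1` strongly and boundedly, then `b* ρ b → ρ` in the trace norm. -/
theorem tendsto_nuc_sub_of_adjoint {ρ : BoundedOp d} (hρ : ρ ∈ selfAdjointTraceClass (L2 d))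
    {b : ℕ+ → BoundedOp d} {C : ℝ} (hC : ∀ n, ‖b n‖ ≤ C)
    (hb : ∀ v, Tendsto (fun n => (b n).adjoint v) atTop (𝓝 v)) :
    Tendsto (fun n => nuc (ρ - (b n).adjoint ∘L ρ ∘L b n)) atTop (𝓝 0) := by
  let P : ℕ+ → BoundedOp d := fun n => (b n).adjoint - ContinuousLinearMap.id ℂ (L2 d)
  have hP : ∀ v, Tendsto (fun n => P n v) atTop (𝓝 0) := fun v => by
    have := (hb v).sub_const v
    rw [sub_self] at this
    exact this
  have hPC : ∀ n, ‖P n‖ ≤ C + 1 := fun n => by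
    refine (norm_sub_le _ _).trans (add_le_add ?_ ContinuousLinearMap.norm_id_le)
    rw [LinearIsometryEquiv.norm_map]
    exact hC n
  have hbC : ∀ n, ‖(b n).adjoint‖ ≤ C := fun n => by
    rw [LinearIsometryEquiv.norm_map]
    exact hC n
  have h1 := tendsto_nuc_comp_adjoint hρ hPC hbC hP
  have h2 := tendsto_nuc_comp_adjoint_right hρ hPC
    (R := fun _ => ContinuousLinearMap.id ℂ (L2 d)) (D := 1)
    (fun _ => ContinuousLinearMap.norm_id_le) hP
  have h := h1.add h2
  rw [add_zero] at h
  refine tendsto_of_tendsto_of_tendsto_of_le_of_le tendsto_const_nhds h (fun _ => zero_le)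
    fun n => ?_
  refine le_trans (le_of_eq ?_) (nuc_add_le _ _)
  rw [nuc_sub_comm]
  congr 1
  ext1 v
  simp [P, ContinuousLinearMap.adjoint_id]

/-- Friedrichs' lemma for the form `Y ρ + ρ Y* + ∑ A_j ρ A_j*`: if it is trace class on `ρ`, then
its values on the smoothed operators `b* ρ b` converge to it in the trace norm. The difference is
built from commutators of `b` with the coefficients; those with `Y` are bounded and tend to `0`,
those with `A j` are `O(1 / n)` and meet a factor `A j b` of size `o(n)`. -/
theorem tendsto_nuc_sub_formOp (φ : Mollifier d) (χ : Cutoff d) {Y : Module.End ℂ (Test d)}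
    (hY : Y ∈ firstOrder d * firstOrder d) {A : κ → Module.End ℂ (Test d)}
    (hA : ∀ j, A j ∈ firstOrder d) {ρ T : BoundedOp d} (hρ : ρ ∈ selfAdjointTraceClass (L2 d))
    (hT : T ∈ selfAdjointTraceClass (L2 d)) (h : FormEq Y A ρ T) {S : ℕ+ → BoundedOp d}
    (hS : ∀ n, FormEq Y A ((smoothing φ χ n).adjoint ∘L ρ ∘L smoothing φ χ n) (S n)) :
    Tendsto (fun n => nuc (T - S n)) atTop (𝓝 0) := by
  obtain ⟨C, hC⟩ := exists_norm_smoothing_le φ χ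
  let b := smoothing φ χ
  let B := fun n => scaledConvMul n φ.toTest χ.toTest
  have hbB : ∀ n (f : Test d), b n f.toL2 = (B n f).toL2 := smoothing_toL2 φ χ
  -- `E` extends `[b, Y]`, `F` extends `n [b, A j]`, `G` extends `n⁻¹ b (A j)` and `N = n⁻² F`
  obtain ⟨E, CE, hE, hCE, hEt⟩ := commutator_mem_smallFamilies hY φ.toTest χ.toTest
  choose F CF hF hCF using fun j =>
    smul_commutator_mem_boundedFamilies (hA j) φ.toTest χ.toTest
  choose G CG hG hCG hGt using fun j => inv_smul_mem_smallFamilies (hA j) φ.toTest χ.toTest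
  choose N CN hN hCN hNt using fun j => smul_mem_smallFamilies
    (smul_commutator_mem_boundedFamilies (hA j) φ.toTest χ.toTest)
    (a := fun n => (n : ℂ)⁻¹ * (n : ℂ)⁻¹) (c := 1)
    (by simpa using tendsto_inv_pnat_complex.mul tendsto_inv_pnat_complex)
    (fun n => by
      rw [norm_mul]
      exact mul_le_one₀ (norm_inv_pnat_le n) (norm_nonneg _) (norm_inv_pnat_le n))
  let D₁ : ℕ+ → BoundedOp d := fun n => (b n).adjoint ∘L T ∘L b n
  let D₂ : ℕ+ → BoundedOp d := fun n => (E n).adjoint ∘L ρ ∘L b n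
  let D₃ : ℕ+ → BoundedOp d := fun n => (b n).adjoint ∘L ρ ∘L E n
  let D₄ : κ → ℕ+ → BoundedOp d := fun j n => (F j n).adjoint ∘L ρ ∘L G j n
  let D₅ : κ → ℕ+ → BoundedOp d := fun j n => (G j n).adjoint ∘L ρ ∘L F j n
  let D₆ : κ → ℕ+ → BoundedOp d := fun j n => (N j n).adjoint ∘L ρ ∘L F j n
  -- moving `b` through the coefficients of the form turns `S n` into `b* T b` and commutator terms
  have key : ∀ n, S n = D₁ n + D₂ n + D₃ n + ∑ j, (D₄ j n + D₅ j n - D₆ j n) := fun n => by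
    refine ext_of_inner_toL2 fun f g => ?_
    have hYf : ∀ f, (B n (Y f)).toL2 = E n f.toL2 + (Y (B n f)).toL2 := fun f => by
      rw [hE n f, ← toL2Lin_apply, ← toL2Lin_apply, ← toL2Lin_apply, ← map_add]
      simp [B]
    have hAf : ∀ j f, (A j (B n f)).toL2 = (B n (A j f)).toL2 - (n : ℂ)⁻¹ • F j n f.toL2 :=
      fun j f => by
      rw [hF j n f, ← toL2Lin_apply, ← toL2Lin_apply, ← toL2Lin_apply, ← map_smul, ← map_sub]
      simp [B, smul_smul]
    have hGf : ∀ j f, (B n (A j f)).toL2 = (n : ℂ) • G j n f.toL2 := fun j f => by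
      rw [hG j n f, ← toL2Lin_apply, ← toL2Lin_apply, ← map_smul]
      simp [B, smul_smul]
    have hNf : ∀ j (f : Test d), N j n f.toL2 = ((n : ℂ)⁻¹ * (n : ℂ)⁻¹) • F j n f.toL2 :=
        fun j f => by
      rw [hN j n f, hF j n f, ← toL2Lin_apply, ← toL2Lin_apply, ← map_smul]
      rfl
    have hterm : ∀ j, ⟪(B n (A j f)).toL2, ρ (B n (A j g)).toL2⟫_ℂ =
        ⟪(A j (B n f)).toL2, ρ (A j (B n g)).toL2⟫_ℂ + (⟪F j n f.toL2, ρ (G j n g.toL2)⟫_ℂ +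
          ⟪G j n f.toL2, ρ (F j n g.toL2)⟫_ℂ - ⟪N j n f.toL2, ρ (F j n g.toL2)⟫_ℂ) := fun j => by
      have hn := pnat_ne_zero n
      rw [hAf, hAf, hGf, hGf, hNf]
      simp only [map_sub, map_smul, inner_sub_left, inner_sub_right, inner_smul_left,
        inner_smul_right, map_mul, map_inv₀, map_natCast]
      field_simp
      ring
    rw [hS n f g]
    simp only [D₁, D₂, D₃, D₄, D₅, D₆, add_apply, sub_apply, sum_apply,
      ContinuousLinearMap.comp_apply, inner_add_right, inner_sub_right, inner_sum,
      ContinuousLinearMap.adjoint_inner_right]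
    change ⟪b n (Y f).toL2, ρ (b n g.toL2)⟫_ℂ + ⟪b n f.toL2, ρ (b n (Y g).toL2)⟫_ℂ +
      ∑ j, ⟪b n (A j f).toL2, ρ (b n (A j g).toL2)⟫_ℂ = _
    simp only [hbB, hterm, Finset.sum_add_distrib, hYf, map_add, inner_add_left, inner_add_right,
      Finset.sum_sub_distrib]
    rw [h (B n f) (B n g)]
    ring
  have hadj : ∀ {C : ℝ} {P : ℕ+ → BoundedOp d}, (∀ n, ‖P n‖ ≤ C) → ∀ n, ‖(P n).adjoint‖ ≤ C :=
    fun hP n => by rw [LinearIsometryEquiv.norm_map]; exact hP n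
  have l1 : Tendsto (fun n => nuc (T - D₁ n)) atTop (𝓝 0) :=
    tendsto_nuc_sub_of_adjoint hT hC (tendsto_adjoint_smoothing φ χ)
  have left : ∀ {P R : ℕ+ → BoundedOp d} {C C' : ℝ}, (∀ n, ‖P n‖ ≤ C) → (∀ n, ‖R n‖ ≤ C') →
      (∀ v, Tendsto (fun n => (P n).adjoint v) atTop (𝓝 0)) →
      Tendsto (fun n => nuc ((P n).adjoint ∘L ρ ∘L R n)) atTop (𝓝 0) := by
    intro P R C C' hP hR hPt
    simpa only [ContinuousLinearMap.adjoint_adjoint] using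
      tendsto_nuc_comp_adjoint hρ (hadj hP) (hadj hR) hPt
  have right : ∀ {P R : ℕ+ → BoundedOp d} {C C' : ℝ}, (∀ n, ‖P n‖ ≤ C) → (∀ n, ‖R n‖ ≤ C') →
      (∀ v, Tendsto (fun n => (P n).adjoint v) atTop (𝓝 0)) →
      Tendsto (fun n => nuc ((R n).adjoint ∘L ρ ∘L P n)) atTop (𝓝 0) := by
    intro P R C C' hP hR hPt
    simpa only [ContinuousLinearMap.adjoint_adjoint] using
      tendsto_nuc_comp_adjoint_right hρ (hadj hP) (hadj hR) hPt
  have l2 : Tendsto (fun n => nuc (D₂ n)) atTop (𝓝 0) := left hCE hC hEt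
  have l3 : Tendsto (fun n => nuc (D₃ n)) atTop (𝓝 0) := right hCE hC hEt
  have l4 : ∀ j, Tendsto (fun n => nuc (D₄ j n)) atTop (𝓝 0) :=
    fun j => right (hCG j) (hCF j) (hGt j)
  have l5 : ∀ j, Tendsto (fun n => nuc (D₅ j n)) atTop (𝓝 0) :=
    fun j => left (hCG j) (hCF j) (hGt j)
  have l6 : ∀ j, Tendsto (fun n => nuc (D₆ j n)) atTop (𝓝 0) :=
    fun j => left (hCN j) (hCF j) (hNt j)
  have hlim := ((l1.add l2).add l3).add
    (tendsto_finsetSum Finset.univ fun j _ => ((l4 j).add (l5 j)).add (l6 j))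
  simp only [add_zero, Finset.sum_const_zero] at hlim
  refine tendsto_of_tendsto_of_tendsto_of_le_of_le tendsto_const_nhds hlim (fun _ => zero_le)
    fun n => ?_
  have e : T - S n = T - D₁ n - D₂ n - D₃ n - ∑ j, (D₄ j n + D₅ j n - D₆ j n) := by
    rw [key]; abel
  dsimp only
  rw [e]
  refine (nuc_sub_le _ _).trans (add_le_add ((nuc_sub_le _ _).trans
    (add_le_add (nuc_sub_le _ _) le_rfl)) ((nuc_sum_le _ _).trans
      (Finset.sum_le_sum fun j _ => (nuc_sub_le _ _).trans
        (add_le_add (nuc_add_le _ _) le_rfl))))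

/-- Finite real linear combinations of the rank one operators `|f⟩⟨f|` given by test functions. -/
def IsFiniteRankTest (σ : BoundedOp d) : Prop :=
  ∃ (ι : Type) (_ : Fintype ι) (c : ι → ℝ) (f : ι → Test d),
    σ = ∑ i, (c i : ℂ) • InnerProductSpace.rankOne ℂ (f i).toL2 (f i).toL2

/-- Finite-rank operators built from test functions form a core: first `ρ` is smoothed, then it
is replaced inside `b* ρ b` by a finite-rank operator, which is harmless as the form is bounded on
operators of this kind for fixed `b`. -/
theorem exists_isFiniteRankTest_approx (φ : Mollifier d) (χ : Cutoff d)
    {Y : Module.End ℂ (Test d)} (hY : Y ∈ firstOrder d * firstOrder d)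
    {A : κ → Module.End ℂ (Test d)} (hA : ∀ j, A j ∈ firstOrder d) {ρ T : BoundedOp d}
    (hρ : ρ ∈ selfAdjointTraceClass (L2 d)) (hT : T ∈ selfAdjointTraceClass (L2 d))
    (h : FormEq Y A ρ T) {ε : ℝ≥0∞} (hε : 0 < ε) :
    ∃ σ ∈ selfAdjointTraceClass (L2 d), ∃ S ∈ selfAdjointTraceClass (L2 d),
      IsFiniteRankTest σ ∧ FormEq Y A σ S ∧ nuc (ρ - σ) < ε ∧ nuc (T - S) < ε := by
  choose E₀ G hE₀ hG using exists_realizations φ χ hY hA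
  have hform : ∀ n ρ, FormEq Y A ((smoothing φ χ n).adjoint ∘L ρ ∘L smoothing φ χ n)
      (formOp (smoothing φ χ n) (E₀ n) (G n) ρ) := fun n ρ =>
    formEq_formOp (smoothing_toL2 φ χ n) (hE₀ n) (hG n) ρ
  obtain ⟨C, hC⟩ := exists_norm_smoothing_le φ χ
  have hε2 : 0 < ε / 2 := ENNReal.half_pos hε.ne'
  have l1 := tendsto_nuc_sub_of_adjoint hρ hC (tendsto_adjoint_smoothing φ χ)
  have l2 := tendsto_nuc_sub_formOp φ χ hY hA hρ hT h fun n => hform n ρ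
  obtain ⟨n, h1, h2⟩ :=
    ((l1.eventually (gt_mem_nhds hε2)).and (l2.eventually (gt_mem_nhds hε2))).exists
  obtain ⟨K, hK, hKle⟩ := exists_nuc_formOp_le (smoothing φ χ n) (E₀ n) (G n)
  let b := smoothing φ χ n
  let δ : ℝ≥0∞ := ε / 2 / (‖b.adjoint‖ₑ * ‖b‖ₑ + K + 1)
  have hM : ‖b.adjoint‖ₑ * ‖b‖ₑ + K + 1 ≠ ⊤ := by
    refine ENNReal.add_ne_top.2 ⟨ENNReal.add_ne_top.2 ⟨?_, hK⟩, by simp⟩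
    exact ENNReal.mul_ne_top enorm_ne_top enorm_ne_top
  have hδ : 0 < δ := ENNReal.div_pos hε2.ne' hM
  obtain ⟨ι, _, c, v, hv⟩ := exists_finiteRank_nuc_sub_lt hρ hδ
  have hMδ : (‖b.adjoint‖ₑ * ‖b‖ₑ + K + 1) * δ ≤ ε / 2 := ENNReal.mul_div_le
  let τ : BoundedOp d := ∑ i, (c i : ℂ) • InnerProductSpace.rankOne ℂ (v i) (v i)
  have hτ : τ ∈ selfAdjointTraceClass (L2 d) := by
    refine sum_mem_saTraceClass _ fun i _ => ?_
    rw [Complex.coe_smul]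
    refine real_smul_mem_saTraceClass (c i) (mem_selfAdjointTraceClass_iff.2 ⟨?_, ?_⟩)
    · rw [ContinuousLinearMap.isSelfAdjoint_iff', InnerProductSpace.adjoint_rankOne]
    · exact ne_top_of_le_ne_top (ENNReal.mul_ne_top enorm_ne_top enorm_ne_top)
        (nuc_rankOne_le _ _)
  refine ⟨b.adjoint ∘L τ ∘L b, conj_mem_saTraceClass hτ b, formOp b (E₀ n) (G n) τ,
    formOp_mem _ _ _ hτ, ?_, hform n τ, ?_, ?_⟩
  · choose f hf using fun i => exists_toL2_eq_adjoint_smoothing φ χ n (v i)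
    refine ⟨ι, inferInstance, c, f, ?_⟩
    ext1 u
    simp only [τ, ContinuousLinearMap.comp_apply, sum_apply, smul_apply,
      InnerProductSpace.rankOne_apply, map_sum, map_smul, hf,
      ContinuousLinearMap.adjoint_inner_left]
    rfl
  · have e : ρ - b.adjoint ∘L τ ∘L b =
        (ρ - b.adjoint ∘L ρ ∘L b) + b.adjoint ∘L (ρ - τ) ∘L b := by
      rw [ContinuousLinearMap.sub_comp, ContinuousLinearMap.comp_sub]; abel
    rw [e, ← ENNReal.add_halves ε]
    refine (nuc_add_le _ _).trans_lt (ENNReal.add_lt_add_of_lt_of_le ?_ h1 ?_)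
    · exact ne_top_of_le_ne_top (ENNReal.mul_ne_top
        (ENNReal.mul_ne_top enorm_ne_top enorm_ne_top) hv.ne_top) (nuc_comp_le _ _ _)
    · refine (nuc_comp_le _ _ _).trans (le_trans ?_ hMδ)
      gcongr
      rw [add_assoc]
      exact le_self_add
  · have e : T - formOp b (E₀ n) (G n) τ =
        (T - formOp b (E₀ n) (G n) ρ) + formOp b (E₀ n) (G n) (ρ - τ) := by
      rw [formOp_sub]; abel
    rw [e, ← ENNReal.add_halves ε]
    refine (nuc_add_le _ _).trans_lt (ENNReal.add_lt_add_of_lt_of_le ?_ h2 ?_)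
    · exact ne_top_of_le_ne_top (ENNReal.mul_ne_top hK hv.ne_top) (hKle _)
    · refine (hKle _).trans (le_trans ?_ hMδ)
      gcongr
      exact le_add_self.trans le_self_add

end Approximation

end Core

/-! ### The Banach space of self-adjoint trace class operators -/

section BanachSpace

/-- The nuclear norm is lower semicontinuous for convergence in operator norm. -/
theorem nuc_le_of_tendsto {H : Type*} [NormedAddCommGroup H] [InnerProductSpace ℂ H]
    {α : Type*} {l : Filter α} [l.NeBot] {A : α → H →L[ℂ] H} {A₀ : H →L[ℂ] H}
    (hA : Tendsto A l (𝓝 A₀)) {c : ℝ≥0∞} (hc : ∀ᶠ n in l, nuc (A n) ≤ c) :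
    nuc A₀ ≤ c := by
  refine nuc_le_iff.2 fun n u v hu hv => ?_
  have hcont : Continuous fun B : H →L[ℂ] H => ‖∑ i, ⟪u i, B (v i)⟫_ℂ‖ₑ := by fun_prop
  refine le_of_tendsto ((hcont.tendsto A₀).comp hA) ?_
  filter_upwards [hc] with k hk
  exact (enorm_sum_le_nuc_one (A k) hu hv).trans hk

universe u
variable (H : Type u) [NormedAddCommGroup H] [InnerProductSpace ℂ H] [CompleteSpace H]

/-- The real vector space of self-adjoint trace class operators. -/
def saTraceClassSubmodule : Submodule ℝ (H →L[ℂ] H) where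
  carrier := selfAdjointTraceClass H
  zero_mem' := zero_mem_saTraceClass
  add_mem' := add_mem_saTraceClass
  smul_mem' c _ hA := real_smul_mem_saTraceClass c hA

/-- The self-adjoint trace class operators as a type of its own, which carries the trace norm
instead of the operator norm. -/
def SATraceClass : Type u := saTraceClassSubmodule H

namespace SATraceClass

instance : AddCommGroup (SATraceClass H) := inferInstanceAs (AddCommGroup (saTraceClassSubmodule H))
instance : Module ℝ (SATraceClass H) := inferInstanceAs (Module ℝ (saTraceClassSubmodule H))

variable {H}

/-- The underlying bounded operator. -/
def toOp (A : SATraceClass H) : H →L[ℂ] H := A.1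

theorem toOp_mem (A : SATraceClass H) : A.toOp ∈ selfAdjointTraceClass H := A.2

/-- A self-adjoint trace class operator as an element of the Banach space. -/
def ofMem {A : H →L[ℂ] H} (hA : A ∈ selfAdjointTraceClass H) : SATraceClass H := ⟨A, hA⟩

@[simp] theorem toOp_ofMem {A : H →L[ℂ] H} (hA : A ∈ selfAdjointTraceClass H) :
    (ofMem hA).toOp = A := rfl

theorem toOp_add (A B : SATraceClass H) : (A + B).toOp = A.toOp + B.toOp := rfl
theorem toOp_sub (A B : SATraceClass H) : (A - B).toOp = A.toOp - B.toOp := rfl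
theorem toOp_smul (c : ℝ) (A : SATraceClass H) : (c • A).toOp = c • A.toOp := rfl
theorem toOp_injective : Function.Injective (toOp : SATraceClass H → H →L[ℂ] H) :=
  Subtype.val_injective

instance : Norm (SATraceClass H) := ⟨fun A => (nuc A.toOp).toReal⟩

theorem norm_def (A : SATraceClass H) : ‖A‖ = (nuc A.toOp).toReal := rfl

theorem nuc_ne_top (A : SATraceClass H) : nuc A.toOp ≠ ⊤ :=
  (mem_selfAdjointTraceClass_iff.1 A.toOp_mem).2

theorem ofReal_norm_eq (A : SATraceClass H) : ENNReal.ofReal ‖A‖ = nuc A.toOp :=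
  ENNReal.ofReal_toReal A.nuc_ne_top

theorem norm_toOp_le (A : SATraceClass H) : ‖A.toOp‖ ≤ ‖A‖ := by
  have := ENNReal.toReal_mono A.nuc_ne_top (enorm_le_nuc A.toOp)
  rwa [toReal_enorm] at this

theorem normedSpaceCore : NormedSpace.Core ℝ (SATraceClass H) where
  norm_nonneg _ := ENNReal.toReal_nonneg
  norm_smul c A := by
    have key : ∀ (c : ℝ) (A : SATraceClass H), ‖c • A‖ ≤ |c| * ‖A‖ := fun c A => by
      have h := nuc_smul_le (c : ℂ) A.toOp
      have h' := ENNReal.toReal_mono (ENNReal.mul_ne_top enorm_ne_top A.nuc_ne_top) h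
      rw [ENNReal.toReal_mul, toReal_enorm, Complex.norm_real] at h'
      rw [norm_def, toOp_smul, ← Complex.coe_smul]
      exact h'
    refine le_antisymm (key c A) ?_
    rcases eq_or_ne c 0 with rfl | hc
    · simp only [norm_zero, zero_mul]
      exact ENNReal.toReal_nonneg
    · have h := key c⁻¹ (c • A)
      rw [smul_smul, inv_mul_cancel₀ hc, one_smul, abs_inv] at h
      rw [Real.norm_eq_abs]
      have hc' : 0 < |c| := abs_pos.2 hc
      calc |c| * ‖A‖ ≤ |c| * (|c|⁻¹ * ‖c • A‖) := by gcongr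
        _ = ‖c • A‖ := by rw [← mul_assoc, mul_inv_cancel₀ hc'.ne', one_mul]
  norm_triangle A B := by
    have h := ENNReal.toReal_mono (ENNReal.add_ne_top.2 ⟨A.nuc_ne_top, B.nuc_ne_top⟩)
      (nuc_add_le A.toOp B.toOp)
    rwa [ENNReal.toReal_add A.nuc_ne_top B.nuc_ne_top] at h
  norm_eq_zero_iff A := by
    refine ⟨fun h => toOp_injective ?_, fun h => ?_⟩
    · have := A.norm_toOp_le
      rw [h] at this
      exact norm_le_zero_iff.1 this
    · rw [h, norm_def]
      show (nuc (0 : H →L[ℂ] H)).toReal = 0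
      simp

instance : NormedAddCommGroup (SATraceClass H) := NormedAddCommGroup.ofCore normedSpaceCore
instance : NormedSpace ℝ (SATraceClass H) := NormedSpace.ofCore normedSpaceCore

theorem enorm_eq (A : SATraceClass H) : ‖A‖ₑ = nuc A.toOp := by
  rw [← ofReal_norm, ofReal_norm_eq]

theorem enorm_eq_traceNorm (A : SATraceClass H) : ‖A‖ₑ = traceNorm A.toOp := by
  rw [enorm_eq, traceNorm_eq_nuc A.toOp_mem.1]

end SATraceClass

variable {H}

theorem isSelfAdjoint_of_tendsto {α : Type*} {l : Filter α} [l.NeBot] {A : α → H →L[ℂ] H}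
    {A₀ : H →L[ℂ] H} (hA : Tendsto A l (𝓝 A₀)) (h : ∀ n, IsSelfAdjoint (A n)) :
    IsSelfAdjoint A₀ :=
  tendsto_nhds_unique (((continuous_star.tendsto A₀).comp hA).congr fun n => (h n).star_eq) hA

instance : CompleteSpace (SATraceClass H) := by
  refine Metric.complete_of_cauchySeq_tendsto fun A hA => ?_
  have hop : CauchySeq fun n => (A n).toOp := by
    rw [Metric.cauchySeq_iff] at hA ⊢
    intro ε hε
    obtain ⟨N, hN⟩ := hA ε hε
    refine ⟨N, fun n hn k hk => lt_of_le_of_lt ?_ (hN n hn k hk)⟩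
    rw [dist_eq_norm, dist_eq_norm, ← SATraceClass.toOp_sub]
    exact SATraceClass.norm_toOp_le _
  obtain ⟨B, hB⟩ := cauchySeq_tendsto_of_complete hop
  have hsa : IsSelfAdjoint B :=
    isSelfAdjoint_of_tendsto hB fun n => (A n).toOp_mem.1
  have key : ∀ ε : ℝ, 0 < ε → ∃ N, ∀ n ≥ N, nuc ((A n).toOp - B) ≤ ENNReal.ofReal ε := by
    intro ε hε
    obtain ⟨N, hN⟩ := Metric.cauchySeq_iff.1 hA ε hε
    refine ⟨N, fun n hn => nuc_le_of_tendsto (hB.const_sub (A n).toOp) ?_⟩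
    filter_upwards [eventually_ge_atTop N] with k hk
    rw [← SATraceClass.toOp_sub, ← SATraceClass.ofReal_norm_eq, ← dist_eq_norm]
    exact ENNReal.ofReal_le_ofReal (hN n hn k hk).le
  have hBmem : B ∈ selfAdjointTraceClass H := by
    refine mem_selfAdjointTraceClass_iff.2 ⟨hsa, ?_⟩
    obtain ⟨N, hN⟩ := key 1 one_pos
    have h := nuc_sub_le (A N).toOp ((A N).toOp - B)
    rw [sub_sub_cancel] at h
    exact ne_top_of_le_ne_top (ENNReal.add_ne_top.2 ⟨(A N).nuc_ne_top,
      ne_top_of_le_ne_top ENNReal.ofReal_ne_top (hN N le_rfl)⟩) h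
  refine ⟨SATraceClass.ofMem hBmem, Metric.tendsto_atTop.2 fun ε hε => ?_⟩
  obtain ⟨N, hN⟩ := key (ε / 2) (half_pos hε)
  refine ⟨N, fun n hn => lt_of_le_of_lt ?_ (half_lt_self hε)⟩
  rw [dist_eq_norm]
  have h := hN n hn
  have he : nuc ((A n).toOp - B) = ENNReal.ofReal ‖A n - SATraceClass.ofMem hBmem‖ :=
    (SATraceClass.ofReal_norm_eq (A n - SATraceClass.ofMem hBmem)).symm
  rw [he] at h
  exact (ENNReal.ofReal_le_ofReal_iff (half_pos hε).le).1 h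

end BanachSpace

/-! ### The resolvent of a contraction semigroup -/

section Semigroup

variable {X : Type*} [NormedAddCommGroup X] [NormedSpace ℝ X] [CompleteSpace X]

/-- For the generator `G` of a strongly continuous contraction semigroup, `1 - G` is onto: the
Laplace transform `x = ∫ e^{-s} Φ_s y ds` solves `x - G x = y`. -/
theorem exists_generator_resolvent {Φ : ℝ → X → X}
    (hadd : ∀ t, 0 ≤ t → ∀ x y, Φ t (x + y) = Φ t x + Φ t y)
    (hsmul : ∀ t, 0 ≤ t → ∀ (c : ℝ) x, Φ t (c • x) = c • Φ t x)
    (hzero : ∀ x, Φ 0 x = x) (hmul : ∀ s t, 0 ≤ s → 0 ≤ t → ∀ x, Φ (s + t) x = Φ s (Φ t x))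
    (hcontr : ∀ t, 0 ≤ t → ∀ x, ‖Φ t x‖ ≤ ‖x‖)
    (hcont : ∀ x, Tendsto (fun t => ‖Φ t x - x‖) (𝓝[>] 0) (𝓝 0)) (y : X) :
    ∃ x, Tendsto (fun t : ℝ => t⁻¹ • (Φ t x - x)) (𝓝[>] 0) (𝓝 (x - y)) := by
  have hsub : ∀ t, 0 ≤ t → ∀ x z, Φ t (x - z) = Φ t x - Φ t z := fun t ht x z => by
    rw [eq_sub_iff_add_eq, ← hadd t ht, sub_add_cancel]
  let u : ℝ → X := fun s => Φ (max s 0) y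
  -- the orbit of `y` is as continuous at any time as it is at time `0`
  have hmod : ∀ s t, 0 ≤ s → 0 ≤ t → ‖Φ t y - Φ s y‖ ≤ ‖Φ |t - s| y - y‖ := by
    have key : ∀ s t, 0 ≤ s → s ≤ t → ‖Φ t y - Φ s y‖ ≤ ‖Φ |t - s| y - y‖ := fun s t hs hst => by
      have h := hmul s (t - s) hs (sub_nonneg.2 hst) y
      rw [add_sub_cancel] at h
      rw [h, ← hsub s hs, abs_of_nonneg (sub_nonneg.2 hst)]
      exact hcontr s hs _
    intro s t hs ht
    rcases le_total s t with h | h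
    · exact key s t hs h
    · rw [norm_sub_rev, abs_sub_comm]
      exact key t s ht h
  have hcont' : Tendsto (fun t => ‖Φ t y - y‖) (𝓝[≥] 0) (𝓝 0) := by
    have h0 : ‖Φ 0 y - y‖ = 0 := by rw [hzero, sub_self, norm_zero]
    have h := continuousWithinAt_Ioi_iff_Ici (f := fun t => ‖Φ t y - y‖) (a := (0 : ℝ))
    rw [ContinuousWithinAt, ContinuousWithinAt, h0] at h
    exact h.1 (hcont y)
  have hu : Continuous u := by
    refine continuous_iff_continuousAt.2 fun s => ?_
    rw [ContinuousAt, tendsto_iff_norm_sub_tendsto_zero]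
    have h1 : Tendsto (fun t : ℝ => |max t 0 - max s 0|) (𝓝 s) (𝓝[≥] 0) := by
      refine tendsto_nhdsWithin_iff.2
        ⟨?_, Eventually.of_forall fun t => Set.mem_Ici.2 (abs_nonneg _)⟩
      have : Continuous fun t : ℝ => |max t 0 - max s 0| := by fun_prop
      simpa using this.tendsto s
    exact squeeze_zero (fun _ => norm_nonneg _)
      (fun t => hmod _ _ (le_max_right _ _) (le_max_right _ _)) (hcont'.comp h1)
  let w : ℝ → X := fun s => Real.exp (-s) • u s
  have hw : Continuous w := (Real.continuous_exp.comp continuous_neg).smul hu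
  have hwi : IntegrableOn w (Set.Ioi 0) := by
    refine Integrable.mono' ((integrableOn_exp_neg_Ioi 0).mul_const ‖y‖) hw.aestronglyMeasurable
      (Eventually.of_forall fun s => ?_)
    rw [norm_smul, Real.norm_of_nonneg (Real.exp_pos _).le]
    gcongr
    exact hcontr _ (le_max_right _ _) y
  let x : X := ∫ s in Set.Ioi (0 : ℝ), w s
  -- the flow shifts the Laplace transform, so that `Φ t x` is explicitly differentiable in `t`
  have hΦx : ∀ t, 0 ≤ t → Φ t x = Real.exp t • (x - ∫ s in (0 : ℝ)..t, w s) := fun t ht => by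
    let L : X →L[ℝ] X := LinearMap.mkContinuous
      { toFun := Φ t, map_add' := hadd t ht, map_smul' := hsmul t ht } 1 fun z => by
        rw [one_mul]
        exact hcontr t ht z
    have h1 : Φ t x = ∫ s in Set.Ioi (0 : ℝ), Φ t (w s) := (L.integral_comp_comm hwi).symm
    have h2 : ∫ s in Set.Ioi (0 : ℝ), Φ t (w s) =
        ∫ s in Set.Ioi (0 : ℝ), Real.exp t • w (s + t) := by
      refine setIntegral_congr_fun measurableSet_Ioi fun s hs => ?_
      have hs' : (0 : ℝ) ≤ s := le_of_lt hs
      simp only [w, u, max_eq_left hs', max_eq_left (add_nonneg hs' ht)]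
      rw [hsmul t ht, ← hmul t s ht hs', smul_smul, ← Real.exp_add, add_comm t s]
      congr 2
      ring
    have h3 : ∫ s in Set.Ioi (0 : ℝ), w (s + t) = ∫ s in Set.Ioi t, w s := by
      have h := (measurePreserving_add_right (volume : Measure ℝ) t).setIntegral_preimage_emb
        (measurableEmbedding_addRight t) w (Set.Ioi t)
      rw [← h, Set.preimage_add_const_Ioi, sub_self]
    have h4 := intervalIntegral.integral_interval_add_Ioi hwi (hwi.mono_set (Set.Ioi_subset_Ioi ht))
    rw [h1, h2, integral_smul, h3]
    congr 1
    rw [eq_sub_iff_add_eq, add_comm]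
    exact h4
  refine ⟨x, ?_⟩
  have hder : HasDerivAt (fun t => Real.exp t • (x - ∫ s in (0 : ℝ)..t, w s)) (x - y) 0 := by
    have h1 : HasDerivAt (fun t => x - ∫ s in (0 : ℝ)..t, w s) (-w 0) 0 :=
      (hw.integral_hasStrictDerivAt 0 0).hasDerivAt.const_sub x
    have h2 := (Real.hasDerivAt_exp 0).smul h1
    have hw0 : w 0 = y := by simp [w, u, hzero]
    simp only [Real.exp_zero, one_smul, intervalIntegral.integral_same, sub_zero, hw0] at h2
    rwa [neg_add_eq_sub] at h2
  have hs := (hasDerivAt_iff_tendsto_slope_zero.1 hder).mono_left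
    (nhdsWithin_mono (0 : ℝ) fun t (ht : 0 < t) => ht.ne')
  refine hs.congr' ?_
  filter_upwards [self_mem_nhdsWithin] with t ht
  simp only [zero_add, Real.exp_zero, one_smul, intervalIntegral.integral_same, sub_zero]
  rw [hΦx t (le_of_lt ht)]

end Semigroup

/-! ### Formal adjoints and the dissipation identity -/

section FormalAdjoints

variable {d m : ℕ}

/-- `D'` is a formal adjoint of `D` on test functions. -/
def IsFormalAdjoint (D D' : Module.End ℂ (Test d)) : Prop :=
  ∀ f g : Test d, ⟪(D f).toL2, g.toL2⟫_ℂ = ⟪f.toL2, (D' g).toL2⟫_ℂ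

theorem toL2_add (f g : Test d) : (f + g).toL2 = f.toL2 + g.toL2 := map_add toL2Lin f g
theorem toL2_sub (f g : Test d) : (f - g).toL2 = f.toL2 - g.toL2 := map_sub toL2Lin f g
theorem toL2_neg (f : Test d) : (-f).toL2 = -f.toL2 := map_neg toL2Lin f
theorem toL2_smul (c : ℂ) (f : Test d) : (c • f).toL2 = c • f.toL2 := map_smul toL2Lin c f
theorem toL2_zero : (0 : Test d).toL2 = 0 := map_zero toL2Lin

namespace IsFormalAdjoint

variable {D D' E E' : Module.End ℂ (Test d)}

theorem add (h : IsFormalAdjoint D D') (h' : IsFormalAdjoint E E') :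
    IsFormalAdjoint (D + E) (D' + E') := fun f g => by
  rw [LinearMap.add_apply, LinearMap.add_apply, toL2_add, toL2_add, inner_add_left,
    inner_add_right, h, h']

theorem sub (h : IsFormalAdjoint D D') (h' : IsFormalAdjoint E E') :
    IsFormalAdjoint (D - E) (D' - E') := fun f g => by
  rw [LinearMap.sub_apply, LinearMap.sub_apply, toL2_sub, toL2_sub, inner_sub_left,
    inner_sub_right, h, h']

theorem neg (h : IsFormalAdjoint D D') : IsFormalAdjoint (-D) (-D') := fun f g => by
  rw [LinearMap.neg_apply, LinearMap.neg_apply, toL2_neg, toL2_neg, inner_neg_left,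
    inner_neg_right, h]

theorem smul (c : ℂ) (h : IsFormalAdjoint D D') : IsFormalAdjoint (c • D) (star c • D') :=
  fun f g => by
  rw [LinearMap.smul_apply, LinearMap.smul_apply, toL2_smul, toL2_smul, inner_smul_left,
    inner_smul_right, h]
  rfl

theorem mul (h : IsFormalAdjoint D D') (h' : IsFormalAdjoint E E') :
    IsFormalAdjoint (D * E) (E' * D') := fun f g => by
  rw [Module.End.mul_apply, Module.End.mul_apply, h, h']

theorem one : IsFormalAdjoint (1 : Module.End ℂ (Test d)) 1 := fun _ _ => rfl

theorem sum {κ : Type*} (s : Finset κ) {D D' : κ → Module.End ℂ (Test d)}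
    (h : ∀ k ∈ s, IsFormalAdjoint (D k) (D' k)) :
    IsFormalAdjoint (∑ k ∈ s, D k) (∑ k ∈ s, D' k) := by
  classical
  induction s using Finset.induction_on with
  | empty => intro f g; simp [toL2_zero]
  | insert a s ha ih =>
    rw [Finset.sum_insert ha, Finset.sum_insert ha]
    exact (h a (Finset.mem_insert_self a s)).add
      (ih fun k hk => h k (Finset.mem_insert_of_mem hk))

end IsFormalAdjoint

theorem isFormalAdjoint_posEnd (k : Fin d) : IsFormalAdjoint (posEnd k) (posEnd k) :=
  fun f g => by
  rw [inner_toL2, inner_toL2]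
  congr 1
  ext x
  simp only [posEnd_apply, pos_apply, Complex.star_def, map_mul, Complex.conj_ofReal]
  ring

theorem isFormalAdjoint_derEnd (k : Fin d) : IsFormalAdjoint (derEnd k) (-derEnd k) :=
  fun f g => by
  rw [LinearMap.neg_apply, toL2_neg, inner_neg_right, inner_toL2, inner_toL2]
  simp only [derEnd_apply]
  have hp : (fun x => star (f x) * g x) = mulTest (conjTest f) g := rfl
  have hd : ∀ x, der k (conjTest f) x = star (der k f x) := fun x => by
    have h := (Complex.conjCLE.toContinuousLinearMap.hasFDerivAt (x := f x)).comp x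
      (f.hasFDerivAt x)
    rw [der_apply, show fderiv ℝ (conjTest f) x = _ from h.fderiv, der_apply]
    rfl
  have h := integral_der k (mulTest (conjTest f) g)
  rw [der_mulTest] at h
  have hi : ∀ f : Test d, Integrable (f : Space d → ℂ) := fun f =>
    f.cont.integrable_of_hasCompactSupport f.compactSupport
  have h2 := integral_add (hi (mulTest (der k (conjTest f)) g))
    (hi (mulTest (conjTest f) (der k g)))
  have h3 : ∫ x, (mulTest (der k (conjTest f)) g x + mulTest (conjTest f) (der k g) x) = 0 := h
  rw [h3] at h2
  simp only [mulTest_apply, hd, conjTest_apply] at h2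
  exact eq_neg_of_add_eq_zero_left h2.symm

theorem posEnd_mem (k : Fin d) : posEnd k ∈ firstOrder d :=
  Submodule.subset_span (IsGenerator.coordinate k)
theorem derEnd_mem (k : Fin d) : derEnd k ∈ firstOrder d :=
  Submodule.subset_span (IsGenerator.partialDerivative k)
theorem one_mem_firstOrder : (1 : Module.End ℂ (Test d)) ∈ firstOrder d :=
  Submodule.subset_span IsGenerator.one

namespace Coefficients

variable (Q : Coefficients d m)

/-- The Hamiltonian as an endomorphism of the space of test functions. -/
def hamiltonianEnd : Module.End ℂ (Test d) :=
  -((1 / 2 : ℂ) • ∑ k, derEnd k * derEnd k) + (1 / 2 : ℂ) • ∑ k, posEnd k * posEnd k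
    - (Complex.I * Q.μ) • ∑ k, (posEnd k * derEnd k + derEnd k * posEnd k)

/-- `L_j` as an endomorphism of the space of test functions. -/
def lindbladEnd (j : Fin m) : Module.End ℂ (Test d) :=
  ∑ k, (Q.α j k • posEnd k + Q.β j k • derEnd k) + Q.γ j • 1

/-- `L_j^*` as an endomorphism of the space of test functions. -/
def lindbladAdjEnd (j : Fin m) : Module.End ℂ (Test d) :=
  ∑ k, (star (Q.α j k) • posEnd k - star (Q.β j k) • derEnd k) + star (Q.γ j) • 1

/-- `Y^*` as an endomorphism of the space of test functions. -/
def yAdjEnd : Module.End ℂ (Test d) :=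
  Complex.I • Q.hamiltonianEnd - (1 / 2 : ℂ) • ∑ j, Q.lindbladAdjEnd j * Q.lindbladEnd j

theorem hamiltonianEnd_apply (f : Test d) : Q.hamiltonianEnd f = Q.hamiltonian f := by
  simp [hamiltonianEnd, hamiltonian, LinearMap.sum_apply]

theorem lindbladEnd_apply (j : Fin m) (f : Test d) : Q.lindbladEnd j f = Q.lindblad j f := by
  simp [lindbladEnd, lindblad, LinearMap.sum_apply]

theorem lindbladAdjEnd_apply (j : Fin m) (f : Test d) :
    Q.lindbladAdjEnd j f = Q.lindbladAdj j f := by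
  simp [lindbladAdjEnd, lindbladAdj, LinearMap.sum_apply]

theorem yAdjEnd_apply (f : Test d) : Q.yAdjEnd f = Q.yAdj f := by
  simp [yAdjEnd, yAdj, LinearMap.sum_apply, hamiltonianEnd_apply, lindbladEnd_apply,
    lindbladAdjEnd_apply, lindbladSq]

theorem lindbladEnd_mem (j : Fin m) : Q.lindbladEnd j ∈ firstOrder d :=
  Submodule.add_mem _ (Submodule.sum_mem _ fun k _ => Submodule.add_mem _
    (Submodule.smul_mem _ _ (posEnd_mem k)) (Submodule.smul_mem _ _ (derEnd_mem k)))
    (Submodule.smul_mem _ _ one_mem_firstOrder)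

theorem lindbladAdjEnd_mem (j : Fin m) : Q.lindbladAdjEnd j ∈ firstOrder d :=
  Submodule.add_mem _ (Submodule.sum_mem _ fun k _ => Submodule.sub_mem _
    (Submodule.smul_mem _ _ (posEnd_mem k)) (Submodule.smul_mem _ _ (derEnd_mem k)))
    (Submodule.smul_mem _ _ one_mem_firstOrder)

theorem hamiltonianEnd_mem : Q.hamiltonianEnd ∈ firstOrder d * firstOrder d := by
  refine Submodule.sub_mem _ (Submodule.add_mem _ (Submodule.neg_mem _ ?_) ?_) ?_
  · exact Submodule.smul_mem _ _ (Submodule.sum_mem _ fun k _ =>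
      Submodule.mul_mem_mul (derEnd_mem k) (derEnd_mem k))
  · exact Submodule.smul_mem _ _ (Submodule.sum_mem _ fun k _ =>
      Submodule.mul_mem_mul (posEnd_mem k) (posEnd_mem k))
  · exact Submodule.smul_mem _ _ (Submodule.sum_mem _ fun k _ => Submodule.add_mem _
      (Submodule.mul_mem_mul (posEnd_mem k) (derEnd_mem k))
      (Submodule.mul_mem_mul (derEnd_mem k) (posEnd_mem k)))

theorem yAdjEnd_mem : Q.yAdjEnd ∈ firstOrder d * firstOrder d :=
  Submodule.sub_mem _ (Submodule.smul_mem _ _ Q.hamiltonianEnd_mem)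
    (Submodule.smul_mem _ _ (Submodule.sum_mem _ fun j _ =>
      Submodule.mul_mem_mul (Q.lindbladAdjEnd_mem j) (Q.lindbladEnd_mem j)))

theorem isFormalAdjoint_lindbladAdjEnd (j : Fin m) :
    IsFormalAdjoint (Q.lindbladAdjEnd j) (Q.lindbladEnd j) := by
  have h := (IsFormalAdjoint.sum Finset.univ fun k _ =>
    ((isFormalAdjoint_posEnd k).smul (star (Q.α j k))).sub
      ((isFormalAdjoint_derEnd k).smul (star (Q.β j k)))).add
    (IsFormalAdjoint.one.smul (star (Q.γ j)))
  simp only [star_star, smul_neg, sub_neg_eq_add] at h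
  exact h

theorem isFormalAdjoint_hamiltonianEnd : IsFormalAdjoint Q.hamiltonianEnd Q.hamiltonianEnd := by
  have h := (((IsFormalAdjoint.sum Finset.univ fun k _ =>
      (isFormalAdjoint_derEnd (d := d) k).mul (isFormalAdjoint_derEnd k)).smul (1 / 2)).neg.add
    ((IsFormalAdjoint.sum Finset.univ fun k _ =>
      (isFormalAdjoint_posEnd k).mul (isFormalAdjoint_posEnd k)).smul (1 / 2))).sub
    ((IsFormalAdjoint.sum Finset.univ fun k _ =>
      ((isFormalAdjoint_posEnd k).mul (isFormalAdjoint_derEnd k)).add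
      ((isFormalAdjoint_derEnd k).mul (isFormalAdjoint_posEnd k))).smul (Complex.I * Q.μ))
  refine (congrArg (IsFormalAdjoint Q.hamiltonianEnd) ?_).mpr h
  have h2 : star (1 / 2 : ℂ) = 1 / 2 := by
    rw [Complex.star_def, map_div₀, map_one, Complex.conj_ofNat]
  have h3 : star (Complex.I * (Q.μ : ℂ)) = -(Complex.I * Q.μ) := by simp [mul_comm]
  rw [h2, h3, hamiltonianEnd]
  simp only [neg_mul, mul_neg, neg_neg, Finset.sum_add_distrib, Finset.sum_neg_distrib, neg_smul,
    smul_add, smul_neg]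
  abel

/-- The dissipation identity `2 Re ⟨Y* f, f⟩ = - ∑ ‖L_j f‖²`. -/
theorem two_mul_re_inner_yAdjEnd (f : Test d) :
    2 * (⟪(Q.yAdjEnd f).toL2, f.toL2⟫_ℂ).re = -∑ j, ‖(Q.lindbladEnd j f).toL2‖ ^ 2 := by
  have h1 : (⟪(Q.hamiltonianEnd f).toL2, f.toL2⟫_ℂ).im = 0 := by
    have h := Q.isFormalAdjoint_hamiltonianEnd f f
    rw [← inner_conj_symm] at h
    have := congrArg Complex.im h
    rw [Complex.conj_im, ← inner_conj_symm, Complex.conj_im] at this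
    linarith
  have h2 : ∀ j, (⟪((Q.lindbladAdjEnd j * Q.lindbladEnd j) f).toL2, f.toL2⟫_ℂ).re =
      ‖(Q.lindbladEnd j f).toL2‖ ^ 2 := fun j => by
    rw [Module.End.mul_apply, Q.isFormalAdjoint_lindbladAdjEnd j]
    exact inner_self_eq_norm_sq (𝕜 := ℂ) _
  have h3 : (Q.yAdjEnd f).toL2 = Complex.I • (Q.hamiltonianEnd f).toL2 -
      (1 / 2 : ℂ) • ∑ j, ((Q.lindbladAdjEnd j * Q.lindbladEnd j) f).toL2 := by
    rw [yAdjEnd, LinearMap.sub_apply, LinearMap.smul_apply, LinearMap.smul_apply, toL2_sub,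
      toL2_smul, toL2_smul, LinearMap.sum_apply]
    congr 2
    exact map_sum toL2Lin _ _
  rw [h3, inner_sub_left, inner_smul_left, inner_smul_left, sum_inner, Complex.sub_re]
  have h4 : ((starRingEnd ℂ) (1 / 2 : ℂ) * ∑ j,
      ⟪((Q.lindbladAdjEnd j * Q.lindbladEnd j) f).toL2, f.toL2⟫_ℂ).re =
      1 / 2 * ∑ j, ‖(Q.lindbladEnd j f).toL2‖ ^ 2 := by
    have : (starRingEnd ℂ) (1 / 2 : ℂ) = ((1 / 2 : ℝ) : ℂ) := by
      rw [map_div₀, map_one, Complex.conj_ofNat]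
      norm_num
    rw [this, Complex.re_ofReal_mul, Complex.re_sum]
    simp only [h2]
  rw [h4]
  simp only [Complex.conj_I, Complex.mul_re, Complex.neg_re, Complex.neg_im, Complex.I_re,
    Complex.I_im, h1]
  ring

/-- `Z` has the form of `𝓛` without jump operators; the empty family of jump operators is encoded
by the index type `Fin 0`. -/
theorem zEq_iff_formEq {ρ T : BoundedOp d} :
    Q.ZEq ρ T ↔ FormEq Q.yAdjEnd (fun j : Fin 0 => j.elim0) ρ T := by
  refine forall₂_congr fun f g => ?_
  simp [yAdjEnd_apply]

theorem lEq_iff_formEq {ρ T : BoundedOp d} :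
    Q.LEq ρ T ↔ FormEq Q.yAdjEnd Q.lindbladAdjEnd ρ T := by
  refine forall₂_congr fun f g => ?_
  have h3 : ∀ f, (Q.yAdjEnd f).toL2 = Complex.I • (Q.hamiltonian f).toL2 -
      (1 / 2 : ℂ) • ∑ j, (Q.lindbladSq j f).toL2 := fun f => by
    rw [yAdjEnd_apply, yAdj, toL2_sub, toL2_smul, toL2_smul]
    congr 2
    exact map_sum toL2Lin _ _
  rw [Eq.congr_right]
  simp only [h3, lindbladAdjEnd_apply, inner_sub_left, inner_sub_right, inner_smul_left,
    inner_smul_right, map_sub, map_smul, map_sum, sum_inner, inner_sum, Finset.sum_sub_distrib,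
    Finset.mul_sum, mul_add, Finset.sum_add_distrib, Complex.conj_I]
  have h2 : (starRingEnd ℂ) (1 / 2 : ℂ) = 1 / 2 := by
    rw [map_div₀, map_one, Complex.conj_ofNat]
  rw [h2]
  ring

end Coefficients

end FormalAdjoints

/-! ### The jump part of the generator on finite-rank operators -/

section JumpPart

variable {d m : ℕ}

theorem rankOne_self_mem_saTraceClass (x : L2 d) :
    InnerProductSpace.rankOne ℂ x x ∈ selfAdjointTraceClass (L2 d) := by
  refine mem_selfAdjointTraceClass_iff.2 ⟨?_, ?_⟩
  · rw [ContinuousLinearMap.isSelfAdjoint_iff', InnerProductSpace.adjoint_rankOne]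
  · exact ne_top_of_le_ne_top (ENNReal.mul_ne_top enorm_ne_top enorm_ne_top) (nuc_rankOne_le _ _)

theorem sum_rankOne_mem_saTraceClass {ι : Type*} [Fintype ι] (c : ι → ℝ) (x : ι → L2 d) :
    ∑ i, (c i : ℂ) • InnerProductSpace.rankOne ℂ (x i) (x i) ∈ selfAdjointTraceClass (L2 d) := by
  refine sum_mem_saTraceClass _ fun i _ => ?_
  rw [Complex.coe_smul]
  exact real_smul_mem_saTraceClass (c i) (rankOne_self_mem_saTraceClass _)

theorem nuc_sum_rankOne_le {ι : Type*} [Fintype ι] (c : ι → ℝ) (x : ι → L2 d) :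
    nuc (∑ i, (c i : ℂ) • InnerProductSpace.rankOne ℂ (x i) (x i)) ≤
      ENNReal.ofReal (∑ i, |c i| * ‖x i‖ ^ 2) := by
  rw [ENNReal.ofReal_sum_of_nonneg fun i _ => by positivity]
  refine (nuc_sum_le _ _).trans (Finset.sum_le_sum fun i _ => (nuc_smul_le _ _).trans ?_)
  refine (mul_le_mul_right (nuc_rankOne_le _ _) _).trans (le_of_eq ?_)
  rw [ENNReal.ofReal_mul (abs_nonneg _), ENNReal.ofReal_pow (norm_nonneg _), ofReal_norm, sq,
    ← Real.norm_eq_abs, ofReal_norm]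
  congr 1
  rw [← ofReal_norm, ← ofReal_norm, Complex.norm_real]

theorem IsFiniteRankTest.sub {σ τ : BoundedOp d} (hσ : IsFiniteRankTest σ)
    (hτ : IsFiniteRankTest τ) : IsFiniteRankTest (σ - τ) := by
  obtain ⟨ι, _, c, f, rfl⟩ := hσ
  obtain ⟨κ, _, c', f', rfl⟩ := hτ
  refine ⟨ι ⊕ κ, inferInstance, Sum.elim c fun k => -c' k, Sum.elim f f', ?_⟩
  rw [Fintype.sum_sum_type, sub_eq_add_neg, ← Finset.sum_neg_distrib]
  congr 1
  refine Finset.sum_congr rfl fun i _ => ?_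
  rw [Sum.elim_inr, Sum.elim_inr, Complex.ofReal_neg, neg_smul]

/-- The spectral decomposition of a finite-rank operator built from test functions has
eigenfunctions which are test functions. -/
theorem IsFiniteRankTest.exists_orthonormal {σ : BoundedOp d} (hσ : IsFiniteRankTest σ) :
    ∃ (n : ℕ) (c : Fin n → ℝ) (e : Fin n → Test d), Orthonormal ℂ (fun i => (e i).toL2) ∧
      σ = ∑ i, (c i : ℂ) • InnerProductSpace.rankOne ℂ (e i).toL2 (e i).toL2 := by
  obtain ⟨ι, _, c, f, hf⟩ := hσ
  have hsa : IsSelfAdjoint σ := by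
    rw [hf]
    exact (sum_rankOne_mem_saTraceClass c fun i => (f i).toL2).1
  have hsym : ∀ x y : L2 d, ⟪σ x, y⟫_ℂ = ⟪x, σ y⟫_ℂ := fun x y => by
    conv_rhs => rw [← hsa.adjoint_eq]
    rw [ContinuousLinearMap.adjoint_inner_right]
  let V : Submodule ℂ (L2 d) := Submodule.span ℂ (Set.range fun i => (f i).toL2)
  have hV : ∀ x, σ x ∈ V := fun x => by
    rw [hf]
    simp only [sum_apply, smul_apply, InnerProductSpace.rankOne_apply]
    exact Submodule.sum_mem _ fun i _ => Submodule.smul_mem _ _ (Submodule.smul_mem _ _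
      (Submodule.subset_span ⟨i, rfl⟩))
  have hVtest : V ≤ LinearMap.range (toL2Lin (d := d)) :=
    Submodule.span_le.2 fun x ⟨i, hi⟩ => ⟨f i, hi⟩
  have : FiniteDimensional ℂ V := FiniteDimensional.span_of_finite ℂ (Set.finite_range _)
  let T : V →ₗ[ℂ] V := σ.toLinearMap.restrict fun x _ => hV x
  have hT : T.IsSymmetric := fun x y => hsym x y
  let b := hT.eigenvectorBasis rfl
  choose e he using fun i => hVtest (b i).2
  have he' : ∀ i, (e i).toL2 = (b i : L2 d) := he
  refine ⟨_, hT.eigenvalues rfl, e, ?_, ?_⟩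
  · simp only [he']
    exact b.orthonormal.comp_linearIsometry V.subtypeₗᵢ
  · ext1 x
    have hb : ∀ i, σ (b i) = (hT.eigenvalues rfl i : ℂ) • (b i : L2 d) := fun i =>
      congrArg Subtype.val (hT.apply_eigenvectorBasis rfl i)
    have h := congrArg Subtype.val (b.sum_repr' ⟨σ x, hV x⟩)
    rw [Submodule.coe_sum] at h
    rw [← show _ = σ x from h]
    simp only [sum_apply, smul_apply, InnerProductSpace.rankOne_apply, he']
    refine Finset.sum_congr rfl fun i _ => ?_
    have h2 : ⟪b i, (⟨σ x, hV x⟩ : V)⟫_ℂ = (hT.eigenvalues rfl i : ℂ) * ⟪(b i : L2 d), x⟫_ℂ := by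
      change ⟪(b i : L2 d), σ x⟫_ℂ = _
      rw [← hsym, hb, inner_smul_left, Complex.conj_ofReal]
    rw [Submodule.coe_smul, h2, smul_smul]

theorem sum_rankOne_apply_of_orthonormal {n : ℕ} {c : Fin n → ℝ} {e : Fin n → L2 d}
    (he : Orthonormal ℂ e) (i : Fin n) :
    (∑ k, (c k : ℂ) • InnerProductSpace.rankOne ℂ (e k) (e k)) (e i) = (c i : ℂ) • e i := by
  simp only [sum_apply, smul_apply, InnerProductSpace.rankOne_apply]
  rw [Finset.sum_eq_single i]
  · rw [inner_self_eq_norm_sq_to_K, he.1 i]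
    simp
  · intro k _ hk
    rw [he.2 hk, zero_smul, smul_zero]
  · exact fun h => absurd (Finset.mem_univ i) h

theorem enorm_sum_sign_mul_inner_le_nuc {n : ℕ} {e : Fin n → L2 d} (he : Orthonormal ℂ e)
    {s : Fin n → ℝ} (hs : ∀ i, |s i| = 1) (A : BoundedOp d) :
    ‖∑ i, (s i : ℂ) * ⟪e i, A (e i)⟫_ℂ‖ₑ ≤ nuc A := by
  have hv : IsBessel 1 e := QuantumLindblad.Orthonormal.isBessel he
  have hu : IsBessel 1 fun i => (s i : ℂ) • e i := fun y => by
    refine le_trans (le_of_eq (Finset.sum_congr rfl fun i _ => ?_)) (hv y)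
    rw [inner_smul_left, norm_mul, Complex.conj_ofReal, Complex.norm_real, Real.norm_eq_abs, hs,
      one_mul]
  have h := enorm_sum_le_nuc_one A hu hv
  simpa only [inner_smul_left, Complex.conj_ofReal] using h

/-- On an eigenfunction of `σ` with eigenvalue `c`, the form of `Y σ + σ Y*` is
`-c ∑ ‖L_j f‖²`. -/
theorem Coefficients.inner_eq_of_eigenfunction (Q : Coefficients d m) {σ S : BoundedOp d}
    (hσ : IsSelfAdjoint σ) (hS : FormEq Q.yAdjEnd (fun j : Fin 0 => j.elim0) σ S) {c : ℝ}
    {f : Test d} (hf : σ f.toL2 = (c : ℂ) • f.toL2) :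
    ⟪f.toL2, S f.toL2⟫_ℂ = ((-(c * ∑ j, ‖(Q.lindbladEnd j f).toL2‖ ^ 2) : ℝ) : ℂ) := by
  have hsym : ⟪f.toL2, σ (Q.yAdjEnd f).toL2⟫_ℂ = ⟪σ f.toL2, (Q.yAdjEnd f).toL2⟫_ℂ := by
    conv_lhs => rw [← hσ.adjoint_eq]
    rw [ContinuousLinearMap.adjoint_inner_right]
  have h := Q.two_mul_re_inner_yAdjEnd f
  have h2 : ((2 * (⟪(Q.yAdjEnd f).toL2, f.toL2⟫_ℂ).re : ℝ) : ℂ) =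
      ⟪(Q.yAdjEnd f).toL2, f.toL2⟫_ℂ + ⟪f.toL2, (Q.yAdjEnd f).toL2⟫_ℂ := by
    rw [← inner_conj_symm f.toL2, Complex.add_conj]
  rw [hS, hsym, hf, inner_smul_left, inner_smul_right, Complex.conj_ofReal, Fin.sum_univ_zero,
    add_zero, ← mul_add, ← h2, h]
  push_cast
  ring

/-- Let `W = ∑ L_j σ L_j*` be the jump part for a finite-rank operator `σ` built from test
functions, and `S = Y σ + σ Y*`. Test `S` against the signs of the eigenvalues `c i` of `σ` in an
eigenbasis `e i`: by the dissipation identity the result is `-a` with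
`a = ∑ |c i| ‖L_j e i‖²`. Since `‖W‖₁ ≤ a ≤ ‖S‖₁`, the jump part is dominated by `Z`; and testing
`σ - S - W` in the same way gives at least `‖σ‖₁ + a - ‖W‖₁`, so that `1 - 𝓛` expands the trace
norm. -/
theorem Coefficients.exists_jumpPart (Q : Coefficients d m) {σ : BoundedOp d}
    (hσ : IsFiniteRankTest σ) : ∃ W ∈ selfAdjointTraceClass (L2 d),
      (∀ f g : Test d, ⟪f.toL2, W g.toL2⟫_ℂ =
        ∑ j, ⟪(Q.lindbladAdjEnd j f).toL2, σ (Q.lindbladAdjEnd j g).toL2⟫_ℂ) ∧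
      ∀ S, FormEq Q.yAdjEnd (fun j : Fin 0 => j.elim0) σ S →
        nuc W ≤ nuc S ∧ nuc σ ≤ nuc (σ - S - W) := by
  obtain ⟨n, c, e, he, hσe⟩ := hσ.exists_orthonormal
  have hσsa : IsSelfAdjoint σ := by
    rw [hσe]
    exact (sum_rankOne_mem_saTraceClass c fun i => (e i).toL2).1
  obtain ⟨x, hx⟩ : ∃ x : Fin m × Fin n → L2 d, ∀ p, x p = (Q.lindbladEnd p.1 (e p.2)).toL2 :=
    ⟨_, fun _ => rfl⟩
  have hWmem := sum_rankOne_mem_saTraceClass (fun p : Fin m × Fin n => c p.2) x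
  have hW := nuc_sum_rankOne_le (fun p : Fin m × Fin n => c p.2) x
  obtain ⟨W, hWe⟩ : ∃ W : BoundedOp d,
      W = ∑ p, (c p.2 : ℂ) • InnerProductSpace.rankOne ℂ (x p) (x p) := ⟨_, rfl⟩
  rw [← hWe] at hW hWmem
  refine ⟨W, hWmem, fun f g => ?_, fun S hS => ?_⟩
  · simp only [hWe, hσe, sum_apply, smul_apply, InnerProductSpace.rankOne_apply, inner_sum,
      inner_smul_right, Fintype.sum_prod_type, hx]
    refine Finset.sum_congr rfl fun j _ => Finset.sum_congr rfl fun i _ => ?_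
    rw [Q.isFormalAdjoint_lindbladAdjEnd, ← inner_conj_symm (e i).toL2,
      Q.isFormalAdjoint_lindbladAdjEnd, inner_conj_symm]
  obtain ⟨a, ha⟩ : ∃ a : ℝ, a = ∑ p : Fin m × Fin n, |c p.2| * ‖x p‖ ^ 2 := ⟨_, rfl⟩
  have ha0 : 0 ≤ a := by
    rw [ha]
    exact Finset.sum_nonneg fun p _ => by positivity
  rw [← ha] at hW
  obtain ⟨s, hs, hsc⟩ : ∃ s : Fin n → ℝ, (∀ i, |s i| = 1) ∧ ∀ i, s i * c i = |c i| := by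
    refine ⟨fun i => if 0 ≤ c i then 1 else -1, fun i => ?_, fun i => ?_⟩
    · dsimp only
      split_ifs <;> simp
    · dsimp only
      split_ifs with h
      · rw [abs_of_nonneg h, one_mul]
      · rw [abs_of_neg (not_le.1 h), neg_one_mul]
  have hσi : ∀ i, σ (e i).toL2 = (c i : ℂ) • (e i).toL2 := fun i => by
    rw [hσe]
    exact sum_rankOne_apply_of_orthonormal he i
  have hSsum : ∑ i, (s i : ℂ) * ⟪(e i).toL2, S (e i).toL2⟫_ℂ = ((-a : ℝ) : ℂ) := by
    rw [ha, Fintype.sum_prod_type_right, ← Finset.sum_neg_distrib, Complex.ofReal_sum]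
    refine Finset.sum_congr rfl fun i _ => ?_
    rw [Q.inner_eq_of_eigenfunction hσsa hS (hσi i), ← Complex.ofReal_mul, mul_neg, ← mul_assoc,
      hsc, Finset.mul_sum]
    simp only [hx]
  have hσsum : ∑ i, (s i : ℂ) * ⟪(e i).toL2, σ (e i).toL2⟫_ℂ = ((∑ i, |c i| : ℝ) : ℂ) := by
    rw [Complex.ofReal_sum]
    refine Finset.sum_congr rfl fun i _ => ?_
    rw [hσi, inner_smul_right, inner_self_eq_norm_sq_to_K, he.1 i, ← hsc]
    simp
  refine ⟨hW.trans ?_, ?_⟩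
  · have h := enorm_sum_sign_mul_inner_le_nuc he hs S
    rwa [hSsum, ← ofReal_norm, Complex.norm_real, norm_neg, Real.norm_of_nonneg ha0] at h
  · have h1 := enorm_sum_sign_mul_inner_le_nuc he hs (σ - S - W)
    have h2 := enorm_sum_sign_mul_inner_le_nuc he hs W
    have hσle : nuc σ ≤ ENNReal.ofReal (∑ i, |c i|) := by
      have h := nuc_sum_rankOne_le c fun i => (e i).toL2
      rw [← hσe] at h
      simpa only [he.1, one_pow, mul_one] using h
    have hc : 0 ≤ ∑ i, |c i| := Finset.sum_nonneg fun i _ => abs_nonneg _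
    refine hσle.trans ((ENNReal.add_le_add_iff_right (ENNReal.ofReal_ne_top (r := a))).1 ?_)
    rw [← ENNReal.ofReal_add hc ha0]
    have h3 : (((∑ i, |c i|) + a : ℝ) : ℂ) =
        ∑ i, (s i : ℂ) * ⟪(e i).toL2, (σ - S - W) (e i).toL2⟫_ℂ +
          ∑ i, (s i : ℂ) * ⟪(e i).toL2, W (e i).toL2⟫_ℂ := by
      simp only [sub_apply, inner_sub_right, mul_sub, Finset.sum_sub_distrib]
      rw [hSsum, hσsum]
      push_cast
      ring
    have h4 : ENNReal.ofReal ((∑ i, |c i|) + a) = ‖(((∑ i, |c i|) + a : ℝ) : ℂ)‖ₑ := by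
      rw [← ofReal_norm, Complex.norm_real, Real.norm_of_nonneg (add_nonneg hc ha0)]
    rw [h4, h3]
    exact (enorm_add_le _ _).trans (add_le_add h1 (h2.trans hW))

end JumpPart

/-! ### The maximal operator -/

section MaximalOperator

variable {d m : ℕ}

namespace FormEq

variable {κ : Type*} [Fintype κ] {Y : Module.End ℂ (Test d)} {A : κ → Module.End ℂ (Test d)}
  {ρ ρ' T T' : BoundedOp d}

theorem sub (h : FormEq Y A ρ T) (h' : FormEq Y A ρ' T') : FormEq Y A (ρ - ρ') (T - T') :=
  fun f g => by
  simp only [sub_apply, inner_sub_right, h f g, h' f g, Finset.sum_sub_distrib]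
  ring

/-- The form passes to limits in the operator norm, because its coefficients act on the test
functions only. -/
theorem of_tendsto {α : Type*} {l : Filter α} [l.NeBot] {σ S : α → BoundedOp d}
    (hσ : Tendsto σ l (𝓝 ρ)) (hS : Tendsto S l (𝓝 T)) (h : ∀ n, FormEq Y A (σ n) (S n)) :
    FormEq Y A ρ T := fun f g => by
  have key : ∀ {B : α → BoundedOp d} {B₀ : BoundedOp d}, Tendsto B l (𝓝 B₀) → ∀ u v : L2 d,
      Tendsto (fun n => ⟪u, B n v⟫_ℂ) l (𝓝 ⟪u, B₀ v⟫_ℂ) := fun hB u v =>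
    tendsto_const_nhds.inner
      (((ContinuousLinearMap.apply ℂ (L2 d) v).continuous.tendsto _).comp hB)
  refine tendsto_nhds_unique ((key hS f.toL2 g.toL2).congr fun n => h n f g) ?_
  exact ((key hσ _ _).add (key hσ _ _)).add (tendsto_finsetSum _ fun j _ => key hσ _ _)

end FormEq

theorem tendsto_of_tendsto_nuc {α : Type*} {l : Filter α} {B : α → BoundedOp d}
    {B₀ : BoundedOp d} (h : Tendsto (fun n => nuc (B₀ - B n)) l (𝓝 0)) : Tendsto B l (𝓝 B₀) := by
  rw [tendsto_iff_edist_tendsto_0]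
  refine tendsto_of_tendsto_of_tendsto_of_le_of_le tendsto_const_nhds h (fun _ => zero_le)
    fun n => ?_
  rw [edist_comm, edist_eq_enorm_sub]
  exact enorm_le_nuc _

namespace Coefficients

variable (Q : Coefficients d m)

/-- The jump part of the generator is relatively bounded by `Z` with constant `1`, hence the domain
of `Z` is contained in the domain of the maximal operator. -/
theorem domZ_subset_domL (φ : Mollifier d) (χ : Cutoff d) : Q.domZ ⊆ Q.domL := by
  rintro ρ ⟨hρ, T, hT, hZ⟩
  have hform := Q.zEq_iff_formEq.1 hZ
  obtain ⟨ε, -, hε0, hεlim⟩ := exists_seq_strictAnti_tendsto' (zero_lt_one' ℝ≥0∞)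
  have happ := fun n => exists_isFiniteRankTest_approx φ χ Q.yAdjEnd_mem
    (A := fun j : Fin 0 => j.elim0) (fun j => j.elim0) hρ hT hform (hε0 n).1
  choose σ hσ S hS hfr hSform hρσ hTS using happ
  choose W hW hWform hWle using fun n => Q.exists_jumpPart (hfr n)
  -- the jump part depends linearly on `σ`, so that it may be estimated on differences
  have hdiff : ∀ n k, nuc (W n - W k) ≤ nuc (S n - S k) := fun n k => by
    obtain ⟨W', -, hW', hle⟩ := Q.exists_jumpPart ((hfr n).sub (hfr k))
    have : W' = W n - W k := ext_of_inner_toL2 fun f g => by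
      simp only [hW', sub_apply, inner_sub_right, hWform, Finset.sum_sub_distrib]
    rw [← this]
    exact (hle _ ((hSform n).sub (hSform k))).1
  have hcau : CauchySeq fun n => SATraceClass.ofMem (hW n) := by
    rw [EMetric.cauchySeq_iff]
    intro δ hδ
    obtain ⟨N, hN⟩ := eventually_atTop.1
      (hεlim.eventually (gt_mem_nhds (ENNReal.half_pos hδ.ne')))
    refine ⟨N, fun n hn k hk => ?_⟩
    rw [edist_eq_enorm_sub, SATraceClass.enorm_eq, SATraceClass.toOp_sub]
    refine (hdiff n k).trans_lt ?_
    rw [← ENNReal.add_halves δ, ← sub_sub_sub_cancel_left (S k) (S n) T, ← nuc_neg, neg_sub]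
    refine (nuc_sub_le _ _).trans_lt ?_
    exact ENNReal.add_lt_add ((hTS _).trans (hN _ (by assumption)))
      ((hTS _).trans (hN _ (by assumption)))
  obtain ⟨W₀, hW₀⟩ := cauchySeq_tendsto_of_complete hcau
  have hlim : ∀ {B : ℕ → BoundedOp d} {B₀ : BoundedOp d}, (∀ n, nuc (B₀ - B n) < ε n) →
      Tendsto B atTop (𝓝 B₀) := fun h =>
    tendsto_of_tendsto_nuc (tendsto_of_tendsto_of_tendsto_of_le_of_le tendsto_const_nhds hεlim
      (fun _ => zero_le) fun n => (h n).le)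
  have hWlim : Tendsto W atTop (𝓝 W₀.toOp) := by
    refine tendsto_of_tendsto_nuc ?_
    have h := tendsto_iff_edist_tendsto_0.1 hW₀
    refine h.congr fun n => ?_
    rw [edist_comm, edist_eq_enorm_sub, SATraceClass.enorm_eq]
    rfl
  refine ⟨T + W₀.toOp, hρ, add_mem_saTraceClass hT W₀.toOp_mem, Q.lEq_iff_formEq.2 ?_⟩
  refine FormEq.of_tendsto (hlim hρσ) ((hlim hTS).add hWlim) fun n f g => ?_
  have h := hSform n f g
  rw [Fin.sum_univ_zero, add_zero] at h
  rw [add_apply, inner_add_right, h, hWform]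

/-- The operator `1 - 𝓛` is injective on the domain of the maximal operator: it expands the trace
norm on the core of finite-rank operators, by `exists_jumpPart`. -/
theorem eq_zero_of_formEq_self (φ : Mollifier d) (χ : Cutoff d) {δ : BoundedOp d}
    (hδ : δ ∈ selfAdjointTraceClass (L2 d)) (h : FormEq Q.yAdjEnd Q.lindbladAdjEnd δ δ) :
    δ = 0 := by
  have hle : ∀ ε : ℝ≥0∞, 0 < ε → nuc δ ≤ 3 * ε := fun ε hε => by
    obtain ⟨σ, -, S, -, hfr, hS, h1, h2⟩ :=
      exists_isFiniteRankTest_approx φ χ Q.yAdjEnd_mem Q.lindbladAdjEnd_mem hδ hδ h hε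
    obtain ⟨W, -, hW, hest⟩ := Q.exists_jumpPart hfr
    have hZ : FormEq Q.yAdjEnd (fun j : Fin 0 => j.elim0) σ (S - W) := fun f g => by
      rw [sub_apply, inner_sub_right, hS f g, hW, Fin.sum_univ_zero, add_zero, add_sub_cancel_right]
    have h3 := (hest _ hZ).2
    rw [sub_sub, sub_add_cancel] at h3
    calc nuc δ = nuc (δ - σ + σ) := by rw [sub_add_cancel]
      _ ≤ nuc (δ - σ) + nuc (σ - S) := (nuc_add_le _ _).trans (add_le_add le_rfl h3)
      _ ≤ nuc (δ - σ) + (nuc (δ - S) + nuc (δ - σ)) := by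
        refine add_le_add le_rfl ?_
        rw [← sub_sub_sub_cancel_left S σ δ]
        exact nuc_sub_le _ _
      _ ≤ ε + (ε + ε) := add_le_add h1.le (add_le_add h2.le h1.le)
      _ = 3 * ε := by ring
  have h0 : nuc δ = 0 := by
    refine nonpos_iff_eq_zero.1 (le_of_forall_gt_imp_ge_of_dense fun a ha => ?_)
    refine (hle (a / 3) (ENNReal.div_pos ha.ne' (by norm_num))).trans ?_
    exact ENNReal.mul_div_le
  have h1 : ‖δ‖ₑ = 0 := nonpos_iff_eq_zero.1 (h0 ▸ enorm_le_nuc δ)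
  rw [← ofReal_norm, ENNReal.ofReal_eq_zero] at h1
  exact norm_le_zero_iff.1 h1

theorem mem_maxGraph_iff {ρ T : BoundedOp d} : (ρ, T) ∈ Q.maxGraph ↔
    ρ ∈ selfAdjointTraceClass (L2 d) ∧ T ∈ selfAdjointTraceClass (L2 d) ∧
      FormEq Q.yAdjEnd Q.lindbladAdjEnd ρ T := by
  rw [← Q.lEq_iff_formEq]
  rfl

theorem allMollifiedOps_subset_domZ (φ : Mollifier d) (χ : Cutoff d) :
    allMollifiedOps φ χ ⊆ Q.domZ := by
  intro σ hσ
  obtain ⟨n, hn⟩ := Set.mem_iUnion.1 hσ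
  obtain ⟨hmem, ρ, hρ, rfl⟩ := mem_mollifiedOps_iff.1 hn
  obtain ⟨E₀, G, hE₀, hG⟩ := exists_realizations φ χ Q.yAdjEnd_mem
    (A := fun j : Fin 0 => j.elim0) (fun j => j.elim0) n
  exact ⟨hmem, _, formOp_mem _ E₀ G hρ,
    Q.zEq_iff_formEq.2 (formEq_formOp (smoothing_toL2 φ χ n) hE₀ hG ρ)⟩

/-- The graph of the maximal operator is closed in the trace norm. -/
theorem mem_maxGraph_of_tendsto {ρ T : BoundedOp d} {σ S : ℕ → BoundedOp d}
    (h : ∀ n, (σ n, S n) ∈ Q.maxGraph)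
    (hlim : Tendsto (fun n => traceNorm (ρ - σ n) + traceNorm (T - S n)) atTop (𝓝 0)) :
    (ρ, T) ∈ Q.maxGraph := by
  have key : ∀ {B : ℕ → BoundedOp d} {B₀ : BoundedOp d},
      (∀ n, B n ∈ selfAdjointTraceClass (L2 d)) →
      Tendsto (fun n => traceNorm (B₀ - B n)) atTop (𝓝 0) →
      B₀ ∈ selfAdjointTraceClass (L2 d) ∧ Tendsto B atTop (𝓝 B₀) := by
    intro B B₀ hB hB₀
    have hop : Tendsto B atTop (𝓝 B₀) := by
      rw [tendsto_iff_edist_tendsto_0]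
      refine tendsto_of_tendsto_of_tendsto_of_le_of_le tendsto_const_nhds hB₀ (fun _ => zero_le)
        fun n => ?_
      rw [edist_comm, edist_eq_enorm_sub]
      exact enorm_le_traceNorm _
    have hsa := isSelfAdjoint_of_tendsto hop fun n => (hB n).1
    refine ⟨mem_selfAdjointTraceClass_iff.2 ⟨hsa, ?_⟩, hop⟩
    obtain ⟨n, hn⟩ := (hB₀.eventually (gt_mem_nhds ENNReal.zero_lt_top)).exists
    rw [traceNorm_eq_nuc (hsa.sub (hB n).1)] at hn
    rw [← sub_add_cancel B₀ (B n)]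
    exact ne_top_of_le_ne_top
      (ENNReal.add_ne_top.2 ⟨hn.ne, (mem_selfAdjointTraceClass_iff.1 (hB n)).2⟩) (nuc_add_le _ _)
  have h1 := key (fun n => (h n).1) (tendsto_of_tendsto_of_tendsto_of_le_of_le tendsto_const_nhds
    hlim (fun _ => zero_le) fun n => le_self_add)
  have h2 := key (fun n => (h n).2.1) (tendsto_of_tendsto_of_tendsto_of_le_of_le
    tendsto_const_nhds hlim (fun _ => zero_le) fun n => le_add_self)
  exact Q.mem_maxGraph_iff.2 ⟨h1.1, h2.1,
    FormEq.of_tendsto h1.2 h2.2 fun n => (Q.mem_maxGraph_iff.1 (h n)).2.2⟩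

theorem exists_tendsto_of_mem_maxGraph (φ : Mollifier d) (χ : Cutoff d) {ρ T : BoundedOp d}
    (h : (ρ, T) ∈ Q.maxGraph) : ∃ σ S : ℕ → BoundedOp d,
      (∀ n, σ n ∈ allMollifiedOps φ χ ∧ (σ n, S n) ∈ Q.maxGraph) ∧
      Tendsto (fun n => traceNorm (ρ - σ n) + traceNorm (T - S n)) atTop (𝓝 0) := by
  obtain ⟨hρ, hT, hform⟩ := Q.mem_maxGraph_iff.1 h
  choose E₀ G hE₀ hG using exists_realizations φ χ Q.yAdjEnd_mem Q.lindbladAdjEnd_mem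
  let σ : ℕ+ → BoundedOp d := fun n => (smoothing φ χ n).adjoint ∘L ρ ∘L smoothing φ χ n
  let S : ℕ+ → BoundedOp d := fun n => formOp (smoothing φ χ n) (E₀ n) (G n) ρ
  have hσ : ∀ n, σ n ∈ selfAdjointTraceClass (L2 d) := fun n => conj_mem_saTraceClass hρ _
  have hS : ∀ n, S n ∈ selfAdjointTraceClass (L2 d) := fun n => formOp_mem _ _ _ hρ
  have hσS : ∀ n, FormEq Q.yAdjEnd Q.lindbladAdjEnd (σ n) (S n) := fun n =>
    formEq_formOp (smoothing_toL2 φ χ n) (hE₀ n) (hG n) ρ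
  obtain ⟨C, hC⟩ := exists_norm_smoothing_le φ χ
  have hlim := (tendsto_nuc_sub_of_adjoint hρ hC (tendsto_adjoint_smoothing φ χ)).add
    (tendsto_nuc_sub_formOp φ χ Q.yAdjEnd_mem Q.lindbladAdjEnd_mem hρ hT hform hσS)
  rw [add_zero] at hlim
  refine ⟨fun n => σ n.succPNat, fun n => S n.succPNat, fun n => ⟨?_, ?_⟩, ?_⟩
  · exact Set.mem_iUnion.2 ⟨_, mem_mollifiedOps_iff.2 ⟨hσ _, ρ, hρ, rfl⟩⟩
  · exact Q.mem_maxGraph_iff.2 ⟨hσ _, hS _, hσS _⟩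
  · have hsucc : Tendsto Nat.succPNat atTop atTop :=
      OrderIso.pnatIsoNat.symm.tendsto_atTop
    refine (hlim.comp hsucc).congr fun n => ?_
    rw [Function.comp_apply, traceNorm_eq_nuc (hρ.1.sub (hσ _).1),
      traceNorm_eq_nuc (hT.1.sub (hS _).1)]

/-- A generator which acts as `𝓛` is maximal: `1 - G` is onto while `1 - 𝓛` is injective. -/
theorem generatorGraph_eq_maxGraph (φ : Mollifier d) (χ : Cutoff d)
    {Φ : ℝ → BoundedOp d → BoundedOp d} (hΦ : IsContractionSemigroup Φ)
    (h : generatorGraph Φ ⊆ Q.maxGraph) : generatorGraph Φ = Q.maxGraph := by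
  classical
  refine h.antisymm ?_
  rintro ⟨ρ, T⟩ hp
  obtain ⟨hρ, hT, hform⟩ := Q.mem_maxGraph_iff.1 hp
  -- the restriction of `Φ t` to the Banach space `SATraceClass`, extended by `0` to `t < 0`
  let Ψ : ℝ → SATraceClass (L2 d) → SATraceClass (L2 d) := fun t A =>
    if ht : 0 ≤ t then SATraceClass.ofMem (hΦ.mem t ht A.toOp A.toOp_mem) else 0
  have hΨ : ∀ t, 0 ≤ t → ∀ A, (Ψ t A).toOp = Φ t A.toOp := fun t ht A => by
    simp only [Ψ, dif_pos ht, SATraceClass.toOp_ofMem]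
  have hpos : ∀ᶠ t in 𝓝[>] (0 : ℝ), 0 ≤ t := by
    filter_upwards [self_mem_nhdsWithin] with t ht using le_of_lt ht
  obtain ⟨x, hx⟩ := exists_generator_resolvent (Φ := Ψ)
    (fun t ht A B => SATraceClass.toOp_injective (by
      rw [hΨ t ht, SATraceClass.toOp_add, SATraceClass.toOp_add, hΨ t ht, hΨ t ht,
        hΦ.map_add t ht _ A.toOp_mem _ B.toOp_mem]))
    (fun t ht c A => SATraceClass.toOp_injective (by
      rw [hΨ t ht, SATraceClass.toOp_smul, SATraceClass.toOp_smul, hΨ t ht]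
      exact hΦ.map_smul t ht c _ A.toOp_mem))
    (fun A => SATraceClass.toOp_injective (by rw [hΨ 0 le_rfl, hΦ.zero _ A.toOp_mem]))
    (fun s t hs ht A => SATraceClass.toOp_injective (by
      rw [hΨ _ (add_nonneg hs ht), hΨ s hs, hΨ t ht, hΦ.add s t hs ht _ A.toOp_mem]))
    (fun t ht A => by
      have := hΦ.contraction t ht _ A.toOp_mem
      rw [← hΨ t ht, ← SATraceClass.enorm_eq_traceNorm, ← SATraceClass.enorm_eq_traceNorm] at this
      rwa [← ofReal_norm, ← ofReal_norm, ENNReal.ofReal_le_ofReal_iff (norm_nonneg _)] at this)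
    (fun A => by
      have h1 := hΦ.continuous _ A.toOp_mem
      have h2 : Tendsto (fun t => ‖Ψ t A - A‖ₑ) (𝓝[>] 0) (𝓝 0) := by
        refine h1.congr' ?_
        filter_upwards [hpos] with t ht
        rw [← hΨ t ht, ← SATraceClass.toOp_sub, SATraceClass.enorm_eq_traceNorm]
      rw [← tendsto_zero_iff_norm_tendsto_zero]
      exact tendsto_zero_iff_enorm_tendsto_zero.2 h2)
    (SATraceClass.ofMem (sub_mem_saTraceClass hρ hT))
  have hgen : (x.toOp, x.toOp - (ρ - T)) ∈ generatorGraph Φ := by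
    refine ⟨x.toOp_mem, sub_mem_saTraceClass x.toOp_mem (sub_mem_saTraceClass hρ hT), ?_⟩
    have h1 := tendsto_iff_edist_tendsto_0.1 hx
    refine h1.congr' ?_
    filter_upwards [hpos] with t ht
    rw [edist_eq_enorm_sub, SATraceClass.enorm_eq_traceNorm, SATraceClass.toOp_sub,
      SATraceClass.toOp_smul, SATraceClass.toOp_sub, hΨ t ht]
    rfl
  have hxform := (Q.mem_maxGraph_iff.1 (h hgen)).2.2
  have hδ := hform.sub hxform
  rw [show T - (x.toOp - (ρ - T)) = ρ - x.toOp by abel] at hδ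
  have h0 : ρ - x.toOp = 0 :=
    Q.eq_zero_of_formEq_self φ χ (sub_mem_saTraceClass hρ x.toOp_mem) hδ
  have hρx : x.toOp = ρ := (sub_eq_zero.1 h0).symm
  rwa [hρx, sub_sub_cancel] at hgen

end Coefficients

/-- The smoothed operators are dense in the self-adjoint trace class operators. -/
theorem exists_mem_allMollifiedOps_traceNorm_sub_lt (φ : Mollifier d) (χ : Cutoff d)
    {ρ : BoundedOp d} (hρ : ρ ∈ selfAdjointTraceClass (L2 d)) {ε : ℝ≥0∞} (hε : 0 < ε) :
    ∃ σ ∈ allMollifiedOps φ χ, traceNorm (ρ - σ) < ε := by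
  obtain ⟨C, hC⟩ := exists_norm_smoothing_le φ χ
  obtain ⟨n, hn⟩ := ((tendsto_nuc_sub_of_adjoint hρ hC
    (tendsto_adjoint_smoothing φ χ)).eventually (gt_mem_nhds hε)).exists
  have hσ := conj_mem_saTraceClass hρ (smoothing φ χ n)
  refine ⟨_, Set.mem_iUnion.2 ⟨n, mem_mollifiedOps_iff.2 ⟨hσ, ρ, hρ, rfl⟩⟩, ?_⟩
  rwa [traceNorm_eq_nuc (hρ.1.sub hσ.1)]

end MaximalOperator

end QuantumLindblad

end

theorem mainTheorem4 (d m : ℕ) (φ : Mollifier d) (χ : Cutoff d) (Q : Coefficients d m) :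
    -- `𝒟_∞` is dense in `𝒥₁ˢ` for the trace norm
    (allMollifiedOps φ χ ⊆ selfAdjointTraceClass (L2 d) ∧
      ∀ ρ ∈ selfAdjointTraceClass (L2 d), ∀ ε : ℝ≥0∞, 0 < ε →
        ∃ σ ∈ allMollifiedOps φ χ, traceNorm (ρ - σ) < ε) ∧
    -- `𝒟_∞ ⊆ 𝒟(Z) ⊆ 𝒟(𝓛)`
    (allMollifiedOps φ χ ⊆ Q.domZ ∧ Q.domZ ⊆ Q.domL) ∧
    -- the closure of the graph of `𝓛` on `𝒟_∞` is the graph of the maximal operator `𝓛`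
    (∀ ρ T : BoundedOp d, (ρ, T) ∈ Q.maxGraph ↔
      ∃ σ S : ℕ → BoundedOp d,
        (∀ n, σ n ∈ allMollifiedOps φ χ ∧ (σ n, S n) ∈ Q.maxGraph) ∧
        Tendsto (fun n => traceNorm (ρ - σ n) + traceNorm (T - S n)) atTop (𝓝 0)) ∧
    -- a generator of a contraction semigroup that acts as `𝓛` is the maximal operator `𝓛`
    (∀ Φ : ℝ → BoundedOp d → BoundedOp d, IsContractionSemigroup Φ →
      generatorGraph Φ ⊆ Q.maxGraph → generatorGraph Φ = Q.maxGraph) := by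
  refine ⟨⟨fun σ hσ => (Q.allMollifiedOps_subset_domZ φ χ hσ).1, fun ρ hρ ε hε =>
    exists_mem_allMollifiedOps_traceNorm_sub_lt φ χ hρ hε⟩,
    ⟨Q.allMollifiedOps_subset_domZ φ χ, Q.domZ_subset_domL φ χ⟩, fun ρ T =>
    ⟨Q.exists_tendsto_of_mem_maxGraph φ χ, ?_⟩, fun Φ hΦ h =>
    Q.generatorGraph_eq_maxGraph φ χ hΦ h⟩
  rintro ⟨σ, S, hσS, hlim⟩
  exact Q.mem_maxGraph_of_tendsto (fun n => (hσS n).2) hlim
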